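/- Let $N\ge 3$ be an integer, $\alpha\in(0,N)$, $p,q>1$ real numbers and $K>0$ a constant. Consider the system $$ \left\{ \begin{aligned} -\Delta u+u+K\phi |u|^{q-2}u&=(I_\alpha*|u|^p)|u|^{p-2}u &&\text{in }\mathbb R^N,\\ -\Delta \phi&=K|u|^q&&\text{in }\mathbb R^N, \end{aligned} \right. $$ for real-valued $u,\phi$, understood in the weak sense (tested against $C_c^\infty(\mathbb R^N)$), where $I_\alpha(x)=A_\alpha|x|^{-(N-\alpha)}$ with $A_\alpha=\Gamma\big(\tfrac{N-\alpha}{2}\big)\big/\big(\Gamma(\tfrac{\alpha}{2})\,\pi^{N/2}\,2^\alpha\big)$ is the Riesz potential. Assume that one of the following two conditions holds: 1. $p\ge\frac{N+\alpha}{N-2}$ and $\frac{N+\alpha}{p}\le\frac{N+2}{q}$; 2. $p\le\frac{N+\alpha}{N}$ and $\frac{N+\alpha}{p}>\frac{N+2}{q}$. Then the only solution $(u,\phi)$ of the system which satisfies $$ u\in H^1(\mathbb R^N)\cap L^{\frac{2Np}{N+\alpha}}(\mathbb R^N),\qquad \phi\in H^1(\mathbb R^N), $$ $$ K|u|^q\in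 L^{\frac{2N}{N+2}}(\mathbb R^N),\qquad |\nabla u|\in H^1_{loc}(\mathbb R^N)\cap L^{\frac{2Np}{N+\alpha}}_{loc}(\mathbb R^N) $$ is the trivial one, $u=\phi=0$ almost everywhere. -/

import Mathlib

open MeasureTheory
open scoped ContDiff ENNReal

noncomputable section

namespace ChoquardSP

/-- The Euclidean space `ℝᴺ`. -/
abbrev E (N : ℕ) : Type := EuclideanSpace ℝ (Fin N)

/-- Test functions: the class `C_c^∞(ℝᴺ)`. -/
def IsTest {N : ℕ} (η : E N → ℝ) : Prop :=
  ContDiff ℝ ∞ η ∧ HasCompactSupport η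

/-- `G` is the weak (distributional) gradient of `f`: both are locally integrable and
`∫ f ∂ᵥη = - ∫ η (G · v)` for all test functions `η` and all directions `v`. -/
def HasWeakGradient {N : ℕ} (f : E N → ℝ) (G : E N → E N) : Prop :=
  LocallyIntegrable f volume ∧ LocallyIntegrable G volume ∧
    ∀ η : E N → ℝ, IsTest η → ∀ v : E N,
      ∫ x, f x * fderiv ℝ η x v = - ∫ x, η x * inner ℝ (G x) v

/-- The space `L^s_loc(ℝᴺ)`. -/
def MemLpLoc {N : ℕ} {F : Type*} [NormedAddCommGroup F] (f : E N → F) (s : ℝ≥0∞) : Prop :=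
  ∀ C : Set (E N), IsCompact C → MemLp f s (volume.restrict C)

/-- The Sobolev space `H¹(ℝᴺ)`. -/
def MemH1 {N : ℕ} (f : E N → ℝ) : Prop :=
  MemLp f 2 volume ∧ ∃ G : E N → E N, HasWeakGradient f G ∧ MemLp G 2 volume

/-- The local Sobolev space `H¹_loc(ℝᴺ)`. -/
def MemH1Loc {N : ℕ} (f : E N → ℝ) : Prop :=
  MemLpLoc f 2 ∧ ∃ G : E N → E N, HasWeakGradient f G ∧ MemLpLoc G 2

/-- The Riesz potential `I_α(x) = A_α / |x|^{N-α}`, where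
`A_α = Γ((N-α)/2) / (Γ(α/2) π^{N/2} 2^α)`. -/
def riesz (N : ℕ) (α : ℝ) (x : E N) : ℝ :=
  (Real.Gamma (((N : ℝ) - α) / 2) /
      (Real.Gamma (α / 2) * Real.pi ^ ((N : ℝ) / 2) * (2 : ℝ) ^ α)) /
    ‖x‖ ^ ((N : ℝ) - α)

/-- The convolution `I_α * f`. -/
def rieszConv {N : ℕ} (α : ℝ) (f : E N → ℝ) (x : E N) : ℝ :=
  ∫ y, riesz N α (x - y) * f y

/-- `(u, φ)` is a weak solution of the system
`-Δu + u + K φ |u|^{q-2} u = (I_α * |u|^p) |u|^{p-2} u`, `-Δφ = K |u|^q` in `ℝᴺ`.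
Here `fderiv ℝ η x (Du x)` is `∇u · ∇η`, and similarly for `φ`. Under the regularity conditions
`IsRegular` below, all the integrals converge. -/
def IsWeakSolution {N : ℕ} (α p q : ℝ) (K u φ : E N → ℝ) : Prop :=
  ∃ Du Dφ : E N → E N, HasWeakGradient u Du ∧ HasWeakGradient φ Dφ ∧
    (∀ η : E N → ℝ, IsTest η →
      (∫ x, fderiv ℝ η x (Du x)) + (∫ x, u x * η x) +
          (∫ x, K x * φ x * (|u x| ^ (q - 2) * u x) * η x) =
        ∫ x, rieszConv α (fun y => |u y| ^ p) x * (|u x| ^ (p - 2) * u x) * η x) ∧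
    (∀ η : E N → ℝ, IsTest η →
      ∫ x, fderiv ℝ η x (Dφ x) = ∫ x, K x * |u x| ^ q * η x)

/-- The regularity class: `u ∈ H¹ ∩ L^{2Np/(N+α)}`, `φ ∈ H¹`, `K |u|^q ∈ L^{2N/(N+2)}`,
`|∇u| ∈ H¹_loc ∩ L^{2Np/(N+α)}_loc`. -/
def IsRegular {N : ℕ} (α p q : ℝ) (K u φ : E N → ℝ) : Prop :=
  MemH1 u ∧
    MemLp u (ENNReal.ofReal (2 * N * p / (N + α))) volume ∧
    MemH1 φ ∧
    MemLp (fun x => K x * |u x| ^ q) (ENNReal.ofReal (2 * N / (N + 2))) volume ∧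
    ∃ Du : E N → E N, HasWeakGradient u Du ∧
      MemH1Loc (fun x => ‖Du x‖) ∧
      MemLpLoc (fun x => ‖Du x‖) (ENNReal.ofReal (2 * N * p / (N + α)))

end ChoquardSP

end

/-!
Multiply the first equation by `⟪∇u, x⟫`, the infinitesimal generator of the dilations
`l ↦ u (l • x)`, and use the second equation for `φ`: this gives the Pohožaev identity
`(N-2)/2 ∫ |∇u|² + N/2 ∫ u² + (N+2)/(2q) ∫ |∇φ|² = (N+α)/(2p) ∫ (I_α * |u|^p) |u|^p`.
Multiplying by `u` instead gives the Nehari identity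
`∫ |∇u|² + ∫ u² + ∫ |∇φ|² = ∫ (I_α * |u|^p) |u|^p`. Eliminating the right-hand side leaves
`((N-2) - (N+α)/p) ∫ |∇u|² + (N - (N+α)/p) ∫ u² + ((N+2)/q - (N+α)/p) ∫ |∇φ|² = 0`,
and the assumption on `p` and `q` makes all three coefficients of one sign.

Since `⟪∇u, x⟫` itself is too singular in the coupling term, the multiplier is the difference
`η (u (l • x) - u x)` with a cutoff `η ≥ 0`, differentiated at `l = 1`. Convexity of `|·|^q`
together with `K φ ≥ 0` bounds the coupling term from one side; a function of `l` dominated by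
another that touches it at the interior point `l = 1` has the same derivative there.
-/

noncomputable section

namespace ChoquardSP

open Filter Topology Set Metric

variable {N : ℕ}

lemma contDiff_gradient {ζ : E N → ℝ} (hζ : ContDiff ℝ ∞ ζ) : ContDiff ℝ ∞ (gradient ζ) :=
  (InnerProductSpace.toDual ℝ (E N)).symm.toContinuousLinearEquiv.contDiff.comp
    (hζ.fderiv_right (m := ∞) (by simp))

lemma contDiff_fderiv_apply {ζ : E N → ℝ} (hζ : ContDiff ℝ ∞ ζ) (v : E N) :
    ContDiff ℝ ∞ (fun x => fderiv ℝ ζ x v) :=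
  (hζ.fderiv_right (m := ∞) (by simp)).clm_apply contDiff_const

lemma norm_gradient (ζ : E N → ℝ) (x : E N) : ‖gradient ζ x‖ = ‖fderiv ℝ ζ x‖ := by
  simp [gradient]

lemma fderiv_comp_const_smul {η : E N → ℝ} (hη : Differentiable ℝ η) (l : ℝ) (x v : E N) :
    fderiv ℝ (fun x => η (l • x)) x v = l * fderiv ℝ η (l • x) v := by
  have : HasFDerivAt (fun x => η (l • x)) _ x :=
    (hη (l • x)).hasFDerivAt.comp x ((hasFDerivAt_id x).const_smul l)
  rw [this.fderiv]
  simp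

lemma sum_apply_smul_single (x : E N) : ∑ i, x i • EuclideanSpace.single i (1 : ℝ) = x := by
  ext j
  simp [Finset.sum_apply, Pi.single_apply]

namespace IsTest

variable {η ζ : E N → ℝ}

lemma continuous (h : IsTest η) : Continuous η := h.1.continuous

lemma differentiable (h : IsTest η) : Differentiable ℝ η := h.1.differentiable (by simp)

lemma fderiv_apply (h : IsTest η) (v : E N) : IsTest (fun x => fderiv ℝ η x v) :=
  ⟨contDiff_fderiv_apply h.1 v, h.2.fderiv_apply ℝ v⟩

lemma contDiff_mul (h : IsTest η) (hζ : ContDiff ℝ ∞ ζ) : IsTest (fun x => ζ x * η x) :=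
  ⟨hζ.mul h.1, h.2.mul_left⟩

lemma comp_smul (hη : IsTest η) {l : ℝ} (hl : l ≠ 0) : IsTest (fun x => η (l • x)) :=
  ⟨hη.1.comp (contDiff_const_smul l), hη.2.comp_homeomorph (Homeomorph.smulOfNeZero l hl)⟩

lemma comp_sub (hη : IsTest η) (x : E N) : IsTest (fun t => η (x - t)) :=
  ⟨hη.1.comp (contDiff_const.sub contDiff_id), hη.2.comp_homeomorph (Homeomorph.subLeft x)⟩

lemma continuous_gradient (h : IsTest η) : Continuous (gradient η) :=
  (contDiff_gradient h.1).continuous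

lemma hasCompactSupport_gradient (h : IsTest η) : HasCompactSupport (gradient η) :=
  (h.2.fderiv ℝ).comp_left (g := (InnerProductSpace.toDual ℝ (E N)).symm) (map_zero _)

lemma hasCompactSupport_fderiv_self (hη : IsTest η) :
    HasCompactSupport (fun x => fderiv ℝ η x x) :=
  (hη.2.fderiv ℝ).mono fun x hx => by
    contrapose! hx
    simp [Function.notMem_support.1 hx]

lemma continuous_fderiv_self (hη : IsTest η) : Continuous (fun x => fderiv ℝ η x x) :=
  (hη.1.continuous_fderiv (by simp)).clm_apply continuous_id

lemma sum_fderiv_apply_mul_single (hη : IsTest η) (x : E N) :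
    ∑ i, fderiv ℝ (fun y : E N => y i * η y) x (EuclideanSpace.single i 1) =
      N * η x + fderiv ℝ η x x := by
  have hd : ∀ i : Fin N, fderiv ℝ (fun y : E N => y i * η y) x (EuclideanSpace.single i 1) =
      fderiv ℝ η x (x i • EuclideanSpace.single i 1) + η x := fun i => by
    have hi : HasFDerivAt (fun y : E N => y i) (EuclideanSpace.proj (𝕜 := ℝ) i) x :=
      (EuclideanSpace.proj (𝕜 := ℝ) i).hasFDerivAt
    rw [(hi.fun_mul (hη.differentiable x).hasFDerivAt).fderiv]
    simp
  simp only [hd]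
  rw [Finset.sum_add_distrib, ← map_sum, sum_apply_smul_single, add_comm]
  simp

end IsTest

lemma integrable_mul_of_hasCompactSupport {f η : E N → ℝ} (hf : LocallyIntegrable f volume)
    (hη : Continuous η) (hc : HasCompactSupport η) : Integrable (fun x => f x * η x) := by
  simpa using hf.integrable_smul_right_of_hasCompactSupport hη hc

lemma integrable_mul_inner_of_hasCompactSupport {G : E N → E N} {η : E N → ℝ}
    (hG : LocallyIntegrable G volume) (hη : Continuous η) (hc : HasCompactSupport η) (v : E N) :
    Integrable (fun x => η x * inner ℝ (G x) v) := by
  simpa only [inner_smul_left, conj_trivial] using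
    (hG.integrable_smul_left_of_hasCompactSupport hη hc).inner_const (𝕜 := ℝ) v

lemma locallyIntegrable_comp_smul {F : Type*} [NormedAddCommGroup F] {f : E N → F}
    (hf : LocallyIntegrable f volume) {l : ℝ} (hl : l ≠ 0) :
    LocallyIntegrable (fun x => f (l • x)) volume := by
  rw [locallyIntegrable_iff] at hf ⊢
  intro k hk
  have hk' : IsCompact ((l • ·) '' k : Set (E N)) := hk.image (continuous_const_smul l)
  have h := (integrable_indicator_iff hk'.measurableSet).2 (hf _ hk')
  refine (integrable_indicator_iff hk.measurableSet).1
    ((h.comp_smul hl).congr (.of_forall fun x => ?_))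
  simp only [← indicator_comp_right, (smul_right_injective (E N) hl).preimage_image,
    Function.comp_def]

namespace HasWeakGradient

variable {f g : E N → ℝ} {F G : E N → E N}

lemma zero : HasWeakGradient (fun _ : E N => (0 : ℝ)) (fun _ => 0) :=
  ⟨locallyIntegrable_zero, locallyIntegrable_zero, fun η _ v => by simp⟩

lemma congr (h : HasWeakGradient f F) (hfg : f =ᵐ[volume] g) (hFG : F =ᵐ[volume] G) :
    HasWeakGradient g G := by
  refine ⟨h.1.congr hfg, h.2.1.congr hFG, fun η hη v => ?_⟩
  have e1 : ∫ x, g x * fderiv ℝ η x v = ∫ x, f x * fderiv ℝ η x v :=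
    integral_congr_ae (hfg.mono fun x hx => by simp only [hx])
  have e2 : ∫ x, η x * inner ℝ (G x) v = ∫ x, η x * inner ℝ (F x) v :=
    integral_congr_ae (hFG.mono fun x hx => by simp only [hx])
  rw [e1, e2, h.2.2 η hη v]

lemma unique (h : HasWeakGradient f F) (h' : HasWeakGradient f G) : F =ᵐ[volume] G := by
  refine ae_eq_of_integral_contDiff_smul_eq h.2.1 h'.2.1 fun g hg hg2 => ?_
  refine ext_inner_right ℝ fun v => ?_
  have e : ∀ F : E N → E N, LocallyIntegrable F volume →
      inner ℝ (∫ x, g x • F x) v = ∫ x, g x * inner ℝ (F x) v := by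
    intro F hF
    rw [real_inner_comm, ← integral_inner
      (hF.integrable_smul_left_of_hasCompactSupport hg.continuous hg2)]
    simp [inner_smul_right, real_inner_comm]
  rw [e F h.2.1, e G h'.2.1, ← neg_inj, ← h.2.2 g ⟨hg, hg2⟩ v, h'.2.2 g ⟨hg, hg2⟩ v]

lemma sub (h : HasWeakGradient f F) (h' : HasWeakGradient g G) :
    HasWeakGradient (fun x => f x - g x) (fun x => F x - G x) := by
  refine ⟨h.1.sub h'.1, h.2.1.sub h'.2.1, fun η hη v => ?_⟩
  have hv := hη.fderiv_apply v
  simp only [sub_mul, inner_sub_left, mul_sub]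
  rw [integral_sub (integrable_mul_of_hasCompactSupport h.1 hv.continuous hv.2)
      (integrable_mul_of_hasCompactSupport h'.1 hv.continuous hv.2),
    integral_sub (integrable_mul_inner_of_hasCompactSupport h.2.1 hη.continuous hη.2 v)
      (integrable_mul_inner_of_hasCompactSupport h'.2.1 hη.continuous hη.2 v),
    h.2.2 η hη v, h'.2.2 η hη v]
  ring

lemma const_mul (h : HasWeakGradient f F) (c : ℝ) :
    HasWeakGradient (fun x => c * f x) (fun x => c • F x) := by
  refine ⟨h.1.smul c, h.2.1.smul c, fun η hη v => ?_⟩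
  simp only [mul_assoc, inner_smul_left, mul_left_comm _ c, conj_trivial]
  rw [integral_const_mul, integral_const_mul, h.2.2 η hη v]
  ring

lemma contDiff_mul {ζ : E N → ℝ} (h : HasWeakGradient f F) (hζ : ContDiff ℝ ∞ ζ) :
    HasWeakGradient (fun x => ζ x * f x) (fun x => ζ x • F x + f x • gradient ζ x) := by
  refine ⟨h.1.continuous_mul hζ.continuous, (h.2.1.continuous_smul hζ.continuous).add
    (h.1.smul_continuous (contDiff_gradient hζ).continuous), fun η hη v => ?_⟩
  have leibniz : ∀ x, fderiv ℝ (fun x => ζ x * η x) x v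
      = ζ x * fderiv ℝ η x v + η x * fderiv ℝ ζ x v := fun x => by
    rw [fderiv_fun_mul (hζ.differentiable (by simp) x) (hη.differentiable x)]
    simp
  have i1 : Integrable fun x => f x * (ζ x * fderiv ℝ η x v) :=
    integrable_mul_of_hasCompactSupport h.1
      (hζ.continuous.mul (hη.fderiv_apply v).continuous) (hη.fderiv_apply v).2.mul_left
  have i2 : Integrable fun x => f x * (η x * fderiv ℝ ζ x v) :=
    integrable_mul_of_hasCompactSupport h.1
      (hη.continuous.mul (contDiff_fderiv_apply hζ v).continuous) hη.2.mul_right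
  have i3 : Integrable fun x => ζ x * η x * inner ℝ (F x) v :=
    integrable_mul_inner_of_hasCompactSupport h.2.1 (hζ.continuous.mul hη.continuous)
      hη.2.mul_left v
  have parts : (∫ x, f x * (ζ x * fderiv ℝ η x v)) + ∫ x, f x * (η x * fderiv ℝ ζ x v) =
      -∫ x, ζ x * η x * inner ℝ (F x) v := by
    rw [← integral_add i1 i2, ← h.2.2 _ (hη.contDiff_mul hζ) v]
    simp only [leibniz, mul_add]
  have split : ∀ x, η x * inner ℝ (ζ x • F x + f x • gradient ζ x) v
      = ζ x * η x * inner ℝ (F x) v + f x * (η x * fderiv ℝ ζ x v) := fun x => by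
    rw [inner_add_left, inner_smul_left, inner_smul_left, inner_gradient_left]
    simp only [conj_trivial]
    ring
  simp only [split, mul_assoc, mul_left_comm (ζ _) (f _)]
  simp only [mul_assoc] at i3 parts
  rw [integral_add i3 i2]
  linarith

lemma comp_smul (h : HasWeakGradient f F) {l : ℝ} (hl : 0 < l) :
    HasWeakGradient (fun x => f (l • x)) (fun x => l • F (l • x)) := by
  refine ⟨locallyIntegrable_comp_smul h.1 hl.ne',
    (locallyIntegrable_comp_smul h.2.1 hl.ne').smul l, fun η hη v => ?_⟩
  have parts := h.2.2 _ (hη.comp_smul (inv_ne_zero hl.ne')) v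
  simp only [fderiv_comp_const_smul hη.differentiable] at parts
  have h1 := Measure.integral_comp_smul volume
    (fun x : E N => f x * (l⁻¹ * fderiv ℝ η (l⁻¹ • x) v)) l
  have h2 := Measure.integral_comp_smul volume
    (fun x : E N => η (l⁻¹ • x) * inner ℝ (F x) v) l
  simp only [smul_smul, inv_mul_cancel₀ hl.ne', one_smul, smul_eq_mul] at h1 h2
  rw [parts] at h1
  simp only [mul_left_comm _ l⁻¹] at h1
  rw [integral_const_mul] at h1
  simp only [inner_smul_left, mul_left_comm _ l, conj_trivial]
  rw [integral_const_mul, h2, ← mul_right_inj' (inv_ne_zero hl.ne'), h1]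
  field_simp

lemma integral_mul_sum_fderiv (h : HasWeakGradient f F) {ι : Type*} (s : Finset ι)
    {η : ι → E N → ℝ} (hη : ∀ i, IsTest (η i)) (v : ι → E N) :
    ∫ x, f x * ∑ i ∈ s, fderiv ℝ (η i) x (v i) = -∫ x, ∑ i ∈ s, η i x * inner ℝ (F x) (v i) := by
  simp only [Finset.mul_sum]
  rw [integral_finsetSum _ fun i _ => integrable_mul_of_hasCompactSupport h.1
      ((hη i).fderiv_apply _).continuous ((hη i).fderiv_apply _).2,
    integral_finsetSum _ fun i _ => integrable_mul_inner_of_hasCompactSupport h.2.1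
      (hη i).continuous (hη i).2 _, ← Finset.sum_neg_distrib]
  exact Finset.sum_congr rfl fun i _ => h.2.2 _ (hη i) _

/- The field `x ↦ ζ x • x` has divergence `N ζ + ⟪∇ζ, x⟫`. -/
lemma integral_mul_radial_div (h : HasWeakGradient f F) {ζ : E N → ℝ} (hζ : IsTest ζ) :
    ∫ x, f x * (N * ζ x + fderiv ℝ ζ x x) = - ∫ x, ζ x * inner ℝ (F x) x := by
  have hi : ∀ i : Fin N, IsTest (fun x : E N => x i * ζ x) := fun i =>
    hζ.contDiff_mul (EuclideanSpace.proj (𝕜 := ℝ) i).contDiff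
  have hx : ∀ x, ζ x * inner ℝ (F x) x =
      ∑ i, x i * ζ x * inner ℝ (F x) (EuclideanSpace.single i (1 : ℝ)) := fun x => by
    have : inner ℝ (F x) x = ∑ i, x i * inner ℝ (F x) (EuclideanSpace.single i (1 : ℝ)) := by
      simpa only [inner_sum, inner_smul_right] using
        congrArg (inner ℝ (F x)) (sum_apply_smul_single x).symm
    rw [this, Finset.mul_sum]
    exact Finset.sum_congr rfl fun i _ => by ring
  simp only [← hζ.sum_fderiv_apply_mul_single, hx]
  exact h.integral_mul_sum_fderiv _ hi _

end HasWeakGradient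

section LpConvergence

variable {X F F' : Type*} [MeasurableSpace X] {μ : Measure X} [NormedAddCommGroup F]
  [NormedAddCommGroup F'] {r : ℝ≥0∞}

lemma tendsto_eLpNorm_add_zero {f g : ℕ → X → F} (hr : 1 ≤ r)
    (hf : ∀ n, AEStronglyMeasurable (f n) μ) (hg : ∀ n, AEStronglyMeasurable (g n) μ)
    (hf0 : Tendsto (fun n => eLpNorm (f n) r μ) atTop (𝓝 0))
    (hg0 : Tendsto (fun n => eLpNorm (g n) r μ) atTop (𝓝 0)) :
    Tendsto (fun n => eLpNorm (f n + g n) r μ) atTop (𝓝 0) :=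
  tendsto_of_tendsto_of_tendsto_of_le_of_le tendsto_const_nhds
    (by simpa using hf0.add hg0) (fun _ => zero_le) fun n => eLpNorm_add_le (hf n) (hg n) hr

lemma tendsto_eLpNorm_of_tendsto_eLpNorm_sub {f : ℕ → X → F} {g : X → F} (hr : 1 ≤ r)
    (hf : ∀ n, AEStronglyMeasurable (f n) μ) (hg : MemLp g r μ)
    (h : Tendsto (fun n => eLpNorm (fun x => f n x - g x) r μ) atTop (𝓝 0)) :
    Tendsto (fun n => eLpNorm (f n) r μ) atTop (𝓝 (eLpNorm g r μ)) := by
  have upper : ∀ n, eLpNorm (f n) r μ ≤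
      eLpNorm g r μ + eLpNorm (fun x => f n x - g x) r μ := fun n => by
    have := eLpNorm_add_le hg.1 ((hf n).sub hg.1) hr
    rwa [add_sub_cancel] at this
  have lower : ∀ n, eLpNorm g r μ - eLpNorm (fun x => f n x - g x) r μ ≤
      eLpNorm (f n) r μ := fun n => by
    have := eLpNorm_sub_le (hf n) ((hf n).sub hg.1) hr
    rw [tsub_le_iff_right]
    rwa [sub_sub_cancel] at this
  refine tendsto_of_tendsto_of_tendsto_of_le_of_le ?_ ?_ lower upper
  · simpa using ENNReal.Tendsto.sub tendsto_const_nhds h (Or.inl hg.2.ne)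
  · simpa using tendsto_const_nhds.add h

lemma tendsto_eLpNorm_zero_of_dominated (hr : r ≠ ⊤) {w : ℕ → X → F} {b : X → F'}
    (hb : MemLp b r μ) (hm : ∀ n, AEStronglyMeasurable (w n) μ)
    (hwb : ∀ n, ∀ᵐ x ∂μ, ‖w n x‖ ≤ ‖b x‖)
    (hlim : ∀ᵐ x ∂μ, Tendsto (fun n => w n x) atTop (𝓝 0)) :
    Tendsto (fun n => eLpNorm (w n) r μ) atTop (𝓝 0) := by
  rcases eq_or_ne r 0 with rfl | hr0
  · simp
  have hrp := ENNReal.toReal_pos hr0 hr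
  have h := tendsto_lintegral_of_dominated_convergence' (μ := μ)
    (F := fun n x => ‖w n x‖ₑ ^ r.toReal) (f := fun _ => 0) (fun x => ‖b x‖ₑ ^ r.toReal)
    (fun n => (hm n).enorm.pow_const _)
    (fun n => (hwb n).mono fun x hx =>
      ENNReal.rpow_le_rpow (enorm_le_iff_norm_le.2 hx) hrp.le)
    (lintegral_rpow_enorm_lt_top_of_eLpNorm_lt_top hr0 hr hb.2).ne
    (hlim.mono fun x hx => by simpa [hrp] using hx.enorm.ennrpow_const r.toReal)
  simp only [eLpNorm_eq_lintegral_rpow_enorm_toReal hr0 hr]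
  simpa [hrp] using h.ennrpow_const (1 / r.toReal)

end LpConvergence

section Averaging

variable {F : Type*} [NormedAddCommGroup F] [NormedSpace ℝ F]

lemma enorm_integral_rpow_le {X : Type*} [MeasurableSpace X] {κ : Measure X}
    [IsProbabilityMeasure κ] {f : X → F} (hf : AEStronglyMeasurable f κ) {r : ℝ} (hr : 1 ≤ r) :
    ‖∫ t, f t ∂κ‖ₑ ^ r ≤ ∫⁻ t, ‖f t‖ₑ ^ r ∂κ := by
  have hr0 : 0 < r := one_pos.trans_le hr
  have h := eLpNorm'_le_eLpNorm'_of_exponent_le (μ := κ) zero_lt_one hr hf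
  simp only [eLpNorm', ENNReal.rpow_one, div_one] at h
  calc ‖∫ t, f t ∂κ‖ₑ ^ r ≤ ((∫⁻ t, ‖f t‖ₑ ^ r ∂κ) ^ (1 / r)) ^ r := by
        gcongr; exact (enorm_integral_le_lintegral_enorm f).trans h
    _ = ∫⁻ t, ‖f t‖ₑ ^ r ∂κ := by
        rw [← ENNReal.rpow_mul, one_div_mul_cancel hr0.ne', ENNReal.rpow_one]

lemma eLpNorm_integral_sub_le {G : Type*} [AddGroup G] [MeasurableSpace G] [MeasurableAdd₂ G]
    [MeasurableNeg G] {μ κ : Measure G} [SFinite μ] [μ.IsAddRightInvariant]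
    [IsProbabilityMeasure κ] {w : G → F} (hw : StronglyMeasurable w) {r : ℝ≥0∞} (hr : 1 ≤ r)
    (hr' : r ≠ ⊤) :
    eLpNorm (fun x => ∫ t, w (x - t) ∂κ) r μ ≤ eLpNorm w r μ := by
  have hr0 : r ≠ 0 := (zero_lt_one.trans_le hr).ne'
  have hr1 : 1 ≤ r.toReal := by simpa using ENNReal.toReal_mono hr' hr
  rw [eLpNorm_eq_lintegral_rpow_enorm_toReal hr0 hr',
    eLpNorm_eq_lintegral_rpow_enorm_toReal hr0 hr']
  gcongr ?_ ^ _
  calc ∫⁻ x, ‖∫ t, w (x - t) ∂κ‖ₑ ^ r.toReal ∂μ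
      ≤ ∫⁻ x, ∫⁻ t, ‖w (x - t)‖ₑ ^ r.toReal ∂κ ∂μ := lintegral_mono fun x =>
        enorm_integral_rpow_le (hw.comp_measurable (by fun_prop)).aestronglyMeasurable hr1
    _ = ∫⁻ t, ∫⁻ x, ‖w (x - t)‖ₑ ^ r.toReal ∂μ ∂κ := lintegral_lintegral_swap
        ((hw.comp_measurable (measurable_fst.sub measurable_snd)).enorm.pow_const _).aemeasurable
    _ = ∫⁻ x, ‖w x‖ₑ ^ r.toReal ∂μ := by
        simp only [lintegral_sub_right_eq_self (fun x => ‖w x‖ₑ ^ r.toReal), lintegral_const,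
          measure_univ, mul_one]

end Averaging

/-- A sequence of smooth bump functions whose supports shrink to the origin. -/
def bump (N n : ℕ) : ContDiffBump (0 : E N) where
  rIn := 1 / (2 * ((n : ℝ) + 1))
  rOut := 1 / ((n : ℝ) + 1)
  rIn_pos := by positivity
  rIn_lt_rOut := by
    have : (0 : ℝ) < n + 1 := by positivity
    exact one_div_lt_one_div_of_lt this (by linarith)

lemma tendsto_bump_rOut : Tendsto (fun n => (bump N n).rOut) atTop (𝓝 0) :=
  tendsto_one_div_add_atTop_nhds_zero_nat

lemma isTest_bump (N n : ℕ) : IsTest ((bump N n).normed volume) :=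
  ⟨(bump N n).contDiff_normed, (bump N n).hasCompactSupport_normed⟩

/-- The mollification of `w` at scale `1 / (n + 1)`. -/
def mollify {F : Type*} [NormedAddCommGroup F] [NormedSpace ℝ F] (n : ℕ) (w : E N → F) : E N → F :=
  convolution ((bump N n).normed volume) w (ContinuousLinearMap.lsmul ℝ ℝ) volume

section Mollify

variable {F : Type*} [NormedAddCommGroup F] [NormedSpace ℝ F]

lemma mollify_apply (n : ℕ) (w : E N → F) (x : E N) :
    mollify n w x = ∫ t, (bump N n).normed volume t • w (x - t) := rfl

lemma mollify_eq_swap (n : ℕ) (w : E N → F) (x : E N) :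
    mollify n w x = ∫ t, (bump N n).normed volume (x - t) • w t := by
  unfold mollify
  rw [convolution_eq_swap]
  rfl

lemma mollify_congr (n : ℕ) {w w' : E N → F} (h : w =ᵐ[volume] w') :
    mollify n w = mollify n w' :=
  convolution_congr _ (ae_eq_refl _) h

lemma continuous_mollify (n : ℕ) {w : E N → F} (hw : LocallyIntegrable w volume) :
    Continuous (mollify n w) :=
  (bump N n).hasCompactSupport_normed.continuous_convolution_left _
    (bump N n).continuous_normed hw

lemma hasCompactSupport_mollify (n : ℕ) {w : E N → F} (hw : HasCompactSupport w) :
    HasCompactSupport (mollify n w) :=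
  (bump N n).hasCompactSupport_normed.convolution _ hw

lemma contDiff_mollify (n : ℕ) {w : E N → ℝ} (hw : LocallyIntegrable w volume) :
    ContDiff ℝ ∞ (mollify n w) :=
  (bump N n).hasCompactSupport_normed.contDiff_convolution_left (n := ⊤) _
    (bump N n).contDiff_normed hw

lemma mollify_sub (n : ℕ) {w w' : E N → F} (hw : LocallyIntegrable w volume)
    (hw' : LocallyIntegrable w' volume) :
    mollify n (fun x => w x - w' x) = fun x => mollify n w x - mollify n w' x := by
  ext x
  have h : ∀ w : E N → F, LocallyIntegrable w volume →
      Integrable fun t => (bump N n).normed volume t • w (x - t) := fun w hw =>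
    (bump N n).hasCompactSupport_normed.convolutionExists_left
      (ContinuousLinearMap.lsmul ℝ ℝ) (bump N n).continuous_normed hw x
  simp only [mollify_apply, smul_sub]
  exact integral_sub (h w hw) (h w' hw')

lemma eLpNorm_mollify_le (n : ℕ) {w : E N → F} (hw : AEStronglyMeasurable w volume)
    {r : ℝ≥0∞} (hr : 1 ≤ r) (hr' : r ≠ ⊤) :
    eLpNorm (mollify n w) r volume ≤ eLpNorm w r volume := by
  set ρ := (bump N n).normed volume
  have hρ : Measurable fun t => ENNReal.ofReal (ρ t) :=
    (bump N n).continuous_normed.measurable.ennreal_ofReal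
  have hρ0 : ∀ t, (ENNReal.ofReal (ρ t)).toReal = ρ t := fun t =>
    ENNReal.toReal_ofReal ((bump N n).nonneg_normed t)
  have hρ1 : ∫⁻ t, ENNReal.ofReal (ρ t) = 1 := by
    rw [← ofReal_integral_eq_lintegral_ofReal (bump N n).integrable_normed
      (.of_forall (bump N n).nonneg_normed), (bump N n).integral_normed, ENNReal.ofReal_one]
  have : IsProbabilityMeasure (volume.withDensity fun t => ENNReal.ofReal (ρ t)) :=
    ⟨by simp [withDensity_apply _ MeasurableSet.univ, hρ1]⟩
  have key := eLpNorm_integral_sub_le (μ := volume)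
    (κ := volume.withDensity fun t => ENNReal.ofReal (ρ t)) hw.stronglyMeasurable_mk hr hr'
  simp only [integral_withDensity_eq_integral_toReal_smul hρ (.of_forall fun _ =>
    ENNReal.ofReal_lt_top), hρ0] at key
  rwa [mollify_congr n hw.ae_eq_mk, eLpNorm_congr_ae hw.ae_eq_mk]

lemma tendsto_mollify_of_continuous [CompleteSpace F] {w : E N → F} (hw : Continuous w)
    (hc : HasCompactSupport w) {r : ℝ≥0∞} (hr' : r ≠ ⊤) :
    Tendsto (fun n => eLpNorm (fun x => mollify n w x - w x) r volume) atTop (𝓝 0) := by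
  set S := cthickening 1 (tsupport w)
  have hSc : IsCompact S := hc.isCompact.cthickening
  have hS : volume S ^ (1 / r.toReal) ≠ ⊤ :=
    ENNReal.rpow_ne_top_of_nonneg (by simp) hSc.measure_lt_top.ne
  refine ENNReal.tendsto_nhds_zero.2 fun ε hε => ?_
  obtain ⟨c, hc0, hcε⟩ := ENNReal.exists_nnreal_pos_mul_lt hS hε.ne'
  obtain ⟨δ, hδ, hd⟩ :=
    Metric.uniformContinuous_iff.1 (hc.uniformContinuous_of_continuous hw) c hc0
  filter_upwards [(tendsto_bump_rOut (N := N)).eventually_lt_const hδ,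
    (tendsto_bump_rOut (N := N)).eventually_lt_const zero_lt_one] with n hn hn1
  have hsupp : Function.support (mollify n w) ⊆ S := by
    refine (support_convolution_subset _).trans ?_
    rw [(bump N n).support_normed_eq]
    rintro _ ⟨a, ha, b, hb, rfl⟩
    refine mem_cthickening_of_dist_le _ b _ _ (subset_tsupport w hb) ?_
    simp only [mem_ball, dist_zero_right] at ha
    simpa using (ha.trans hn1).le
  refine (eLpNorm_sub_le_of_dist_bdd volume hr' hSc.measurableSet c.coe_nonneg (fun x => ?_)
    hsupp ((subset_tsupport w).trans (self_subset_cthickening _))).trans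
    (by simpa only [ENNReal.ofReal_coe_nnreal] using hcε.le)
  exact (bump N n).dist_normed_convolution_le hw.aestronglyMeasurable fun y hy =>
    (hd (lt_of_lt_of_le hy hn.le)).le

lemma tendsto_mollify [CompleteSpace F] {w : E N → F} {r : ℝ≥0∞} (hr : 1 ≤ r) (hr' : r ≠ ⊤)
    (hw : MemLp w r volume) :
    Tendsto (fun n => eLpNorm (fun x => mollify n w x - w x) r volume) atTop (𝓝 0) := by
  refine ENNReal.tendsto_nhds_zero.2 fun ε hε => ?_
  have hε3 : ε / 3 ≠ 0 := (ENNReal.div_pos hε.ne' (by simp)).ne'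
  obtain ⟨g, hg, hgw, hgc, hgm⟩ := hw.exists_hasCompactSupport_eLpNorm_sub_le hr' hε3
  filter_upwards [ENNReal.tendsto_nhds_zero.1 (tendsto_mollify_of_continuous hgc hg hr') _
    (pos_iff_ne_zero.2 hε3)] with n hn
  have hwl := hw.locallyIntegrable hr
  have hgl := hgm.locallyIntegrable hr
  have split : (fun x => mollify n w x - w x) = (mollify n (fun x => w x - g x)) +
      ((fun x => mollify n g x - g x) - (w - g)) := by
    rw [mollify_sub n hwl hgl]
    ext x
    simp only [Pi.add_apply, Pi.sub_apply]
    abel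
  have m1 := (continuous_mollify n (hwl.sub hgl)).aestronglyMeasurable (μ := volume)
  have m2 := ((continuous_mollify n hgl).sub hgc).aestronglyMeasurable (μ := volume)
  have m3 := hw.1.sub hgc.aestronglyMeasurable
  rw [split, ← ENNReal.add_thirds ε, add_assoc]
  exact (eLpNorm_add_le m1 (m2.sub m3) hr).trans (add_le_add
    ((eLpNorm_mollify_le n m3 hr hr').trans hgw)
    ((eLpNorm_sub_le m2 m3 hr).trans (add_le_add hn hgw)))

lemma tendsto_mollify_of_tendsto [CompleteSpace F] {w : ℕ → E N → F} {w' : E N → F} {r : ℝ≥0∞}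
    (hr : 1 ≤ r) (hr' : r ≠ ⊤) (hw' : MemLp w' r volume)
    (hw : ∀ n, LocallyIntegrable (w n) volume)
    (h : Tendsto (fun n => eLpNorm (fun x => w n x - w' x) r volume) atTop (𝓝 0)) :
    Tendsto (fun n => eLpNorm (fun x => mollify n (w n) x - w' x) r volume) atTop (𝓝 0) := by
  have hl := hw'.locallyIntegrable hr
  have split : ∀ n, (fun x => mollify n (w n) x - w' x) =
      mollify n (fun x => w n x - w' x) + fun x => mollify n w' x - w' x := fun n => by
    rw [mollify_sub n (hw n) hl]
    ext x
    simp
  simp only [split]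
  refine tendsto_eLpNorm_add_zero hr
    (fun n => (continuous_mollify n ((hw n).sub hl)).aestronglyMeasurable)
    (fun n => (continuous_mollify n hl).aestronglyMeasurable.sub hw'.1) ?_
    (tendsto_mollify hr hr' hw')
  exact tendsto_of_tendsto_of_tendsto_of_le_of_le tendsto_const_nhds h (fun _ => zero_le)
    fun n => eLpNorm_mollify_le n ((hw n).sub hl).aestronglyMeasurable hr hr'

end Mollify

lemma fderiv_mollify (n : ℕ) {w : E N → ℝ} (hw : LocallyIntegrable w volume) (x v : E N) :
    fderiv ℝ (mollify n w) x v =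
      ∫ t, w t * fderiv ℝ ((bump N n).normed volume) (x - t) v := by
  have hρ := isTest_bump N n
  have h1 := (hρ.2.hasFDerivAt_convolution_left (ContinuousLinearMap.lsmul ℝ ℝ)
    (hρ.1.of_le (by simp)) hw x).fderiv
  unfold mollify
  rw [h1, convolution_eq_swap, ContinuousLinearMap.integral_apply]
  · refine integral_congr_ae (.of_forall fun t => ?_)
    simp [ContinuousLinearMap.precompL_apply, mul_comm]
  · have hc : Continuous fun t => fderiv ℝ ((bump N n).normed volume) (x - t) :=
      (hρ.1.continuous_fderiv (by simp)).comp (continuous_const.sub continuous_id)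
    have hs : HasCompactSupport fun t => fderiv ℝ ((bump N n).normed volume) (x - t) :=
      (hρ.2.fderiv ℝ).comp_homeomorph (Homeomorph.subLeft x)
    refine (hw.integrable_smul_right_of_hasCompactSupport hc hs).congr (.of_forall fun t => ?_)
    ext v
    simp [ContinuousLinearMap.precompL_apply, mul_comm]

lemma HasWeakGradient.gradient_mollify (n : ℕ) {w : E N → ℝ} {G : E N → E N}
    (h : HasWeakGradient w G) :
    gradient (mollify n w) = mollify n G := by
  have hρ := isTest_bump N n
  ext1 x
  refine ext_inner_right ℝ fun v => ?_
  have parts := h.2.2 _ (hρ.comp_sub x) v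
  have chain : ∀ t, fderiv ℝ (fun t => (bump N n).normed volume (x - t)) t v
      = - fderiv ℝ ((bump N n).normed volume) (x - t) v := fun t => by
    have : HasFDerivAt (fun t => (bump N n).normed volume (x - t)) _ t :=
      (hρ.differentiable (x - t)).hasFDerivAt.comp t ((hasFDerivAt_id t).const_sub x)
    rw [this.fderiv]
    simp
  simp only [chain, mul_neg] at parts
  rw [integral_neg, neg_inj] at parts
  rw [inner_gradient_left, fderiv_mollify n h.1, parts, mollify_eq_swap, real_inner_comm,
    ← integral_inner (h.2.1.integrable_smul_left_of_hasCompactSupport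
      (hρ.comp_sub x).continuous (hρ.comp_sub x).2)]
  simp [inner_smul_right, real_inner_comm]

/-- The bump function equal to `1` on the unit ball and supported in the ball of radius `2`. -/
def unitBump (N : ℕ) : ContDiffBump (0 : E N) := ⟨1, 2, one_pos, one_lt_two⟩

lemma isTest_unitBump (N : ℕ) : IsTest (unitBump N) :=
  ⟨(unitBump N).contDiff, (unitBump N).hasCompactSupport⟩

/-- The smooth cutoff equal to `1` on the ball of radius `R`, supported in the ball of radius
`2 R`. -/
def cutoff (N : ℕ) (R : ℝ) (x : E N) : ℝ := unitBump N (R⁻¹ • x)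

section Cutoff

variable {R : ℝ}

lemma isTest_cutoff (hR : 0 < R) : IsTest (cutoff N R) :=
  (isTest_unitBump N).comp_smul (inv_ne_zero hR.ne')

lemma cutoff_nonneg (R : ℝ) (x : E N) : 0 ≤ cutoff N R x := (unitBump N).nonneg

lemma cutoff_le_one (R : ℝ) (x : E N) : cutoff N R x ≤ 1 := (unitBump N).le_one

lemma norm_cutoff_le_one (R : ℝ) (x : E N) : ‖cutoff N R x‖ ≤ 1 := by
  rw [Real.norm_of_nonneg (cutoff_nonneg R x)]
  exact cutoff_le_one R x

lemma cutoff_eq_one (hR : 0 < R) {x : E N} (hx : ‖x‖ ≤ R) : cutoff N R x = 1 := by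
  refine (unitBump N).one_of_mem_closedBall ?_
  simp only [mem_closedBall, dist_zero_right, norm_smul, norm_inv, Real.norm_of_nonneg hR.le]
  rw [inv_mul_le_iff₀ hR]
  simpa [unitBump] using hx

lemma cutoff_eq_zero (hR : 0 < R) {x : E N} (hx : 2 * R ≤ ‖x‖) : cutoff N R x = 0 := by
  refine (unitBump N).zero_of_le_dist ?_
  simp only [dist_zero_right, norm_smul, norm_inv, Real.norm_of_nonneg hR.le]
  rw [le_inv_mul_iff₀ hR]
  simp only [unitBump]
  linarith

lemma fderiv_cutoff_apply (R : ℝ) (x v : E N) :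
    fderiv ℝ (cutoff N R) x v = R⁻¹ * fderiv ℝ (unitBump N) (R⁻¹ • x) v :=
  fderiv_comp_const_smul (isTest_unitBump N).differentiable _ _ _

lemma fderiv_cutoff_eq_zero_of_norm_lt (hR : 0 < R) {x : E N} (hx : ‖x‖ < R) :
    fderiv ℝ (cutoff N R) x = 0 := by
  have : cutoff N R =ᶠ[𝓝 x] fun _ => 1 := by
    filter_upwards [(isOpen_lt continuous_norm continuous_const).mem_nhds hx] with y hy
    exact cutoff_eq_one hR (le_of_lt hy)
  rw [this.fderiv_eq]
  simp

lemma fderiv_cutoff_eq_zero_of_lt_norm (hR : 0 < R) {x : E N} (hx : 2 * R < ‖x‖) :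
    fderiv ℝ (cutoff N R) x = 0 := by
  have : cutoff N R =ᶠ[𝓝 x] fun _ => 0 := by
    filter_upwards [(isOpen_lt continuous_const continuous_norm).mem_nhds hx] with y hy
    exact cutoff_eq_zero hR (le_of_lt hy)
  rw [this.fderiv_eq]
  simp

lemma exists_norm_fderiv_cutoff_le (N : ℕ) : ∃ C : ℝ, 0 ≤ C ∧ ∀ R : ℝ, 0 < R → ∀ x : E N,
    ‖fderiv ℝ (cutoff N R) x‖ ≤ C / R := by
  have hχ := isTest_unitBump N
  obtain ⟨C, hC⟩ := (hχ.2.fderiv ℝ).exists_bound_of_continuous (hχ.1.continuous_fderiv (by simp))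
  have hC0 : 0 ≤ C := (norm_nonneg _).trans (hC 0)
  refine ⟨C, hC0, fun R hR x => ContinuousLinearMap.opNorm_le_bound _ (by positivity) fun v => ?_⟩
  rw [fderiv_cutoff_apply, norm_mul, norm_inv, Real.norm_of_nonneg hR.le, div_mul_eq_mul_div,
    div_eq_inv_mul]
  gcongr
  exact ContinuousLinearMap.le_of_opNorm_le _ (hC _) v

lemma exists_norm_fderiv_cutoff_mul_le (N : ℕ) : ∃ C : ℝ, 0 ≤ C ∧ ∀ R : ℝ, 0 < R → ∀ x : E N,
    ‖fderiv ℝ (cutoff N R) x‖ * ‖x‖ ≤ C := by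
  obtain ⟨C, hC0, hC⟩ := exists_norm_fderiv_cutoff_le N
  refine ⟨2 * C, by positivity, fun R hR x => ?_⟩
  rcases le_or_gt ‖x‖ (2 * R) with hx | hx
  · calc _ ≤ C / R * (2 * R) := mul_le_mul (hC R hR x) hx (norm_nonneg _) (by positivity)
      _ = 2 * C := by field_simp
  · rw [fderiv_cutoff_eq_zero_of_lt_norm hR hx, norm_zero, zero_mul]
    positivity

lemma exists_inner_cutoff_smul_sub_le (N : ℕ) : ∃ L : ℝ, 0 ≤ L ∧ ∀ R : ℝ, 0 < R → ∀ x y : E N,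
    |inner ℝ (x - y) (cutoff N R x • x - cutoff N R y • y)| ≤ L * ‖x - y‖ ^ 2 := by
  obtain ⟨C, hC0, hC⟩ := exists_norm_fderiv_cutoff_mul_le N
  refine ⟨1 + C, by positivity, fun R hR x y => ?_⟩
  have hd := (isTest_cutoff (N := N) hR).differentiable
  have lipschitz := Convex.norm_image_sub_le_of_norm_hasFDerivWithin_le (𝕜 := ℝ) (s := univ)
    (f := fun x : E N => cutoff N R x • x) (C := 1 + C) (x := y) (y := x)
    (fun z _ => ((hd z).hasFDerivAt.smul (hasFDerivAt_id z)).hasFDerivWithinAt) (fun z _ => by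
      refine (norm_add_le _ _).trans (add_le_add ?_ ?_)
      · rw [norm_smul]
        exact (mul_le_of_le_one_left (norm_nonneg _) (norm_cutoff_le_one _ _)).trans
          ContinuousLinearMap.norm_id_le
      · exact (ContinuousLinearMap.norm_smulRight_apply _ _).le.trans (hC R hR z))
    convex_univ (mem_univ _) (mem_univ _)
  refine (abs_real_inner_le_norm _ _).trans ?_
  rw [sq, mul_comm, ← mul_assoc]
  exact mul_le_mul_of_nonneg_right lipschitz (norm_nonneg _)

lemma exists_fderiv_fderiv_cutoff_le (N : ℕ) (v : E N) : ∃ C : ℝ, 0 ≤ C ∧ ∀ R : ℝ, 0 < R →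
    ∀ x : E N, |fderiv ℝ (fun y => fderiv ℝ (cutoff N R) y v) x x| ≤ C / R := by
  have h := (isTest_unitBump N).fderiv_apply v
  obtain ⟨C, hC⟩ := h.hasCompactSupport_fderiv_self.exists_bound_of_continuous
    h.continuous_fderiv_self
  refine ⟨C, (norm_nonneg _).trans (hC 0), fun R hR x => ?_⟩
  simp only [fderiv_cutoff_apply]
  rw [fderiv_const_mul ((h.comp_smul (inv_ne_zero hR.ne')).differentiable x)]
  rw [smul_apply, fderiv_comp_const_smul h.differentiable, ← smul_eq_mul R⁻¹ (fderiv _ _ _ x),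
    ← map_smul, smul_eq_mul, abs_mul, abs_of_pos (inv_pos.2 hR), inv_mul_eq_div]
  exact div_le_div_of_nonneg_right (hC _) hR.le

lemma isTest_cutoff_nat (N n : ℕ) : IsTest (cutoff N (n + 1)) := isTest_cutoff (by positivity)

lemma eventually_cutoff_eq_one (x : E N) : ∀ᶠ n : ℕ in atTop, cutoff N (n + 1) x = 1 := by
  filter_upwards [tendsto_natCast_atTop_atTop.eventually_ge_atTop ‖x‖] with n hn
  exact cutoff_eq_one (by positivity) (by linarith)

lemma tendsto_cutoff (x : E N) : Tendsto (fun n : ℕ => cutoff N (n + 1) x) atTop (𝓝 1) :=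
  tendsto_const_nhds.congr' ((eventually_cutoff_eq_one x).mono fun _ h => h.symm)

lemma eventually_fderiv_cutoff_eq_zero (x : E N) :
    ∀ᶠ n : ℕ in atTop, fderiv ℝ (cutoff N (n + 1)) x = 0 := by
  filter_upwards [tendsto_natCast_atTop_atTop.eventually_ge_atTop ‖x‖] with n hn
  exact fderiv_cutoff_eq_zero_of_norm_lt (by positivity) (by linarith)

lemma tendsto_eLpNorm_cutoff_smul_sub {F : Type*} [NormedAddCommGroup F] [NormedSpace ℝ F]
    {r : ℝ≥0∞} (hr : r ≠ ⊤) {w : E N → F} (hw : MemLp w r volume) :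
    Tendsto (fun n : ℕ => eLpNorm (fun x => cutoff N (n + 1) x • w x - w x) r volume)
      atTop (𝓝 0) := by
  refine tendsto_eLpNorm_zero_of_dominated hr hw (fun n =>
    ((isTest_cutoff_nat N n).continuous.aestronglyMeasurable.smul hw.1).sub hw.1)
    (fun n => .of_forall fun x => ?_) (.of_forall fun x => ?_)
  · have : cutoff N (n + 1) x • w x - w x = (cutoff N (n + 1) x - 1) • w x := by
      rw [sub_smul, one_smul]
    rw [this, norm_smul]
    refine mul_le_of_le_one_left (norm_nonneg _) ?_
    rw [Real.norm_eq_abs, abs_le]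
    constructor <;> linarith [cutoff_nonneg (n + 1 : ℝ) x, cutoff_le_one (n + 1 : ℝ) x]
  · exact tendsto_const_nhds.congr' ((eventually_cutoff_eq_one x).mono fun n h => by simp [h])

lemma tendsto_eLpNorm_smul_gradient_cutoff {r : ℝ≥0∞} (hr : r ≠ ⊤) {v : E N → ℝ}
    (hv : MemLp v r volume) :
    Tendsto (fun n : ℕ => eLpNorm (fun x => v x • gradient (cutoff N (n + 1)) x) r volume)
      atTop (𝓝 0) := by
  obtain ⟨C, hC0, hC⟩ := exists_norm_fderiv_cutoff_le N
  refine tendsto_eLpNorm_zero_of_dominated hr (hv.const_mul C) (fun n =>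
    hv.1.smul (isTest_cutoff_nat N n).continuous_gradient.aestronglyMeasurable)
    (fun n => .of_forall fun x => ?_) (.of_forall fun x => ?_)
  · rw [norm_smul, norm_gradient, mul_comm, norm_mul, Real.norm_of_nonneg hC0]
    gcongr
    exact (hC _ (by positivity) x).trans
      (div_le_self hC0 (by linarith [n.cast_nonneg (α := ℝ)]))
  · refine tendsto_const_nhds.congr' ((eventually_fderiv_cutoff_eq_zero x).mono fun n h => ?_)
    simp [gradient, h]

end Cutoff

namespace HasWeakGradient

variable {v : E N → ℝ} {G : E N → E N}

lemma exists_tendsto_test (h : HasWeakGradient v G)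
    (hv : MemLp v 2 volume) (hG : MemLp G 2 volume) :
    ∃ η : ℕ → E N → ℝ, (∀ n, IsTest (η n)) ∧
      Tendsto (fun n => eLpNorm (fun x => gradient (η n) x - G x) 2 volume) atTop (𝓝 0) ∧
      ∀ r : ℝ≥0∞, 1 ≤ r → r ≠ ⊤ → MemLp v r volume →
        Tendsto (fun n => eLpNorm (fun x => η n x - v x) r volume) atTop (𝓝 0) := by
  have hχ := isTest_cutoff_nat N
  have hw := fun n => h.contDiff_mul (hχ n).1
  have htop : (2 : ℝ≥0∞) ≠ ⊤ := ENNReal.ofNat_ne_top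
  refine ⟨fun n => mollify n fun x => cutoff N (n + 1) x * v x, fun n =>
    ⟨contDiff_mollify n (hw n).1, hasCompactSupport_mollify n (hχ n).2.mul_right⟩, ?_,
    fun r hr hr' hvr => tendsto_mollify_of_tendsto hr hr' hvr (fun n => (hw n).1)
      (tendsto_eLpNorm_cutoff_smul_sub hr' hvr)⟩
  simp only [(hw _).gradient_mollify]
  refine tendsto_mollify_of_tendsto one_le_two htop hG (fun n => (hw n).2.1) ?_
  simp only [add_sub_right_comm _ (_ • gradient _ _)]
  exact tendsto_eLpNorm_add_zero one_le_two
    (fun n => ((hχ n).continuous.aestronglyMeasurable.smul hG.1).sub hG.1)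
    (fun n => hv.1.smul (hχ n).continuous_gradient.aestronglyMeasurable)
    (tendsto_eLpNorm_cutoff_smul_sub htop hG) (tendsto_eLpNorm_smul_gradient_cutoff htop hv)

end HasWeakGradient

lemma IsTest.eLpNorm_le_eLpNorm_gradient (hN : 3 ≤ N) {η : E N → ℝ} (hη : IsTest η) :
    eLpNorm η (ENNReal.ofReal (2 * N / (N - 2))) volume ≤
      SNormLESNormFDerivOfEqConst ℝ (volume : Measure (E N)) 2 *
        eLpNorm (gradient η) 2 volume := by
  have hN' : (3 : ℝ) ≤ N := by exact_mod_cast hN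
  have hN2 : (N : ℝ) - 2 ≠ 0 := by linarith
  refine (eLpNorm_le_eLpNorm_fderiv_of_eq (volume : Measure (E N)) (u := η) (p := 2)
    (p' := Real.toNNReal (2 * N / (N - 2))) (hη.1.of_le (by simp)) hη.2 one_le_two
    (by simp; omega) ?_).trans_eq ?_
  · rw [Real.coe_toNNReal _ (div_nonneg (by linarith) (by linarith))]
    simp
    field_simp
  · congr 1
    exact eLpNorm_congr_norm_ae (.of_forall fun x => (norm_gradient _ _).symm)

namespace HasWeakGradient

variable {v : E N → ℝ} {G : E N → E N}

lemma eLpNorm_le_eLpNorm_gradient (hN : 3 ≤ N) (h : HasWeakGradient v G)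
    (hv : MemLp v 2 volume) (hG : MemLp G 2 volume) :
    eLpNorm v (ENNReal.ofReal (2 * N / (N - 2))) volume ≤
      SNormLESNormFDerivOfEqConst ℝ (volume : Measure (E N)) 2 * eLpNorm G 2 volume := by
  obtain ⟨η, hη, hηG, hηv⟩ := h.exists_tendsto_test hv hG
  obtain ⟨ns, hns, hae⟩ := (tendstoInMeasure_of_tendsto_eLpNorm (p := 2) two_ne_zero
    (fun n => (hη n).continuous.aestronglyMeasurable) hv.1
    (hηv 2 one_le_two ENNReal.ofNat_ne_top hv)).exists_seq_tendsto_ae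
  have hlim : Tendsto (fun n => SNormLESNormFDerivOfEqConst ℝ (volume : Measure (E N)) 2 *
      eLpNorm (gradient (η (ns n))) 2 volume) atTop
      (𝓝 (SNormLESNormFDerivOfEqConst ℝ (volume : Measure (E N)) 2 * eLpNorm G 2 volume)) :=
    ENNReal.Tendsto.const_mul ((tendsto_eLpNorm_of_tendsto_eLpNorm_sub one_le_two
      (fun n => (hη n).continuous_gradient.aestronglyMeasurable) hG hηG).comp
      hns.tendsto_atTop) (Or.inr ENNReal.coe_ne_top)
  refine (Lp.eLpNorm_lim_le_liminf_eLpNorm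
    (fun n => (hη (ns n)).continuous.aestronglyMeasurable) v hae).trans ?_
  rw [← hlim.liminf_eq]
  exact liminf_le_liminf (.of_forall fun n => (hη (ns n)).eLpNorm_le_eLpNorm_gradient hN)

lemma memLp_sobolev (hN : 3 ≤ N) (h : HasWeakGradient v G) (hv : MemLp v 2 volume)
    (hG : MemLp G 2 volume) : MemLp v (ENNReal.ofReal (2 * N / (N - 2))) volume :=
  ⟨hv.1, (h.eLpNorm_le_eLpNorm_gradient hN hv hG).trans_lt
    (ENNReal.mul_lt_top ENNReal.coe_lt_top hG.2)⟩

lemma eq_zero (hN : 3 ≤ N) (h : HasWeakGradient v G) (hv : MemLp v 2 volume)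
    (hG : G =ᵐ[volume] 0) : v =ᵐ[volume] 0 := by
  have hN' : (3 : ℝ) ≤ N := by exact_mod_cast hN
  have h0 := h.eLpNorm_le_eLpNorm_gradient hN hv ((memLp_congr_ae hG).2 MemLp.zero)
  rw [eLpNorm_congr_ae hG, eLpNorm_zero, mul_zero, nonpos_iff_eq_zero] at h0
  refine (eLpNorm_eq_zero_iff hv.1 ?_).1 h0
  simp only [ne_eq, ENNReal.ofReal_eq_zero, not_le]
  exact div_pos (by linarith) (by linarith)

end HasWeakGradient

section Pairing

variable {X H : Type*} [MeasurableSpace X] {μ : Measure X} [NormedAddCommGroup H]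
  [InnerProductSpace ℝ H] {r r' : ℝ≥0∞} [ENNReal.HolderConjugate r r']

lemma integrable_inner {k d : X → H} (hk : MemLp k r μ) (hd : MemLp d r' μ) :
    Integrable (fun x => inner ℝ (k x) (d x)) μ :=
  (hk.norm.integrable_mul hd.norm).mono (hk.1.inner hd.1) (.of_forall fun x => by
    simpa using abs_real_inner_le_norm _ _)

lemma enorm_integral_inner_le {k d : X → H} (hk : AEStronglyMeasurable k μ)
    (hd : AEStronglyMeasurable d μ) :
    ‖∫ x, inner ℝ (k x) (d x) ∂μ‖ₑ ≤ eLpNorm k r μ * eLpNorm d r' μ := by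
  refine (enorm_integral_le_lintegral_enorm _).trans ?_
  rw [← eLpNorm_one_eq_lintegral_enorm]
  simpa using eLpNorm_le_eLpNorm_mul_eLpNorm_of_nnnorm (r := 1) hk hd (inner ℝ) 1
    (.of_forall fun x => by simpa using nnnorm_inner_le_nnnorm (𝕜 := ℝ) (k x) (d x))

lemma enorm_integral_mul_le {k d : X → ℝ} (hk : AEStronglyMeasurable k μ)
    (hd : AEStronglyMeasurable d μ) :
    ‖∫ x, k x * d x ∂μ‖ₑ ≤ eLpNorm k r μ * eLpNorm d r' μ := by
  simpa [mul_comm] using enorm_integral_inner_le (r := r) (r' := r') hk hd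

lemma tendsto_integral_inner {k d : X → H} {e : ℕ → X → H} (hk : MemLp k r μ) (hd : MemLp d r' μ)
    (he : ∀ n, AEStronglyMeasurable (e n) μ)
    (h : Tendsto (fun n => eLpNorm (fun x => e n x - d x) r' μ) atTop (𝓝 0)) :
    Tendsto (fun n => ∫ x, inner ℝ (k x) (e n x) ∂μ) atTop (𝓝 (∫ x, inner ℝ (k x) (d x) ∂μ)) := by
  rw [tendsto_iff_edist_tendsto_0]
  refine tendsto_of_tendsto_of_tendsto_of_le_of_le' tendsto_const_nhds
    (by simpa using ENNReal.Tendsto.const_mul h (Or.inr hk.2.ne)) (.of_forall fun n => zero_le) ?_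
  filter_upwards [h.eventually_lt_const one_pos] with n hn
  have hsub : MemLp (fun x => e n x - d x) r' μ := ⟨(he n).sub hd.1, hn.trans ENNReal.one_lt_top⟩
  have hi := integrable_inner hk hsub
  have hid := integrable_inner hk hd
  have hie : Integrable (fun x => inner ℝ (k x) (e n x)) μ := (hi.add hid).congr
    (.of_forall fun x => by simp only [Pi.add_apply, inner_sub_right, sub_add_cancel])
  rw [edist_eq_enorm_sub, ← integral_sub hie hid]
  simp only [← inner_sub_right]
  exact enorm_integral_inner_le hk.1 hsub.1

lemma tendsto_integral_mul {k d : X → ℝ} {e : ℕ → X → ℝ} (hk : MemLp k r μ) (hd : MemLp d r' μ)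
    (he : ∀ n, AEStronglyMeasurable (e n) μ)
    (h : Tendsto (fun n => eLpNorm (fun x => e n x - d x) r' μ) atTop (𝓝 0)) :
    Tendsto (fun n => ∫ x, k x * e n x ∂μ) atTop (𝓝 (∫ x, k x * d x ∂μ)) := by
  simpa [mul_comm] using tendsto_integral_inner (r := r) (r' := r') hk hd he h

lemma tendstoUniformlyOn_integral_mul {ι : Type*} {s : Set ι} {k : X → ℝ} {e : ℕ → X → ℝ}
    {D : ι → X → ℝ} {M : ℝ≥0∞} (hM : M ≠ ⊤) (hk : MemLp k r μ) (he : ∀ n, MemLp (e n) r μ)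
    (hlim : Tendsto (fun n => eLpNorm (fun x => e n x - k x) r μ) atTop (𝓝 0))
    (hD : ∀ i ∈ s, MemLp (D i) r' μ) (hDM : ∀ i ∈ s, eLpNorm (D i) r' μ ≤ M) :
    TendstoUniformlyOn (fun n i => ∫ x, e n x * D i x ∂μ) (fun i => ∫ x, k x * D i x ∂μ)
      atTop s := by
  rw [EMetric.tendstoUniformlyOn_iff]
  intro ε hε
  have hlimM : Tendsto (fun n => eLpNorm (fun x => e n x - k x) r μ * M) atTop (𝓝 0) := by
    simpa using ENNReal.Tendsto.mul_const hlim (Or.inr hM)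
  filter_upwards [hlimM.eventually_lt_const hε] with n hn i hi
  have hint : ∀ {f : X → ℝ}, MemLp f r μ → Integrable (fun x => f x * D i x) μ :=
    fun hf => hf.integrable_mul (hD i hi)
  rw [edist_comm, edist_eq_enorm_sub, ← integral_sub (hint (he n)) (hint hk)]
  simp only [← sub_mul]
  refine (enorm_integral_mul_le (r := r) (r' := r') ((he n).1.sub hk.1)
    (hD i hi).1).trans_lt (lt_of_le_of_lt ?_ hn)
  exact mul_le_mul_right (hDM i hi) _

end Pairing

lemma tendsto_eLpNorm_smul_sub_smul {X H : Type*} [MeasurableSpace X] {μ : Measure X}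
    [NormedAddCommGroup H] [NormedSpace ℝ H] {r : ℝ≥0∞} (hr : 1 ≤ r) (hr' : r ≠ ⊤)
    {a : ℕ → X → ℝ} {b : X → ℝ} {w : ℕ → X → H} {z : X → H} {C : ℝ}
    (ha : ∀ n, AEStronglyMeasurable (a n) μ) (hb : AEStronglyMeasurable b μ)
    (hw : ∀ n, AEStronglyMeasurable (w n) μ) (hz : MemLp z r μ) (haC : ∀ n x, ‖a n x‖ ≤ C)
    (hab : ∀ᵐ x ∂μ, Tendsto (fun n => a n x) atTop (𝓝 (b x)))
    (hwz : Tendsto (fun n => eLpNorm (fun x => w n x - z x) r μ) atTop (𝓝 0)) :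
    Tendsto (fun n => eLpNorm (fun x => a n x • w n x - b x • z x) r μ) atTop (𝓝 0) := by
  have split : ∀ n, (fun x => a n x • w n x - b x • z x) =
      (fun x => a n x • (w n x - z x)) + fun x => (a n x - b x) • z x := fun n => by
    ext1 x
    simp only [Pi.add_apply, smul_sub, sub_smul]
    abel
  simp only [split]
  refine tendsto_eLpNorm_add_zero hr (fun n => (ha n).smul ((hw n).sub hz.1))
    (fun n => ((ha n).sub hb).smul hz.1) ?_ ?_
  · refine tendsto_of_tendsto_of_tendsto_of_le_of_le tendsto_const_nhds
      (by simpa using ENNReal.Tendsto.const_mul hwz (Or.inr (ENNReal.ofReal_ne_top (r := C))))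
      (fun n => zero_le) fun n => eLpNorm_le_mul_eLpNorm_of_ae_le_mul (.of_forall fun x => ?_) r
    rw [norm_smul]
    gcongr
    exact haC n x
  · refine tendsto_eLpNorm_zero_of_dominated hr' (hz.norm.const_mul (C + C))
      (fun n => ((ha n).sub hb).smul hz.1) (fun n => ?_)
      (hab.mono fun x hx => by simpa using (hx.sub_const (b x)).smul_const (z x))
    filter_upwards [hab] with x hx
    have hbC : ‖b x‖ ≤ C := le_of_tendsto' hx.norm fun n => haC n x
    have hC : 0 ≤ C := (norm_nonneg _).trans hbC
    rw [norm_smul, norm_mul, norm_norm, Real.norm_of_nonneg (add_nonneg hC hC)]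
    gcongr
    exact (norm_sub_le _ _).trans (add_le_add (haC n x) hbC)

lemma exists_tendsto_test_of_memLp {k : E N → ℝ} {r : ℝ≥0∞} (hr : 1 ≤ r) (hr' : r ≠ ⊤)
    (hk : MemLp k r volume) :
    ∃ ζ : ℕ → E N → ℝ, (∀ n, IsTest (ζ n)) ∧
      Tendsto (fun n => eLpNorm (fun x => ζ n x - k x) r volume) atTop (𝓝 0) := by
  choose ζ hζc hζs hζ using fun n : ℕ => hk.exist_eLpNorm_sub_le (ε := 1 / (n + 1)) hr' hr
    (by positivity)
  refine ⟨ζ, fun n => ⟨hζs n, hζc n⟩, tendsto_of_tendsto_of_tendsto_of_le_of_le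
    tendsto_const_nhds ?_ (fun n => zero_le)
    fun n => (eLpNorm_sub_comm _ _ _ _).trans_le (hζ n)⟩
  simpa using ENNReal.tendsto_ofReal (tendsto_one_div_add_atTop_nhds_zero_nat (𝕜 := ℝ))

lemma hasWeakGradient_gradient {f : E N → ℝ} (hf : ContDiff ℝ 1 f) :
    HasWeakGradient f (gradient f) := by
  have hG : Continuous (gradient f) := (InnerProductSpace.toDual ℝ (E N)).symm.continuous.comp
    (hf.continuous_fderiv one_ne_zero)
  refine ⟨hf.continuous.locallyIntegrable, hG.locallyIntegrable, fun η hη v => ?_⟩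
  have hv := hη.fderiv_apply v
  simp only [inner_gradient_left, mul_comm (η _)]
  refine integral_mul_fderiv_eq_neg_fderiv_mul_of_integrable ?_ ?_ ?_
    (fun x _ => hf.differentiable one_ne_zero x) (fun x _ => hη.differentiable x)
  · exact (((hf.continuous_fderiv one_ne_zero).clm_apply continuous_const).mul
      hη.continuous).integrable_of_hasCompactSupport hη.2.mul_left
  · exact (hf.continuous.mul hv.continuous).integrable_of_hasCompactSupport hv.2.mul_left
  · exact (hf.continuous.mul hη.continuous).integrable_of_hasCompactSupport hη.2.mul_left

lemma gradient_comp {F : ℝ → ℝ} {f : E N → ℝ} (hF : ContDiff ℝ 1 F) (hf : ContDiff ℝ 1 f) :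
    gradient (F ∘ f) = fun x => deriv F (f x) • gradient f x := by
  ext1 x
  have h := (hF.differentiable one_ne_zero (f x)).hasDerivAt.comp_hasFDerivAt x
    (hf.differentiable one_ne_zero x).hasFDerivAt
  rw [gradient, h.fderiv, map_smul]
  rfl

namespace HasWeakGradient

lemma of_tendsto {f : ℕ → E N → ℝ} {F : ℕ → E N → E N} {g : E N → ℝ} {G : E N → E N}
    (h : ∀ n, HasWeakGradient (f n) (F n)) (hg : MemLp g 2 volume) (hG : MemLp G 2 volume)
    (hfg : Tendsto (fun n => eLpNorm (fun x => f n x - g x) 2 volume) atTop (𝓝 0))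
    (hFG : Tendsto (fun n => eLpNorm (fun x => F n x - G x) 2 volume) atTop (𝓝 0)) :
    HasWeakGradient g G := by
  refine ⟨hg.locallyIntegrable one_le_two, hG.locallyIntegrable one_le_two, fun η hη v => ?_⟩
  have hv := hη.fderiv_apply v
  have lhs := tendsto_integral_mul (r := 2) (r' := 2)
    (hv.continuous.memLp_of_hasCompactSupport hv.2) hg (fun n => (h n).1.aestronglyMeasurable) hfg
  have rhs := tendsto_integral_inner (r := 2) (r' := 2) (k := fun x => η x • v)
    ((hη.continuous.smul continuous_const).memLp_of_hasCompactSupport hη.2.smul_right) hG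
    (fun n => (h n).2.1.aestronglyMeasurable) hFG
  simp only [inner_smul_left, conj_trivial, real_inner_comm _ v] at rhs
  simp only [mul_comm (fderiv ℝ η _ v)] at lhs
  exact tendsto_nhds_unique lhs (by simpa only [(h _).2.2 η hη v] using rhs.neg)

lemma exists_tendsto_ae_test {v : E N → ℝ} {G : E N → E N} (h : HasWeakGradient v G)
    (hv : MemLp v 2 volume) (hG : MemLp G 2 volume) :
    ∃ η : ℕ → E N → ℝ, (∀ n, IsTest (η n)) ∧
      Tendsto (fun n => eLpNorm (fun x => η n x - v x) 2 volume) atTop (𝓝 0) ∧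
      Tendsto (fun n => eLpNorm (fun x => gradient (η n) x - G x) 2 volume) atTop (𝓝 0) ∧
      ∀ᵐ x, Tendsto (fun n => η n x) atTop (𝓝 (v x)) := by
  obtain ⟨η, hη, hηG, hηv⟩ := h.exists_tendsto_test hv hG
  have hηv := hηv 2 one_le_two ENNReal.ofNat_ne_top hv
  obtain ⟨ns, hns, hae⟩ := (tendstoInMeasure_of_tendsto_eLpNorm two_ne_zero
    (fun n => (hη n).continuous.aestronglyMeasurable) hv.1 hηv).exists_seq_tendsto_ae
  exact ⟨fun n => η (ns n), fun n => hη _, hηv.comp hns.tendsto_atTop,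
    hηG.comp hns.tendsto_atTop, hae⟩

lemma comp {v : E N → ℝ} {G : E N → E N} (h : HasWeakGradient v G)
    (hv : MemLp v 2 volume) (hG : MemLp G 2 volume) {F : ℝ → ℝ} (hF : ContDiff ℝ 1 F)
    {C : ℝ} (hC : ∀ t, ‖deriv F t‖ ≤ C) (h0 : F 0 = 0) :
    HasWeakGradient (fun x => F (v x)) (fun x => deriv F (v x) • G x) := by
  have lipschitz : ∀ a b, ‖F a - F b‖ ≤ C * ‖a - b‖ := fun a b =>
    convex_univ.norm_image_sub_le_of_norm_deriv_le
      (fun t _ => hF.differentiable one_ne_zero t) (fun t _ => hC t) (mem_univ _) (mem_univ _)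
  have hF' : Continuous (deriv F) := hF.continuous_deriv_one
  obtain ⟨η, hη, hηv, hηG, hae⟩ := h.exists_tendsto_ae_test hv hG
  have mη : ∀ n, AEStronglyMeasurable (fun x => deriv F (η n x)) volume := fun n =>
    (hF'.comp (hη n).continuous).aestronglyMeasurable
  have mv := hF'.comp_aestronglyMeasurable hv.1
  refine of_tendsto (fun n => hasWeakGradient_gradient (hF.comp ((hη n).1.of_le (by simp))))
    (hv.of_le_mul (c := C) (hF.continuous.comp_aestronglyMeasurable hv.1)
      (.of_forall fun x => by simpa [h0] using lipschitz (v x) 0))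
    (hG.of_le_mul (c := C) (mv.smul hG.1) (.of_forall fun x => ?_)) ?_ ?_
  · rw [norm_smul]
    gcongr
    exact hC _
  · exact tendsto_of_tendsto_of_tendsto_of_le_of_le tendsto_const_nhds
      (by simpa using ENNReal.Tendsto.const_mul hηv (Or.inr ENNReal.ofReal_ne_top))
      (fun n => zero_le) fun n => eLpNorm_le_mul_eLpNorm_of_ae_le_mul
        (.of_forall fun x => lipschitz (η n x) (v x)) 2
  · simp only [gradient_comp hF ((hη _).1.of_le (by simp))]
    exact tendsto_eLpNorm_smul_sub_smul one_le_two ENNReal.ofNat_ne_top mη mv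
      (fun n => (hη n).continuous_gradient.aestronglyMeasurable) hG (fun n x => hC _)
      (hae.mono fun x hx => (hF'.tendsto _).comp hx) hηG

end HasWeakGradient

namespace IsTest

lemma hasDerivAt_comp_smul {ζ : E N → ℝ} (hζ : IsTest ζ) (x : E N) (l : ℝ) :
    HasDerivAt (fun l : ℝ => ζ (l • x)) (fderiv ℝ ζ (l • x) x) l :=
  (hζ.differentiable (l • x)).hasFDerivAt.comp_hasDerivAt l
    (by simpa using (hasDerivAt_id l).smul_const x)

lemma exists_norm_fderiv_smul_le_indicator {ζ : E N → ℝ} (hζ : IsTest ζ) {a : ℝ} (ha : 0 < a) :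
    ∃ C R : ℝ, ∀ l, a ≤ l → ∀ x,
      ‖fderiv ℝ ζ (l • x) x‖ ≤ (closedBall (0 : E N) R).indicator (fun _ => C) x := by
  obtain ⟨R, -, hR⟩ := hζ.2.isCompact.isBounded.exists_pos_norm_le
  obtain ⟨C, hC⟩ := (hζ.2.fderiv ℝ).exists_bound_of_continuous
    (hζ.1.continuous_fderiv (by simp))
  refine ⟨C * (R / a), R / a, fun l hl x => ?_⟩
  by_cases hx : x ∈ closedBall (0 : E N) (R / a)
  · rw [indicator_of_mem hx]
    exact (ContinuousLinearMap.le_opNorm _ _).trans (mul_le_mul (hC _) (by simpa using hx)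
      (norm_nonneg _) ((norm_nonneg _).trans (hC 0)))
  · have hzero : fderiv ℝ ζ (l • x) = 0 := by
      by_contra hne
      have hlx := hR _ (support_fderiv_subset ℝ hne)
      rw [norm_smul, Real.norm_of_nonneg (ha.le.trans hl)] at hlx
      refine hx (mem_closedBall_zero_iff.2 ((le_div_iff₀ ha).2 ?_))
      nlinarith [norm_nonneg x]
    simp [hzero, indicator_of_notMem hx]

end IsTest

lemma hasDerivAt_integral_comp_smul {g ζ : E N → ℝ} (hg : LocallyIntegrable g volume)
    (hζ : IsTest ζ) :
    HasDerivAt (fun l : ℝ => ∫ x, g x * ζ (l • x)) (∫ x, g x * fderiv ℝ ζ x x) 1 := by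
  obtain ⟨C, R, hCR⟩ := hζ.exists_norm_fderiv_smul_le_indicator one_half_pos
  have key := hasDerivAt_integral_of_dominated_loc_of_deriv_le (μ := volume) (x₀ := (1 : ℝ))
    (s := ball 1 (1 / 2)) (F := fun l x => g x * ζ (l • x))
    (F' := fun l x => g x * fderiv ℝ ζ (l • x) x)
    (bound := (closedBall (0 : E N) R).indicator fun x => ‖g x‖ * C)
    (ball_mem_nhds _ (by norm_num))
    (.of_forall fun l => hg.aestronglyMeasurable.mul
      (hζ.continuous.comp (continuous_const_smul l)).aestronglyMeasurable)
    (by simpa using integrable_mul_of_hasCompactSupport hg hζ.continuous hζ.2)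
    (by simpa only [one_smul] using
      hg.aestronglyMeasurable.fun_mul hζ.continuous_fderiv_self.aestronglyMeasurable)
    (.of_forall fun x l hl => ?_)
    ((integrable_indicator_iff measurableSet_closedBall).2
      ((hg.integrableOn_isCompact (isCompact_closedBall _ _)).norm.mul_const _))
    (.of_forall fun x l _ => (hζ.hasDerivAt_comp_smul x l).const_mul _)
  · simpa using key.2
  · have hl' : 1 / 2 ≤ l := by
      rw [mem_ball, Real.dist_eq, abs_lt] at hl
      linarith
    rw [norm_mul, indicator_mul_right]
    gcongr
    exact hCR l hl' x

lemma hasDerivAt_integral_comp_inv_smul {g ζ : E N → ℝ} (hg : LocallyIntegrable g volume)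
    (hζ : IsTest ζ) :
    HasDerivAt (fun l : ℝ => ∫ x, g x * ζ (l⁻¹ • x)) (-∫ x, g x * fderiv ℝ ζ x x) 1 := by
  have h : HasDerivAt (fun l : ℝ => ∫ x, g x * ζ (l • x)) (∫ x, g x * fderiv ℝ ζ x x)
    ((1 : ℝ)⁻¹) := by simpa using hasDerivAt_integral_comp_smul hg hζ
  simpa [Function.comp_def] using h.comp 1 (hasDerivAt_inv one_ne_zero)

lemma integral_mul_comp_smul {w ζ : E N → ℝ} {l : ℝ} (hl : 0 < l) :
    ∫ x, ζ x * w (l • x) = (l ^ N)⁻¹ * ∫ x, w x * ζ (l⁻¹ • x) := by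
  have := Measure.integral_comp_smul volume (fun x : E N => w x * ζ (l⁻¹ • x)) l
  simp only [smul_smul, inv_mul_cancel₀ hl.ne', one_smul, smul_eq_mul, finrank_euclideanSpace,
    Fintype.card_fin, mul_comm (w _) (ζ _)] at this
  rw [this, abs_of_pos (by positivity)]
  simp only [mul_comm]

section Dilation

variable {V F : Type*} [NormedAddCommGroup V] [NormedSpace ℝ V] [FiniteDimensional ℝ V]
  [MeasurableSpace V] [BorelSpace V] {μ : Measure V} [μ.IsAddHaarMeasure] [NormedAddCommGroup F]
  {w : V → F} {r : ℝ≥0∞} {l : ℝ}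

lemma memLp_comp_smul (hw : MemLp w r μ) (hl : l ≠ 0) : MemLp (fun x => w (l • x)) r μ := by
  have h : MemLp w r (μ.map (l • ·)) := by
    rw [Measure.map_addHaar_smul μ hl]
    exact hw.smul_measure ENNReal.ofReal_ne_top
  exact h.comp_of_map (measurable_const_smul l).aemeasurable

lemma eLpNorm_comp_smul (hw : AEStronglyMeasurable w μ) (hl : l ≠ 0) :
    eLpNorm (fun x => w (l • x)) r μ =
      ENNReal.ofReal |(l ^ Module.finrank ℝ V)⁻¹| ^ (1 / r).toReal * eLpNorm w r μ := by
  rcases eq_or_ne r 0 with rfl | -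
  · simp
  have hmap := Measure.map_addHaar_smul μ hl
  have hm : AEStronglyMeasurable w (μ.map (l • ·)) := by
    rw [hmap]
    exact hw.smul_measure _
  rw [← smul_eq_mul, ← eLpNorm_smul_measure_of_ne_zero, ← hmap,
    eLpNorm_map_measure hm (measurable_const_smul l).aemeasurable, Function.comp_def]
  simp [hl]

end Dilation

lemma inner_comp_smul {G : E N → E N} {l : ℝ} (hl : l ≠ 0) :
    (fun x => inner ℝ (G (l • x)) x) = l⁻¹ • fun x => inner ℝ (G (l • x)) (l • x) := by
  ext x
  simp only [Pi.smul_apply, inner_smul_right, smul_eq_mul, inv_mul_cancel_left₀ hl]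

lemma memLp_inner_comp_smul {G : E N → E N} {r : ℝ≥0∞} {l : ℝ}
    (hG : MemLp (fun x => inner ℝ (G x) x) r volume) (hl : l ≠ 0) :
    MemLp (fun x => inner ℝ (G (l • x)) x) r volume := by
  rw [inner_comp_smul hl]
  exact (memLp_comp_smul hG hl).const_smul _

lemma eLpNorm_inner_comp_smul_le {G : E N → E N} {r : ℝ≥0∞} {a l : ℝ}
    (hG : AEStronglyMeasurable (fun x => inner ℝ (G x) x) volume) (ha : 0 < a) (hl : a ≤ l) :
    eLpNorm (fun x => inner ℝ (G (l • x)) x) r volume ≤ ENNReal.ofReal a⁻¹ *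
      (ENNReal.ofReal (a ^ N)⁻¹ ^ (1 / r).toReal *
        eLpNorm (fun x => inner ℝ (G x) x) r volume) := by
  have hl0 : 0 < l := ha.trans_le hl
  rw [inner_comp_smul hl0.ne', eLpNorm_const_smul, eLpNorm_comp_smul hG hl0.ne',
    Real.enorm_of_nonneg (by positivity), abs_of_pos (by positivity), finrank_euclideanSpace,
    Fintype.card_fin]
  gcongr

namespace HasWeakGradient

variable {w : E N → ℝ} {G : E N → E N} {ζ : E N → ℝ}

lemma hasDerivAt_integral_test_one (h : HasWeakGradient w G) (hζ : IsTest ζ) :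
    HasDerivAt (fun l : ℝ => ∫ x, ζ x * w (l • x)) (∫ x, ζ x * inner ℝ (G x) x) 1 := by
  have hpow : HasDerivAt (fun l : ℝ => (l ^ N)⁻¹) (-(N : ℝ)) 1 := by
    simpa using (hasDerivAt_pow N (1 : ℝ)).fun_inv (by simp)
  have hev : (fun l : ℝ => ∫ x, ζ x * w (l • x)) =ᶠ[𝓝 1]
      (fun l : ℝ => (l ^ N)⁻¹) * fun l : ℝ => ∫ x, w x * ζ (l⁻¹ • x) := by
    filter_upwards [lt_mem_nhds (zero_lt_one' ℝ)] with l hl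
    exact integral_mul_comp_smul hl
  refine ((hpow.mul (hasDerivAt_integral_comp_inv_smul h.1 hζ)).congr_of_eventuallyEq
    hev).congr_deriv ?_
  have hdiv := h.integral_mul_radial_div hζ
  simp only [mul_add, mul_left_comm _ (N : ℝ)] at hdiv
  rw [integral_add
    ((integrable_mul_of_hasCompactSupport h.1 hζ.continuous hζ.2).const_mul _)
    (integrable_mul_of_hasCompactSupport h.1 hζ.continuous_fderiv_self
      hζ.hasCompactSupport_fderiv_self), integral_const_mul] at hdiv
  simp only [one_pow, inv_one, one_smul, one_mul]
  linarith

lemma hasDerivAt_integral_test (h : HasWeakGradient w G) (hζ : IsTest ζ) {l₀ : ℝ} (hl₀ : 0 < l₀) :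
    HasDerivAt (fun l : ℝ => ∫ x, ζ x * w (l • x)) (∫ x, ζ x * inner ℝ (G (l₀ • x)) x) l₀ := by
  have hdiv : HasDerivAt (fun l : ℝ => l / l₀) (1 / l₀) l₀ := (hasDerivAt_id l₀).div_const l₀
  have hone : HasDerivAt (fun l : ℝ => ∫ x, ζ x * w (l₀ • l • x))
      (∫ x, ζ x * inner ℝ (l₀ • G (l₀ • x)) x) (l₀ / l₀) := by
    rw [div_self hl₀.ne']
    exact (h.comp_smul hl₀).hasDerivAt_integral_test_one hζ
  refine ((HasDerivAt.comp (h := fun l : ℝ => l / l₀) l₀ hone hdiv).congr_of_eventuallyEq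
    (.of_forall fun l => ?_)).congr_deriv ?_
  · simp only [Function.comp, smul_smul, mul_div_cancel₀ _ hl₀.ne']
  · simp only [inner_smul_left, conj_trivial, mul_left_comm _ l₀]
    rw [integral_const_mul, mul_right_comm, mul_one_div_cancel hl₀.ne', one_mul]

lemma hasDerivAt_integral (h : HasWeakGradient w G) {r r' : ℝ≥0∞} [ENNReal.HolderConjugate r r']
    (hr : r ≠ ⊤) {k : E N → ℝ} (hk : MemLp k r volume) (hw : MemLp w r' volume)
    (hG : MemLp (fun x => inner ℝ (G x) x) r' volume) :
    HasDerivAt (fun l : ℝ => ∫ x, k x * w (l • x)) (∫ x, k x * inner ℝ (G x) x) 1 := by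
  obtain ⟨ζ, hζ, hlim⟩ := exists_tendsto_test_of_memLp (ENNReal.HolderConjugate.one_le r r') hr hk
  have hpos : ∀ l ∈ Ioi (1 / 2 : ℝ), 0 < l := fun l hl => one_half_pos.trans hl
  have hderiv := hasDerivAt_of_tendstoUniformlyOn (l := atTop) (s := Ioi (1 / 2 : ℝ)) isOpen_Ioi
    (f := fun n l => ∫ x, ζ n x * w (l • x)) (g := fun l => ∫ x, k x * w (l • x))
    (f' := fun n l => ∫ x, ζ n x * inner ℝ (G (l • x)) x)
    (g' := fun l => ∫ x, k x * inner ℝ (G (l • x)) x) (x := 1)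
    (tendstoUniformlyOn_integral_mul (ENNReal.mul_ne_top ENNReal.ofReal_ne_top
        (ENNReal.mul_ne_top (ENNReal.rpow_ne_top_of_nonneg ENNReal.toReal_nonneg
          ENNReal.ofReal_ne_top) hG.2.ne)) hk
      (fun n => (hζ n).continuous.memLp_of_hasCompactSupport (hζ n).2) hlim
      (fun l hl => memLp_inner_comp_smul hG (hpos l hl).ne')
      fun l hl => eLpNorm_inner_comp_smul_le hG.1 one_half_pos (mem_Ioi.1 hl).le)
    (.of_forall fun n l hl => h.hasDerivAt_integral_test (hζ n) (hpos l hl))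
    (fun l hl => ?_) (by norm_num)
  · simpa using hderiv
  · simpa only [mul_comm] using tendsto_integral_mul (r := r') (r' := r)
      (memLp_comp_smul hw (hpos l hl).ne') hk (fun n => (hζ n).continuous.aestronglyMeasurable) hlim

end HasWeakGradient

/-- The normalising constant `A_α` of the Riesz kernel. -/
def rieszConst (N : ℕ) (α : ℝ) : ℝ :=
  Real.Gamma (((N : ℝ) - α) / 2) /
      (Real.Gamma (α / 2) * Real.pi ^ ((N : ℝ) / 2) * (2 : ℝ) ^ α)

/-- The Riesz kernel with values in `[0, ∞]`, for integrals that need not converge. -/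
def rieszE (N : ℕ) (α : ℝ) (x : E N) : ℝ≥0∞ := ENNReal.ofReal (riesz N α x)

/-- The mass of the Riesz kernel in the unit ball. -/
def rieszNear (N : ℕ) (α : ℝ) : ℝ≥0∞ := ∫⁻ x in ball (0 : E N) 1, rieszE N α x

/-- The norm of the Riesz kernel in `L ^ (2N / (N - α))` outside the unit ball. -/
def rieszFar (N : ℕ) (α : ℝ) : ℝ≥0∞ :=
  (∫⁻ x in (ball (0 : E N) 1)ᶜ, rieszE N α x ^ (2 * N / (N - α))) ^ ((N - α) / (2 * N))

/-- The Riesz potential with values in `[0, ∞]`. -/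
def rieszPot (α : ℝ) (f : E N → ℝ≥0∞) (x : E N) : ℝ≥0∞ := ∫⁻ y, rieszE N α (x - y) * f y

/-- The constant which the Hardy–Littlewood–Sobolev inequality below produces for a function `f`
with `∫⁻ f ^ (2N / (N + α)) = A`. -/
def hlsBound (N : ℕ) (α : ℝ) (A : ℝ≥0∞) : ℝ≥0∞ :=
  rieszNear N α + rieszFar N α * A ^ ((N + α) / (2 * N))

section Riesz

variable {α R : ℝ} {f g : E N → ℝ≥0∞}

lemma riesz_eq (α : ℝ) (x : E N) : riesz N α x = rieszConst N α / ‖x‖ ^ ((N : ℝ) - α) := rfl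

lemma rieszConst_pos (hα : 0 < α) (hαN : α < N) : 0 < rieszConst N α := by
  have := Real.Gamma_pos_of_pos (show 0 < ((N : ℝ) - α) / 2 by linarith)
  have := Real.Gamma_pos_of_pos (show 0 < α / 2 by linarith)
  have := Real.pi_pos
  unfold rieszConst
  positivity

lemma riesz_nonneg (hα : 0 < α) (hαN : α < N) (x : E N) : 0 ≤ riesz N α x :=
  div_nonneg (rieszConst_pos hα hαN).le (by positivity)

lemma riesz_neg (α : ℝ) (x : E N) : riesz N α (-x) = riesz N α x := by
  rw [riesz_eq, riesz_eq, norm_neg]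

lemma measurable_riesz (α : ℝ) : Measurable (riesz N α) :=
  measurable_const.div (measurable_norm.pow_const _)

lemma measurable_rieszE (α : ℝ) : Measurable (rieszE N α) := (measurable_riesz α).ennreal_ofReal

lemma measurable_rieszE_sub (α : ℝ) :
    Measurable fun z : E N × E N => rieszE N α (z.1 - z.2) :=
  (measurable_rieszE α).comp (measurable_fst.sub measurable_snd)

lemma measurable_rieszE_const_sub (α : ℝ) (x : E N) : Measurable fun y => rieszE N α (x - y) :=
  (measurable_rieszE α).comp (measurable_const.sub measurable_id)

lemma measurable_rieszPot (hf : Measurable f) : Measurable (rieszPot α f) :=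
  ((measurable_rieszE_sub α).mul (hf.comp measurable_snd)).lintegral_prod_right'

lemma enorm_riesz (hα : 0 < α) (hαN : α < N) (x : E N) : ‖riesz N α x‖ₑ = rieszE N α x :=
  Real.enorm_of_nonneg (riesz_nonneg hα hαN x)

lemma rieszE_sub_comm (α : ℝ) (x y : E N) : rieszE N α (x - y) = rieszE N α (y - x) := by
  rw [rieszE, rieszE, ← riesz_neg, neg_sub]

lemma rieszE_smul (hR : 0 < R) (x : E N) :
    rieszE N α (R • x) = ENNReal.ofReal (R ^ (-((N : ℝ) - α))) * rieszE N α x := by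
  rw [rieszE, rieszE, ← ENNReal.ofReal_mul (by positivity), riesz_eq, riesz_eq, norm_smul,
    Real.norm_of_nonneg hR.le, Real.mul_rpow hR.le (norm_nonneg _), Real.rpow_neg hR.le]
  congr 1
  rw [mul_comm (R ^ _), ← div_div]
  ring

lemma setLIntegral_eq_mul_comp_smul (hR : 0 < R) {s : Set (E N)} (hs : MeasurableSet s)
    (g : E N → ℝ≥0∞) :
    ∫⁻ x in s, g x =
      ENNReal.ofReal (R ^ (N : ℝ)) * ∫⁻ x in (R • · : E N → E N) ⁻¹' s, g (R • x) := by
  let e : E N ≃ᵐ E N := (Homeomorph.smulOfNeZero R hR.ne').toMeasurableEquiv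
  have hmap : (volume : Measure (E N)) = ENNReal.ofReal (R ^ (N : ℝ)) • volume.map e := by
    have h := Measure.map_addHaar_smul (volume : Measure (E N)) hR.ne'
    rw [show ⇑e = (R • ·) from rfl, h, smul_smul, ← ENNReal.ofReal_mul (by positivity),
      finrank_euclideanSpace, Fintype.card_fin, abs_of_pos (by positivity), Real.rpow_natCast,
      mul_inv_cancel₀ (by positivity), ENNReal.ofReal_one, one_smul]
  conv_lhs => rw [hmap]
  rw [Measure.restrict_smul, lintegral_smul_measure, Measure.restrict_map e.measurable hs,
    lintegral_map_equiv, smul_eq_mul]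
  rfl

lemma preimage_smul_ball_zero (hR : 0 < R) : (R • · : E N → E N) ⁻¹' ball 0 R = ball 0 1 := by
  ext x
  simpa [norm_smul, abs_of_pos hR] using mul_lt_iff_lt_one_right hR

lemma lintegral_rieszE_ball (hR : 0 < R) :
    ∫⁻ x in ball (0 : E N) R, rieszE N α x = ENNReal.ofReal (R ^ α) * rieszNear N α := by
  rw [setLIntegral_eq_mul_comp_smul hR measurableSet_ball, preimage_smul_ball_zero hR]
  simp only [rieszE_smul hR]
  rw [lintegral_const_mul' _ _ ENNReal.ofReal_ne_top, ← mul_assoc,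
    ← ENNReal.ofReal_mul (by positivity), ← Real.rpow_add hR, rieszNear]
  ring_nf

lemma lintegral_rieszE_compl (hα : 0 < α) (hαN : α < N) (hR : 0 < R) :
    (∫⁻ x in (ball (0 : E N) R)ᶜ, rieszE N α x ^ (2 * N / (N - α))) ^ ((N - α) / (2 * N)) =
      ENNReal.ofReal (R ^ (-(((N : ℝ) - α) / 2))) * rieszFar N α := by
  have hN : (0 : ℝ) < N := hα.trans hαN
  have hNα : 0 < (N : ℝ) - α := sub_pos.2 hαN
  rw [setLIntegral_eq_mul_comp_smul hR measurableSet_ball.compl, preimage_compl,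
    preimage_smul_ball_zero hR]
  simp only [rieszE_smul hR, ENNReal.mul_rpow_of_nonneg _ _ (by positivity : 0 ≤ 2 * N / (N - α))]
  rw [lintegral_const_mul' _ _ (by finiteness), ← mul_assoc,
    ENNReal.ofReal_rpow_of_pos (by positivity), ← ENNReal.ofReal_mul (by positivity),
    ENNReal.mul_rpow_of_nonneg _ _ (by positivity), rieszFar,
    ENNReal.ofReal_rpow_of_pos (by positivity), ← Real.rpow_mul hR.le, ← Real.rpow_add hR,
    ← Real.rpow_mul hR.le]
  congr 3
  field_simp
  ring

lemma rieszNear_ne_top (hα : 0 < α) (hαN : α < N) : rieszNear N α ≠ ⊤ := by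
  have hN : 1 ≤ N := by exact_mod_cast hα.trans hαN
  have h := integrableOn_ball_of_norm_le_rpow (μ := (volume : Measure (E N))) (by simpa using hN)
    (f := riesz N α) (C := rieszConst N α) (α := N - α) (r := 1) (by simp; linarith)
    (.of_forall fun x => by
      rw [Real.norm_of_nonneg (riesz_nonneg hα hαN x), riesz_eq, Real.rpow_neg (norm_nonneg _)]
      exact le_of_eq (div_eq_mul_inv _ _)) (measurable_riesz α).aestronglyMeasurable
  exact h.lintegral_lt_top.ne

lemma rieszFar_ne_top (hα : 0 < α) (hαN : α < N) : rieszFar N α ≠ ⊤ := by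
  have hN : (0 : ℝ) < N := hα.trans hαN
  have hNα : 0 < (N : ℝ) - α := sub_pos.2 hαN
  have hA := rieszConst_pos hα hαN
  have hdecay : Integrable (fun x : E N => rieszConst N α ^ (2 * N / (N - α)) * 2 ^ (2 * N : ℝ) *
      (1 + ‖x‖) ^ (-(2 * N : ℝ))) volume :=
    (integrable_one_add_norm (by simp; linarith)).const_mul _
  refine ENNReal.rpow_ne_top_of_nonneg (by positivity) (ne_top_of_le_ne_top
    hdecay.lintegral_lt_top.ne ((setLIntegral_mono' measurableSet_ball.compl fun x hx => ?_).trans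
      (setLIntegral_le_lintegral _ _)))
  have hx1 : 1 ≤ ‖x‖ := by simpa using hx
  rw [rieszE, ENNReal.ofReal_rpow_of_nonneg (riesz_nonneg hα hαN x) (by positivity)]
  refine ENNReal.ofReal_le_ofReal ?_
  rw [riesz_eq, Real.div_rpow hA.le (by positivity), ← Real.rpow_mul (norm_nonneg _),
    mul_div_cancel₀ _ hNα.ne', div_eq_mul_inv, ← Real.rpow_neg (norm_nonneg _), mul_assoc]
  gcongr
  rw [Real.rpow_neg (by positivity), Real.rpow_neg (by positivity), ← div_eq_mul_inv,
    ← Real.div_rpow (by positivity) (by positivity), ← Real.inv_rpow (by positivity)]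
  gcongr
  rw [le_div_iff₀ (by positivity), inv_mul_le_iff₀ (by positivity)]
  linarith

lemma hlsBound_ne_top (hα : 0 < α) (hαN : α < N) {A : ℝ≥0∞} (hA : A ≠ ⊤) :
    hlsBound N α A ≠ ⊤ := by
  have hnear := rieszNear_ne_top hα hαN
  have hfar := rieszFar_ne_top hα hαN
  have hpow : A ^ ((N + α) / (2 * N)) ≠ ⊤ :=
    ENNReal.rpow_ne_top_of_nonneg (div_nonneg (by linarith) (by positivity)) hA
  unfold hlsBound
  finiteness

lemma holderConjugate_riesz (hα : 0 < α) (hαN : α < N) :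
    (2 * N / (N - α) : ℝ).HolderConjugate (2 * N / (N + α)) := by
  have hN : (0 : ℝ) < N := hα.trans hαN
  have : (N : ℝ) - α ≠ 0 := (sub_pos.2 hαN).ne'
  rw [Real.holderConjugate_iff]
  refine ⟨by rw [lt_div_iff₀ (by linarith)]; linarith, ?_⟩
  field_simp
  ring

lemma lintegral_riesz_mul_indicator_le (hα : 0 < α) (hαN : α < N) (hf : Measurable f) (x : E N)
    (a : ℝ≥0∞) (hR : 0 < R) :
    ∫⁻ y, rieszE N α (x - y) * {y | f y ≤ a}.indicator f y ≤
      ENNReal.ofReal (R ^ α) * rieszNear N α * a +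
        ENNReal.ofReal (R ^ (-(((N : ℝ) - α) / 2))) * rieszFar N α *
          (∫⁻ y, f y ^ (2 * N / (N + α))) ^ ((N + α) / (2 * N)) := by
  have hs := (holderConjugate_riesz hα hαN).pos
  let near : E N → ℝ≥0∞ := (ball 0 R).indicator (rieszE N α)
  let far : E N → ℝ≥0∞ := (ball 0 R)ᶜ.indicator (rieszE N α)
  have mnear : Measurable fun y => near (x - y) :=
    ((measurable_rieszE α).indicator measurableSet_ball).comp (measurable_const.sub measurable_id)
  have mfar : Measurable fun y => far (x - y) :=
    ((measurable_rieszE α).indicator measurableSet_ball.compl).comp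
      (measurable_const.sub measurable_id)
  have split : ∀ y, rieszE N α (x - y) * {y | f y ≤ a}.indicator f y ≤
      near (x - y) * a + far (x - y) * f y := fun y => by
    have hk : rieszE N α (x - y) = near (x - y) + far (x - y) :=
      (congrFun (indicator_self_add_compl (ball (0 : E N) R) (rieszE N α)) (x - y)).symm
    rw [hk, add_mul]
    gcongr
    · exact indicator_le' (s := {y | f y ≤ a}) (g := fun _ => a) (fun _ hy => hy)
        (fun _ _ => zero_le) y
    · exact indicator_le_self _ _ y
  have hnear : ∫⁻ y, near (x - y) * a = ENNReal.ofReal (R ^ α) * rieszNear N α * a := by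
    rw [lintegral_mul_const _ mnear, lintegral_sub_left_eq_self near x,
      lintegral_indicator measurableSet_ball, lintegral_rieszE_ball hR]
  have hfar : ∫⁻ y, far (x - y) * f y ≤ ENNReal.ofReal (R ^ (-(((N : ℝ) - α) / 2))) *
      rieszFar N α * (∫⁻ y, f y ^ (2 * N / (N + α))) ^ ((N + α) / (2 * N)) := by
    have hpow : (fun y => far y ^ (2 * N / (N - α) : ℝ)) =
        (ball 0 R)ᶜ.indicator fun y => rieszE N α y ^ (2 * N / (N - α) : ℝ) :=
      (indicator_comp_of_zero (g := fun t : ℝ≥0∞ => t ^ (2 * N / (N - α) : ℝ))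
        (ENNReal.zero_rpow_of_pos hs)).symm
    have := ENNReal.lintegral_mul_le_Lp_mul_Lq (volume : Measure (E N))
      (holderConjugate_riesz hα hαN) mfar.aemeasurable hf.aemeasurable
    rwa [lintegral_sub_left_eq_self (fun y => far y ^ (2 * N / (N - α) : ℝ)) x, hpow,
      lintegral_indicator measurableSet_ball.compl, one_div_div, one_div_div,
      lintegral_rieszE_compl hα hαN hR] at this
  exact ((lintegral_mono split).trans_eq (lintegral_add_left (mnear.mul_const _) _)).trans
    (add_le_add hnear.le hfar)

/- The radius `R = a ^ (-2 / (N + α))` balances the two terms of the previous bound. -/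
lemma mul_lintegral_riesz_mul_indicator_le (hα : 0 < α) (hαN : α < N) (hf : Measurable f)
    (x : E N) {a : ℝ≥0∞} (ha : a ≠ ⊤) :
    a * ∫⁻ y, rieszE N α (x - y) * {y | f y ≤ a}.indicator f y ≤
      a ^ (2 * N / (N + α)) * hlsBound N α (∫⁻ y, f y ^ (2 * N / (N + α))) := by
  have hN : (0 : ℝ) < N := hα.trans hαN
  rcases eq_or_ne a 0 with rfl | ha0
  · simp
  obtain ⟨b, hb, rfl⟩ : ∃ b : ℝ, 0 < b ∧ a = ENNReal.ofReal b :=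
    ⟨a.toReal, ENNReal.toReal_pos ha0 ha, (ENNReal.ofReal_toReal ha).symm⟩
  set R : ℝ := b ^ (-(2 / (N + α))) with hR
  have near : ENNReal.ofReal b * (ENNReal.ofReal (R ^ α) * rieszNear N α * ENNReal.ofReal b) =
      ENNReal.ofReal b ^ (2 * N / (N + α)) * rieszNear N α := by
    have hexp : b ^ (2 * N / (N + α)) = b * R ^ α * b := by
      rw [mul_right_comm, ← sq, ← Real.rpow_two, hR, ← Real.rpow_mul hb.le,
        ← Real.rpow_add hb]
      congr 1
      field_simp
      ring
    rw [ENNReal.ofReal_rpow_of_pos hb, hexp, ENNReal.ofReal_mul (by positivity),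
      ENNReal.ofReal_mul hb.le]
    ring
  have far : ENNReal.ofReal b * ENNReal.ofReal (R ^ (-(((N : ℝ) - α) / 2))) =
      ENNReal.ofReal b ^ (2 * N / (N + α)) := by
    rw [ENNReal.ofReal_rpow_of_pos hb, ← ENNReal.ofReal_mul hb.le, hR, ← Real.rpow_mul hb.le]
    nth_rw 1 [← Real.rpow_one b]
    rw [← Real.rpow_add hb]
    congr 2
    field_simp
    ring
  calc _ ≤ ENNReal.ofReal b * (ENNReal.ofReal (R ^ α) * rieszNear N α * ENNReal.ofReal b +
        ENNReal.ofReal (R ^ (-(((N : ℝ) - α) / 2))) * rieszFar N α *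
        (∫⁻ y, f y ^ (2 * N / (N + α))) ^ ((N + α) / (2 * N))) := by
        gcongr
        exact lintegral_riesz_mul_indicator_le hα hαN hf x _ (by positivity)
    _ = _ := by
        rw [mul_add, near, mul_assoc (ENNReal.ofReal (R ^ _)), ← mul_assoc (ENNReal.ofReal b), far,
          ← mul_add, hlsBound]

/-- The part of `∫∫ g(x) I_α(x - y) f(y) dx dy` that comes from the pairs with `f(y) ≤ g(x)`. -/
def lowerRieszEnergy (α : ℝ) (f g : E N → ℝ≥0∞) : ℝ≥0∞ :=
  ∫⁻ x, ∫⁻ y, g x * (rieszE N α (x - y) * {y | f y ≤ g x}.indicator f y)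

lemma measurable_lowerRieszKernel (hf : Measurable f) (hg : Measurable g) :
    Measurable fun z : E N × E N =>
      g z.1 * (rieszE N α (z.1 - z.2) * {y | f y ≤ g z.1}.indicator f z.2) := by
  have hset : MeasurableSet {z : E N × E N | f z.2 ≤ g z.1} :=
    measurableSet_le (hf.comp measurable_snd) (hg.comp measurable_fst)
  exact (hg.comp measurable_fst).mul
    ((measurable_rieszE_sub α).mul ((hf.comp measurable_snd).indicator hset))

lemma lowerRieszEnergy_le (hα : 0 < α) (hαN : α < N) (hf : Measurable f) (hg : Measurable g)
    (hg' : ∫⁻ x, g x ^ (2 * N / (N + α)) ≠ ⊤) :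
    lowerRieszEnergy α f g ≤
      (∫⁻ x, g x ^ (2 * N / (N + α))) * hlsBound N α (∫⁻ y, f y ^ (2 * N / (N + α))) := by
  rw [← lintegral_mul_const _ (hg.pow_const _)]
  refine lintegral_mono_ae ?_
  filter_upwards [ae_lt_top (hg.pow_const _) hg'] with x hx
  have hgx : g x ≠ ⊤ := fun h => by
    rw [h, ENNReal.top_rpow_of_pos (holderConjugate_riesz hα hαN).symm.pos] at hx
    exact lt_irrefl _ hx
  rw [lintegral_const_mul _ ((measurable_rieszE_const_sub α x).fun_mul
    (hf.indicator (measurableSet_le hf measurable_const)))]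
  exact mul_lintegral_riesz_mul_indicator_le hα hαN hf x hgx

lemma lintegral_mul_rieszPot_le_lowerRieszEnergy (hf : Measurable f) (hg : Measurable g) :
    ∫⁻ x, g x * rieszPot α f x ≤ lowerRieszEnergy α f g + lowerRieszEnergy α g f := by
  have mfg := measurable_lowerRieszKernel (α := α) hf hg
  have mgf := measurable_lowerRieszKernel (α := α) hg hf
  have hswap : lowerRieszEnergy α g f =
      ∫⁻ x, ∫⁻ y, f y * (rieszE N α (y - x) * {x | g x ≤ f y}.indicator g x) :=
    lintegral_lintegral_swap mgf.aemeasurable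
  rw [hswap, lowerRieszEnergy, ← lintegral_add_left mfg.lintegral_prod_right']
  refine lintegral_mono fun x => ?_
  have mx : Measurable fun y => g x * (rieszE N α (x - y) * {y | f y ≤ g x}.indicator f y) :=
    mfg.comp measurable_prodMk_left
  dsimp only
  rw [rieszPot, ← lintegral_const_mul _ ((measurable_rieszE_const_sub α x).fun_mul hf),
    ← lintegral_add_left mx]
  refine lintegral_mono fun y => ?_
  dsimp only
  rcases le_total (f y) (g x) with h | h
  · rw [indicator_of_mem (show y ∈ {y | f y ≤ g x} from h)]
    exact le_self_add
  · rw [indicator_of_mem (show x ∈ {x | g x ≤ f y} from h), rieszE_sub_comm α y x,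
      mul_left_comm (f y), mul_comm (f y), mul_left_comm (g x)]
    exact le_add_self

lemma lintegral_mul_rieszPot_le (hα : 0 < α) (hαN : α < N)
    (hf : Measurable f) (hg : Measurable g) (hf' : ∫⁻ x, f x ^ (2 * N / (N + α)) ≠ ⊤)
    (hg' : ∫⁻ x, g x ^ (2 * N / (N + α)) ≠ ⊤) :
    ∫⁻ x, g x * rieszPot α f x ≤
      (∫⁻ x, g x ^ (2 * N / (N + α))) * hlsBound N α (∫⁻ y, f y ^ (2 * N / (N + α))) +
      (∫⁻ x, f x ^ (2 * N / (N + α))) * hlsBound N α (∫⁻ y, g y ^ (2 * N / (N + α))) :=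
  (lintegral_mul_rieszPot_le_lowerRieszEnergy hf hg).trans
    (add_le_add (lowerRieszEnergy_le hα hαN hf hg hg') (lowerRieszEnergy_le hα hαN hg hf hf'))

end Riesz

section Duality

variable {X : Type*} [MeasurableSpace X] {μ : Measure X} {s t : ℝ} {T : X → ℝ≥0∞} {C : ℝ≥0∞}

lemma lintegral_rpow_le_of_le (hst : s.HolderConjugate t)
    (h : ∀ g : X → ℝ≥0∞, Measurable g → ∫⁻ x, g x ^ t ∂μ = 1 → ∫⁻ x, g x * T x ∂μ ≤ C)
    {m : X → ℝ≥0∞} (hm : Measurable m) (hmT : m ≤ T) (hfin : ∫⁻ x, m x ^ s ∂μ ≠ ⊤) :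
    ∫⁻ x, m x ^ s ∂μ ≤ C ^ s := by
  set M := ∫⁻ x, m x ^ s ∂μ with hM
  rcases eq_or_ne M 0 with h0 | h0
  · rw [h0]
    exact zero_le
  set c : ℝ≥0∞ := M ^ (-t⁻¹)
  have normalised : ∫⁻ x, (c * m x ^ (s - 1)) ^ t ∂μ = 1 := by
    have hpow : ∀ x, (c * m x ^ (s - 1)) ^ t = M⁻¹ * m x ^ s := fun x => by
      rw [ENNReal.mul_rpow_of_nonneg _ _ hst.symm.nonneg, ← ENNReal.rpow_mul, ← ENNReal.rpow_mul,
        hst.sub_one_mul_conj, neg_mul, inv_mul_cancel₀ hst.symm.ne_zero, ENNReal.rpow_neg_one]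
    simp only [hpow]
    rw [lintegral_const_mul _ (hm.pow_const _), ← hM, ENNReal.inv_mul_cancel h0 hfin]
  have hcM : c * M = M ^ s⁻¹ := by
    nth_rw 1 [← ENNReal.rpow_one M]
    rw [← ENNReal.rpow_add _ _ h0 hfin, neg_add_eq_sub, ← hst.inv_add_inv_eq_one,
      add_sub_cancel_right]
  have hle : c * M ≤ C := calc
    c * M = ∫⁻ x, c * m x ^ (s - 1) * m x ∂μ := by
      rw [hM, ← lintegral_const_mul _ (hm.pow_const _)]
      refine lintegral_congr fun x => ?_
      nth_rw 3 [← ENNReal.rpow_one (m x)]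
      rw [mul_assoc, ← ENNReal.rpow_add_of_nonneg _ _ hst.sub_one_pos.le zero_le_one,
        sub_add_cancel]
    _ ≤ ∫⁻ x, c * m x ^ (s - 1) * T x ∂μ := lintegral_mono fun x => mul_le_mul_right (hmT x) _
    _ ≤ C := h _ ((hm.pow_const _).const_mul _) normalised
  calc M = (M ^ s⁻¹) ^ s := by
        rw [← ENNReal.rpow_mul, inv_mul_cancel₀ hst.ne_zero, ENNReal.rpow_one]
    _ ≤ C ^ s := ENNReal.rpow_le_rpow (hcM ▸ hle) hst.nonneg

/- Fatou's lemma, applied to truncations of `T` with finite integral. -/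
lemma lintegral_rpow_le_of_forall_lintegral_mul_le [SigmaFinite μ] (hst : s.HolderConjugate t)
    (hT : Measurable T)
    (h : ∀ g : X → ℝ≥0∞, Measurable g → ∫⁻ x, g x ^ t ∂μ = 1 → ∫⁻ x, g x * T x ∂μ ≤ C) :
    ∫⁻ x, T x ^ s ∂μ ≤ C ^ s := by
  let m : ℕ → X → ℝ≥0∞ := fun n => (spanningSets μ n).indicator fun x => min (T x) n
  have hm : ∀ n, Measurable (m n) := fun n =>
    (hT.min measurable_const).indicator (measurableSet_spanningSets μ n)
  have hmT : ∀ n, m n ≤ T := fun n =>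
    indicator_le' (fun x _ => min_le_left _ _) (fun x _ => zero_le)
  have hfin : ∀ n, ∫⁻ x, m n x ^ s ∂μ ≠ ⊤ := fun n => by
    have hle : ∀ x, m n x ^ s ≤ (spanningSets μ n).indicator (fun _ => (n : ℝ≥0∞) ^ s) x := by
      intro x
      by_cases hx : x ∈ spanningSets μ n
      · simp only [m, indicator_of_mem hx]
        exact ENNReal.rpow_le_rpow (min_le_right _ _) hst.nonneg
      · simp [m, indicator_of_notMem hx, hst.pos]
    refine ne_top_of_le_ne_top ?_ (lintegral_mono hle)
    rw [lintegral_indicator (measurableSet_spanningSets μ n), setLIntegral_const]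
    exact ENNReal.mul_ne_top (ENNReal.rpow_ne_top_of_nonneg hst.nonneg (by simp))
      (measure_spanningSets_lt_top μ n).ne
  have hlim : ∀ x, Tendsto (fun n => m n x ^ s) atTop (𝓝 (T x ^ s)) := fun x => by
    have hmin : Tendsto (fun n : ℕ => min (T x) (n : ℝ≥0∞)) atTop (𝓝 (T x)) := by
      simpa using (tendsto_const_nhds (x := T x)).min ENNReal.tendsto_nat_nhds_top
    refine (hmin.ennrpow_const s).congr' ?_
    filter_upwards [eventually_ge_atTop (spanningSetsIndex μ x)] with n hn
    simp only [m, indicator_of_mem (monotone_spanningSets μ hn (mem_spanningSetsIndex μ x))]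
  calc ∫⁻ x, T x ^ s ∂μ = ∫⁻ x, liminf (fun n => m n x ^ s) atTop ∂μ :=
        lintegral_congr fun x => (hlim x).liminf_eq.symm
    _ ≤ liminf (fun n => ∫⁻ x, m n x ^ s ∂μ) atTop :=
        lintegral_liminf_le fun n => (hm n).pow_const _
    _ ≤ C ^ s := by
        refine (liminf_le_liminf (.of_forall fun n =>
          lintegral_rpow_le_of_le hst h (hm n) (hmT n) (hfin n))).trans_eq ?_
        simp

end Duality

section RieszConv

variable {α : ℝ}

lemma lintegral_rieszPot_rpow_lt_top (hα : 0 < α) (hαN : α < N) {f : E N → ℝ≥0∞}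
    (hf : Measurable f) (hf' : ∫⁻ x, f x ^ (2 * N / (N + α)) ≠ ⊤) :
    ∫⁻ x, rieszPot α f x ^ (2 * N / (N - α)) < ⊤ := by
  have hconj := holderConjugate_riesz hα hαN
  have hbound := hlsBound_ne_top hα hαN hf'
  have hone := hlsBound_ne_top hα hαN ENNReal.one_ne_top
  refine (lintegral_rpow_le_of_forall_lintegral_mul_le hconj (measurable_rieszPot hf)
    (C := hlsBound N α (∫⁻ y, f y ^ (2 * N / (N + α))) +
      (∫⁻ x, f x ^ (2 * N / (N + α))) * hlsBound N α 1) fun g hg hg' => ?_).trans_lt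
    (ENNReal.rpow_lt_top_of_nonneg hconj.nonneg (by finiteness))
  simpa only [hg', one_mul] using
    lintegral_mul_rieszPot_le hα hαN hf hg hf' (by simp only [hg', ENNReal.one_ne_top,
      not_false_eq_true, ne_eq])

lemma lintegral_rpow_enorm_ne_top {X : Type*} [MeasurableSpace X] {μ : Measure X} {f : X → ℝ}
    {s : ℝ} (hs : 0 < s) (hf : MemLp f (ENNReal.ofReal s) μ) : ∫⁻ x, ‖f x‖ₑ ^ s ∂μ ≠ ⊤ := by
  have := lintegral_rpow_enorm_lt_top_of_eLpNorm_lt_top (by simpa using hs) ENNReal.ofReal_ne_top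
    hf.2
  rw [ENNReal.toReal_ofReal hs.le] at this
  exact this.ne

lemma rieszConv_congr {f g : E N → ℝ} (h : f =ᵐ[volume] g) : rieszConv α f = rieszConv α g := by
  ext x
  exact integral_congr_ae (h.mono fun y hy => by simp only [hy])

lemma memLp_rieszConv (hα : 0 < α) (hαN : α < N) {f : E N → ℝ}
    (hf : MemLp f (ENNReal.ofReal (2 * N / (N + α))) volume) :
    MemLp (rieszConv α f) (ENNReal.ofReal (2 * N / (N - α))) volume := by
  have hconj := holderConjugate_riesz hα hαN
  obtain ⟨g, hg, hfg⟩ := hf.1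
  rw [rieszConv_congr hfg]
  have hmeas : StronglyMeasurable (Function.uncurry fun x y : E N => riesz N α (x - y) * g y) :=
    (((measurable_riesz α).comp (measurable_fst.sub measurable_snd)).mul
      (hg.measurable.comp measurable_snd)).stronglyMeasurable
  refine ⟨hmeas.integral_prod_right.aestronglyMeasurable, ?_⟩
  rw [eLpNorm_lt_top_iff_lintegral_rpow_enorm_lt_top (by simpa using hconj.pos)
    ENNReal.ofReal_ne_top, ENNReal.toReal_ofReal hconj.nonneg]
  refine lt_of_le_of_lt (lintegral_mono fun x => ?_) (lintegral_rieszPot_rpow_lt_top hα hαN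
    hg.enorm (lintegral_rpow_enorm_ne_top hconj.symm.pos ((memLp_congr_ae hfg).1 hf)))
  refine ENNReal.rpow_le_rpow ((enorm_integral_le_lintegral_enorm _).trans (le_of_eq ?_))
    hconj.nonneg
  simp only [enorm_mul, enorm_riesz hα hαN]
  rfl

lemma integrable_riesz_prod_of_stronglyMeasurable (hα : 0 < α) (hαN : α < N) {f g : E N → ℝ}
    (hf : StronglyMeasurable f) (hg : StronglyMeasurable g)
    (hf' : MemLp f (ENNReal.ofReal (2 * N / (N + α))) volume)
    (hg' : MemLp g (ENNReal.ofReal (2 * N / (N + α))) volume) :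
    Integrable (fun z : E N × E N => riesz N α (z.1 - z.2) * f z.2 * g z.1)
      (volume.prod volume) := by
  have hm : Measurable fun z : E N × E N => riesz N α (z.1 - z.2) * f z.2 * g z.1 :=
    (((measurable_riesz α).comp (measurable_fst.sub measurable_snd)).mul
      (hf.measurable.comp measurable_snd)).mul (hg.measurable.comp measurable_fst)
  refine ⟨hm.aestronglyMeasurable, ?_⟩
  rw [HasFiniteIntegral, lintegral_prod _ hm.enorm.aemeasurable]
  have hs := (holderConjugate_riesz hα hαN).symm.pos
  have hF := lintegral_rpow_enorm_ne_top hs hf'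
  have hG := lintegral_rpow_enorm_ne_top hs hg'
  have hbF := hlsBound_ne_top hα hαN hF
  have hbG := hlsBound_ne_top hα hαN hG
  refine lt_of_le_of_lt (le_of_eq (lintegral_congr fun x => ?_))
    ((lintegral_mul_rieszPot_le hα hαN hf.enorm hg.enorm hF hG).trans_lt (by finiteness))
  rw [rieszPot, ← lintegral_const_mul _ ((measurable_rieszE_const_sub α x).fun_mul hf.enorm)]
  refine lintegral_congr fun y => ?_
  rw [enorm_mul, enorm_mul, enorm_riesz hα hαN, mul_comm]

lemma integrable_riesz_prod (hα : 0 < α) (hαN : α < N) {f g : E N → ℝ}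
    (hf : MemLp f (ENNReal.ofReal (2 * N / (N + α))) volume)
    (hg : MemLp g (ENNReal.ofReal (2 * N / (N + α))) volume) :
    Integrable (fun z : E N × E N => riesz N α (z.1 - z.2) * f z.2 * g z.1)
      (volume.prod volume) := by
  obtain ⟨f', hf', hff⟩ := hf.1
  obtain ⟨g', hg', hgg⟩ := hg.1
  refine (integrable_riesz_prod_of_stronglyMeasurable hα hαN hf' hg' ((memLp_congr_ae hff).1 hf)
    ((memLp_congr_ae hgg).1 hg)).congr ?_
  filter_upwards [Measure.quasiMeasurePreserving_snd.ae_eq_comp hff,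
    Measure.quasiMeasurePreserving_fst.ae_eq_comp hgg] with z hz hz'
  simp only [Function.comp] at hz hz'
  rw [hz, hz']

end RieszConv

section Powers

lemma abs_rpow_sub_two_mul_self (a : ℝ) {q : ℝ} (hq : 1 < q) :
    |(|a| ^ (q - 2) * a)| = |a| ^ (q - 1) := by
  rcases eq_or_ne a 0 with rfl | ha
  · simp [Real.zero_rpow (show q - 1 ≠ 0 by linarith)]
  · rw [abs_mul, abs_of_nonneg (by positivity), ← Real.rpow_add_one (abs_pos.2 ha).ne']
    ring_nf

lemma rpow_sub_two_mul_self_mul_self (a : ℝ) {q : ℝ} (hq : 1 < q) :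
    |a| ^ (q - 2) * a * a = |a| ^ q := by
  rcases eq_or_ne a 0 with rfl | ha
  · simp [Real.zero_rpow (show q ≠ 0 by linarith)]
  · have := (abs_pos.2 ha).ne'
    rw [mul_assoc, ← abs_mul_abs_self a, ← mul_assoc, ← Real.rpow_add_one this,
      ← Real.rpow_add_one this]
    ring_nf

lemma rpow_sub_two_mul_self_mul_sub_le (a b : ℝ) {q : ℝ} (hq : 1 < q) :
    |a| ^ (q - 2) * a * (b - a) ≤ (|b| ^ q - |a| ^ q) / q := by
  have young : |a| ^ (q - 2) * a * b ≤ |a| ^ q - |a| ^ q / q + |b| ^ q / q := calc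
    |a| ^ (q - 2) * a * b ≤ |a| ^ (q - 1) * |b| := by
      rw [← abs_rpow_sub_two_mul_self a hq, ← abs_mul]
      exact le_abs_self _
    _ ≤ (|a| ^ (q - 1)) ^ (q / (q - 1)) / (q / (q - 1)) + |b| ^ q / q :=
      Real.young_inequality_of_nonneg (by positivity) (abs_nonneg b)
        (Real.HolderConjugate.conjExponent hq).symm
    _ = |a| ^ q - |a| ^ q / q + |b| ^ q / q := by
      rw [← Real.rpow_mul (abs_nonneg a), mul_div_cancel₀ _ (by linarith : q - 1 ≠ 0)]
      field_simp
  rw [mul_sub, rpow_sub_two_mul_self_mul_self a hq, sub_div]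
  linarith

end Powers

section MemLpPowers

variable {X : Type*} [MeasurableSpace X] {μ : Measure X} {u w : X → ℝ} {r s t : ℝ}

lemma holderTriple_ofReal {a b c : ℝ} (ha : 0 < a) (hb : 0 < b) (hc : 0 < c)
    (h : a⁻¹ + b⁻¹ = c⁻¹) :
    ENNReal.HolderTriple (ENNReal.ofReal a) (ENNReal.ofReal b) (ENNReal.ofReal c) := by
  constructor
  rw [← ENNReal.ofReal_inv_of_pos ha, ← ENNReal.ofReal_inv_of_pos hb,
    ← ENNReal.ofReal_inv_of_pos hc, ← ENNReal.ofReal_add (by positivity) (by positivity), h]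

lemma holderConjugate_ofReal (h : s.HolderConjugate t) :
    ENNReal.HolderConjugate (ENNReal.ofReal s) (ENNReal.ofReal t) := by
  simpa using holderTriple_ofReal h.pos h.symm.pos one_pos (by simpa using h.inv_add_inv_eq_one)

lemma memLp_abs_rpow (ht : 0 < t) (hu : MemLp u (ENNReal.ofReal s) μ) :
    MemLp (fun x => |u x| ^ t) (ENNReal.ofReal (s / t)) μ := by
  simpa only [Real.norm_eq_abs, ENNReal.toReal_ofReal ht.le, ← ENNReal.ofReal_div_of_pos ht] using
    hu.norm_rpow_div (ENNReal.ofReal t)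

lemma memLp_of_memLp_abs_rpow (ht : 0 < t) (hu : AEStronglyMeasurable u μ)
    (h : MemLp (fun x => |u x| ^ t) (ENNReal.ofReal s) μ) :
    MemLp u (ENNReal.ofReal (s * t)) μ := by
  rw [← memLp_norm_rpow_iff (q := ENNReal.ofReal t) hu (by simpa using ht) ENNReal.ofReal_ne_top,
    ENNReal.toReal_ofReal ht.le, ← ENNReal.ofReal_div_of_pos ht, mul_div_cancel_right₀ _ ht.ne']
  exact h

lemma memLp_rpow_sub_two_mul (hr : 1 < r) (hu : MemLp u (ENNReal.ofReal s) μ) :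
    MemLp (fun x => |u x| ^ (r - 2) * u x) (ENNReal.ofReal (s / (r - 1))) μ := by
  refine (memLp_abs_rpow (sub_pos.2 hr) hu).mono
    ((hu.1.norm.aemeasurable.pow_const _).aestronglyMeasurable.mul hu.1) (.of_forall fun x => ?_)
  rw [Real.norm_eq_abs, abs_rpow_sub_two_mul_self _ hr, Real.norm_of_nonneg (by positivity)]

lemma memLp_mul_rpow_sub_two_mul (hst : s.HolderConjugate t) (hr : 1 < r)
    (hw : MemLp w (ENNReal.ofReal t) μ) (hu : MemLp u (ENNReal.ofReal (s * r)) μ) :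
    MemLp (fun x => w x * (|u x| ^ (r - 2) * u x)) (ENNReal.ofReal (s * r).conjExponent) μ := by
  have hs := hst.lt
  have hconj := Real.HolderConjugate.conjExponent (one_lt_mul_of_lt_of_le hs hr.le)
  have exponents : t⁻¹ + (s * r / (r - 1))⁻¹ = (s * r).conjExponent⁻¹ := by
    rw [← sub_eq_of_eq_add' hst.inv_add_inv_eq_one.symm,
      ← sub_eq_of_eq_add' hconj.inv_add_inv_eq_one.symm]
    have : r - 1 ≠ 0 := by linarith
    field_simp
    ring
  have := holderTriple_ofReal hst.symm.pos (div_pos (by nlinarith) (by linarith)) hconj.symm.pos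
    exponents
  exact (memLp_rpow_sub_two_mul hr hu).mul (p := ENNReal.ofReal t) hw

end MemLpPowers

section Superharmonic

/-- A `C¹` substitute for the square of the negative part, with bounded derivative: it vanishes on
`[0, ∞)` and is positive on `(-∞, 0)`. -/
def smoothNegPart (t : ℝ) : ℝ :=
  ∫ s in (0 : ℝ)..t, max (-1) (min s 0)

lemma hasDerivAt_smoothNegPart (t : ℝ) :
    HasDerivAt smoothNegPart (max (-1) (min t 0)) t :=
  ((show Continuous fun s : ℝ => max (-1) (min s 0) by fun_prop).integral_hasStrictDerivAt
    0 t).hasDerivAt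

lemma deriv_smoothNegPart : deriv smoothNegPart = fun t => max (-1) (min t 0) :=
  funext fun t => (hasDerivAt_smoothNegPart t).deriv

lemma contDiff_smoothNegPart : ContDiff ℝ 1 smoothNegPart :=
  contDiff_one_iff_deriv.2 ⟨fun t => (hasDerivAt_smoothNegPart t).differentiableAt, by
    rw [deriv_smoothNegPart]
    fun_prop⟩

lemma deriv_smoothNegPart_nonpos (t : ℝ) : deriv smoothNegPart t ≤ 0 := by
  rw [deriv_smoothNegPart]
  exact max_le (by norm_num) (min_le_right _ _)

lemma norm_deriv_smoothNegPart_le (t : ℝ) : ‖deriv smoothNegPart t‖ ≤ 1 := by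
  refine abs_le.2 ⟨?_, (deriv_smoothNegPart_nonpos t).trans zero_le_one⟩
  rw [deriv_smoothNegPart]
  exact le_max_left _ _

lemma smoothNegPart_zero : smoothNegPart 0 = 0 :=
  intervalIntegral.integral_same

lemma smoothNegPart_pos {t : ℝ} (ht : t < 0) : 0 < smoothNegPart t := by
  rw [smoothNegPart, intervalIntegral.integral_symm, ← intervalIntegral.integral_neg]
  refine intervalIntegral.intervalIntegral_pos_of_pos_on
    (Continuous.intervalIntegrable (by fun_prop) _ _) (fun s hs => ?_) ht
  exact neg_pos.2 (max_lt (by norm_num) (min_lt_of_left_lt hs.2))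

lemma smoothNegPart_nonneg (t : ℝ) : 0 ≤ smoothNegPart t := by
  rcases lt_or_ge t 0 with ht | ht
  · exact (smoothNegPart_pos ht).le
  · exact intervalIntegral.integral_nonneg ht fun s hs => by simp [hs.1]

lemma norm_smoothNegPart_le (t : ℝ) : ‖smoothNegPart t‖ ≤ ‖t‖ := by
  simpa [smoothNegPart_zero] using convex_univ.norm_image_sub_le_of_norm_deriv_le
    (fun s _ => (hasDerivAt_smoothNegPart s).differentiableAt)
    (fun s _ => norm_deriv_smoothNegPart_le s) (mem_univ 0) (mem_univ t)

lemma ae_eq_zero_of_integral_inner_smul_nonneg {X H : Type*} [MeasurableSpace X] {μ : Measure X}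
    [NormedAddCommGroup H] [InnerProductSpace ℝ H] {a : X → ℝ} {G : X → H} (ha : ∀ x, a x ≤ 0)
    (hint : Integrable (fun x => inner ℝ (a x • G x) (G x)) μ)
    (h : 0 ≤ ∫ x, inner ℝ (a x • G x) (G x) ∂μ) : (fun x => a x • G x) =ᵐ[μ] 0 := by
  have nonpos : ∀ x, inner ℝ (a x • G x) (G x) ≤ 0 := fun x => by
    rw [inner_smul_left]
    exact mul_nonpos_of_nonpos_of_nonneg (ha x) real_inner_self_nonneg
  have hzero : (fun x => -inner ℝ (a x • G x) (G x)) =ᵐ[μ] 0 := by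
    refine (integral_eq_zero_iff_of_nonneg (fun x => neg_nonneg.2 (nonpos x)) hint.neg).1 ?_
    rw [integral_neg, h.antisymm' (integral_nonpos nonpos), neg_zero]
  filter_upwards [hzero] with x hx
  simpa [inner_smul_left] using hx

/- The test function `F ∘ v`, with `F` the smooth negative part, gives `∫ F'(v) |∇v|² ≥ 0`
although `F' ≤ 0`, so `∇(F ∘ v) = F'(v) ∇v = 0`. -/
lemma HasWeakGradient.ae_nonneg_of_superharmonic (hN : 3 ≤ N) {v : E N → ℝ} {G : E N → E N}
    (h : HasWeakGradient v G) (hv : MemLp v 2 volume) (hG : MemLp G 2 volume)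
    (hsuper : ∀ (w : E N → ℝ) (H : E N → E N), HasWeakGradient w H → MemLp w 2 volume →
      MemLp H 2 volume → 0 ≤ w → 0 ≤ ∫ x, inner ℝ (H x) (G x)) : ∀ᵐ x, 0 ≤ v x := by
  have hF := contDiff_smoothNegPart
  have hw := h.comp hv hG hF norm_deriv_smoothNegPart_le smoothNegPart_zero
  have w2 : MemLp (fun x => smoothNegPart (v x)) 2 volume :=
    hv.mono (hF.continuous.comp_aestronglyMeasurable hv.1)
      (.of_forall fun x => norm_smoothNegPart_le (v x))
  have H2 : MemLp (fun x => deriv smoothNegPart (v x) • G x) 2 volume :=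
    hG.mono ((hF.continuous_deriv_one.comp_aestronglyMeasurable hv.1).smul hG.1)
      (.of_forall fun x => by
        rw [norm_smul]
        exact mul_le_of_le_one_left (norm_nonneg _) (norm_deriv_smoothNegPart_le _))
  have gradient_eq_zero := ae_eq_zero_of_integral_inner_smul_nonneg
    (fun x => deriv_smoothNegPart_nonpos (v x)) (integrable_inner (r := 2) (r' := 2) H2 hG)
    (hsuper _ _ hw w2 H2 fun x => smoothNegPart_nonneg (v x))
  filter_upwards [hw.eq_zero hN w2 gradient_eq_zero] with x hx
  by_contra hlt
  exact (smoothNegPart_pos (not_le.1 hlt)).ne' hx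

end Superharmonic

section LocalLp

variable {r : ℝ≥0∞}

lemma memLp_smul_of_memLpLoc {F : Type*} [NormedAddCommGroup F] [NormedSpace ℝ F] {η : E N → ℝ}
    {f : E N → F} (hη : Continuous η) (hηc : HasCompactSupport η) (hf : MemLpLoc f r) :
    MemLp (fun x => η x • f x) r volume := by
  have hind : MemLp (indicator (tsupport η) f) r volume :=
    (memLp_indicator_iff_restrict (isClosed_tsupport η).measurableSet).2 (hf _ hηc)
  refine (hind.smul (p := ⊤) (r := r)
    (hη.memLp_of_hasCompactSupport hηc)).ae_eq (.of_forall fun x => ?_)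
  by_cases hx : x ∈ tsupport η
  · simp [hx]
  · simp [hx, image_eq_zero_of_notMem_tsupport hx]

lemma memLpLoc_inner_self {G : E N → E N} (hG : AEStronglyMeasurable G volume)
    (h : MemLpLoc (fun x => ‖G x‖) r) : MemLpLoc (fun x => inner ℝ (G x) x) r := by
  intro C hC
  obtain ⟨R, hR⟩ := hC.isBounded.subset_closedBall (0 : E N)
  refine ((h C hC).const_mul R).mono (hG.restrict.inner aestronglyMeasurable_id)
    ((ae_restrict_iff' hC.measurableSet).2 (.of_forall fun x hx => ?_))
  have hxR : ‖x‖ ≤ R := mem_closedBall_zero_iff.1 (hR hx)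
  calc ‖inner ℝ (G x) x‖ ≤ ‖G x‖ * ‖x‖ := norm_inner_le_norm _ _
    _ ≤ R * ‖G x‖ := by rw [mul_comm]; gcongr
    _ = ‖R * ‖G x‖‖ := (Real.norm_of_nonneg
      (mul_nonneg ((norm_nonneg x).trans hxR) (norm_nonneg _))).symm

lemma inner_smul_add_smul_gradient (η : E N → ℝ) (x v g : E N) (a c : ℝ) :
    inner ℝ (a • g + c • gradient η x) v = a * inner ℝ g v + fderiv ℝ η x v * c := by
  rw [inner_add_left, real_inner_smul_left, real_inner_smul_left, inner_gradient_left, mul_comm c]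

namespace IsTest

variable {η : E N → ℝ}

lemma memLp_smul {F : Type*} [NormedAddCommGroup F] [NormedSpace ℝ F] (hη : IsTest η)
    {f : E N → F} (hf : MemLp f r volume) : MemLp (fun x => η x • f x) r volume :=
  hf.smul (p := ⊤) (hη.continuous.memLp_of_hasCompactSupport hη.2)

lemma memLp_smul_gradient (hη : IsTest η) {f : E N → ℝ} (hf : MemLp f r volume) :
    MemLp (fun x => f x • gradient η x) r volume :=
  (hη.continuous_gradient.memLp_of_hasCompactSupport (p := ⊤)
    hη.hasCompactSupport_gradient).smul hf

lemma memLp_fderiv_apply (hη : IsTest η) {G : E N → E N} (hG : MemLp G r volume) :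
    MemLp (fun x => fderiv ℝ η x (G x)) r volume := by
  have hDη : Continuous (fderiv ℝ η) := hη.1.continuous_fderiv (by simp)
  obtain ⟨B, hB⟩ := (hη.2.fderiv ℝ).exists_bound_of_continuous hDη
  refine hG.of_le_mul (c := B) ?_ (.of_forall fun x => ?_)
  · simpa only [inner_gradient_left] using
      hη.continuous_gradient.aestronglyMeasurable.inner (𝕜 := ℝ) hG.1
  · exact (ContinuousLinearMap.le_opNorm _ _).trans
      (mul_le_mul_of_nonneg_right (hB x) (norm_nonneg _))

lemma memLp_inner_smul_add_smul_gradient_self (hη : IsTest η) {w : E N → ℝ} {G : E N → E N}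
    (hw : MemLp w r volume) (hGm : AEStronglyMeasurable G volume)
    (hG : MemLpLoc (fun x => ‖G x‖) r) :
    MemLp (fun x => inner ℝ (η x • G x + w x • gradient η x) x) r volume := by
  simp only [inner_smul_add_smul_gradient]
  exact (memLp_smul_of_memLpLoc hη.continuous hη.2 (memLpLoc_inner_self hGm hG)).add
    (memLp_smul_of_memLpLoc hη.continuous_fderiv_self hη.hasCompactSupport_fderiv_self
      fun C _ => hw.restrict C)

end IsTest

end LocalLp

namespace HasWeakGradient

variable {w : E N → ℝ} {G : E N → E N}

lemma hasDerivAt_integral_of_hasCompactSupport (h : HasWeakGradient w G) {r r' : ℝ≥0∞}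
    [ENNReal.HolderConjugate r r'] (hr : r ≠ ⊤) {k : E N → ℝ} (hk : MemLp k r volume)
    (hkc : HasCompactSupport k) (hw : MemLp w r' volume) (hG : MemLpLoc (fun x => ‖G x‖) r') :
    HasDerivAt (fun l : ℝ => ∫ x, k x * w (l • x)) (∫ x, k x * inner ℝ (G x) x) 1 := by
  obtain ⟨R, hR, hkR⟩ : ∃ R : ℝ, 0 < R ∧ ∀ x, R < ‖x‖ → k x = 0 := by
    obtain ⟨R, hR, hsub⟩ := hkc.isBounded.subset_closedBall_lt 0 (0 : E N)
    refine ⟨R, hR, fun x hx => image_eq_zero_of_notMem_tsupport fun hmem => ?_⟩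
    exact hx.not_ge (mem_closedBall_zero_iff.1 (hsub hmem))
  have hR2 : 0 < 2 * R := by positivity
  have hχ := isTest_cutoff (N := N) hR2
  have key := (h.contDiff_mul hχ.1).hasDerivAt_integral hr hk (hχ.memLp_smul hw)
    (hχ.memLp_inner_smul_add_smul_gradient_self hw h.2.1.aestronglyMeasurable hG)
  refine (key.congr_deriv (integral_congr_ae (.of_forall fun x => ?_))).congr_of_eventuallyEq ?_
  · rcases le_or_gt ‖x‖ R with hx | hx
    · simp only [inner_smul_add_smul_gradient,
        cutoff_eq_one hR2 (show ‖x‖ ≤ 2 * R by linarith),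
        fderiv_cutoff_eq_zero_of_norm_lt hR2 (show ‖x‖ < 2 * R by linarith)]
      simp
    · simp only [hkR x hx, zero_mul]
  · filter_upwards [Ioo_mem_nhds (zero_lt_one' ℝ) one_lt_two] with l hl
    refine integral_congr_ae (.of_forall fun x => ?_)
    rcases le_or_gt ‖x‖ R with hx | hx
    · have hlx : ‖l • x‖ ≤ 2 * R := by
        rw [norm_smul, Real.norm_of_nonneg hl.1.le]
        exact mul_le_mul hl.2.le hx (norm_nonneg _) zero_le_two
      simp only [cutoff_eq_one hR2 hlx, one_mul]
    · simp only [hkR x hx, zero_mul]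

lemma hasDerivAt_integral_smul_gradient (h : HasWeakGradient w G) (hw : MemLp w 2 volume)
    {k : E N → E N} (hk : MemLp k 2 volume) (hG : MemLpLoc (fun x => ‖G x‖) 2)
    {η : E N → ℝ} (hη : IsTest η) :
    HasDerivAt (fun l : ℝ => ∫ x, inner ℝ (w (l • x) • gradient η (l • x)) (k x))
      (∑ i : Fin N, ∫ x, k x i *
        (fderiv ℝ η x (EuclideanSpace.single i 1) * inner ℝ (G x) x +
          fderiv ℝ (fun y => fderiv ℝ η y (EuclideanSpace.single i 1)) x x * w x)) 1 := by
  have hηi : ∀ i : Fin N, IsTest fun x => fderiv ℝ η x (EuclideanSpace.single i 1) :=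
    fun i => hη.fderiv_apply _
  have hderiv : ∀ i, HasDerivAt
      (fun l : ℝ => ∫ x, k x i * (fderiv ℝ η (l • x) (EuclideanSpace.single i 1) * w (l • x)))
      (∫ x, k x i * (fderiv ℝ η x (EuclideanSpace.single i 1) * inner ℝ (G x) x +
        fderiv ℝ (fun y => fderiv ℝ η y (EuclideanSpace.single i 1)) x x * w x)) 1 := fun i => by
    simpa only [inner_smul_add_smul_gradient] using
      (h.contDiff_mul (hηi i).1).hasDerivAt_integral (r := 2) (r' := 2) (by norm_num)
        (hk.eval_piLp i)
        ((hηi i).memLp_smul hw)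
        ((hηi i).memLp_inner_smul_add_smul_gradient_self hw h.2.1.aestronglyMeasurable hG)
  refine (HasDerivAt.fun_sum (u := Finset.univ) fun i _ => hderiv i).congr_of_eventuallyEq ?_
  filter_upwards [lt_mem_nhds (zero_lt_one' ℝ)] with l hl
  have hint : ∀ i ∈ Finset.univ, Integrable fun x =>
      k x i * (fderiv ℝ η (l • x) (EuclideanSpace.single i 1) * w (l • x)) := fun i _ =>
    (hk.eval_piLp i).integrable_mul (p := 2) (q := 2)
      (memLp_comp_smul ((hηi i).memLp_smul hw) hl.ne')
  rw [← integral_finsetSum _ hint]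
  refine integral_congr_ae (.of_forall fun x => ?_)
  simp only [real_inner_smul_left, inner_gradient_left]
  conv_lhs => rw [← sum_apply_smul_single (k x), map_sum, Finset.mul_sum]
  refine Finset.sum_congr rfl fun i _ => ?_
  rw [map_smul, smul_eq_mul]
  ring

end HasWeakGradient

lemma hasDerivAt_inv_pow_one (k : ℕ) : HasDerivAt (fun l : ℝ => (l ^ k)⁻¹) (-k) 1 := by
  simpa using (hasDerivAt_pow k (1 : ℝ)).fun_inv (by simp)

section Dilation

variable {F : Type*} [NormedAddCommGroup F] {G : E N → F} {η : E N → ℝ}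

lemma integrable_norm_sq_mul (hG : MemLp G 2 volume) (hη : IsTest η) :
    Integrable fun x => ‖G x‖ ^ 2 * η x :=
  integrable_mul_of_hasCompactSupport (hG.integrable_norm_pow two_ne_zero).locallyIntegrable
    hη.continuous hη.2

variable [InnerProductSpace ℝ F]

lemma inner_le_half_norm_sq_add (a b : F) : inner ℝ a b ≤ 1 / 2 * (‖a‖ ^ 2 + ‖b‖ ^ 2) := by
  nlinarith [real_inner_le_norm a b, sq_nonneg (‖a‖ - ‖b‖)]

lemma integral_inner_smul_sub_le (hG : MemLp G 2 volume) (hη : IsTest η) (hη0 : ∀ x, 0 ≤ η x)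
    {l : ℝ} (hl : 0 < l) (c : ℝ) :
    ∫ x, inner ℝ (η x • (c • G (l • x) - G x)) (G x) ≤
      1 / 2 * (c ^ 2 * (l ^ N)⁻¹ * (∫ x, ‖G x‖ ^ 2 * η (l⁻¹ • x)) - ∫ x, ‖G x‖ ^ 2 * η x) := by
  have hGl := memLp_comp_smul hG hl.ne'
  have i₁ := (integrable_norm_sq_mul hGl hη).const_mul (c ^ 2)
  have i₂ := integrable_norm_sq_mul hG hη
  have hmono : ∀ x, inner ℝ (η x • (c • G (l • x) - G x)) (G x) ≤
      1 / 2 * (c ^ 2 * (‖G (l • x)‖ ^ 2 * η x) - ‖G x‖ ^ 2 * η x) := fun x => by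
    have h := mul_le_mul_of_nonneg_left (inner_le_half_norm_sq_add (c • G (l • x)) (G x)) (hη0 x)
    rw [norm_smul, mul_pow, Real.norm_eq_abs, sq_abs] at h
    rw [real_inner_smul_left, inner_sub_left, real_inner_self_eq_norm_sq]
    linarith
  calc _ ≤ ∫ x, 1 / 2 * (c ^ 2 * (‖G (l • x)‖ ^ 2 * η x) - ‖G x‖ ^ 2 * η x) :=
        integral_mono (integrable_inner (hη.memLp_smul ((hGl.const_smul c).sub hG)) hG)
          ((i₁.sub i₂).const_mul _) hmono
    _ = _ := by
      rw [integral_const_mul, integral_sub i₁ i₂, integral_const_mul, mul_assoc (c ^ 2),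
        ← integral_mul_comp_smul hl (w := fun x => ‖G x‖ ^ 2)]
      simp only [mul_comm (η _)]

lemma integral_inner_smul_comp_le {G : E N → E N} (hG : MemLp G 2 volume) (hη : IsTest η)
    (hη0 : ∀ x, 0 ≤ η x) {l : ℝ} (hl : 0 < l) :
    ∫ x, inner ℝ (η (l⁻¹ • x) • G (l⁻¹ • x)) (G x) ≤
      1 / 2 * (l ^ N * (∫ x, ‖G x‖ ^ 2 * η x) + ∫ x, ‖G x‖ ^ 2 * η (l⁻¹ • x)) := by
  have hl' : 0 < l⁻¹ := inv_pos.2 hl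
  have hηl := hη.comp_smul hl'.ne'
  have hGl := memLp_comp_smul hG hl'.ne'
  have i₁ := integrable_norm_sq_mul hGl hηl
  have i₂ := integrable_norm_sq_mul hG hηl
  have change : ∫ x, ‖G (l⁻¹ • x)‖ ^ 2 * η (l⁻¹ • x) = l ^ N * ∫ x, ‖G x‖ ^ 2 * η x := by
    simpa using integral_mul_comp_smul hl' (w := fun x => ‖G x‖ ^ 2 * η x) (ζ := fun _ => 1)
  rw [← change, ← integral_add i₁ i₂, ← integral_const_mul]
  refine integral_mono (integrable_inner (hηl.memLp_smul hGl) hG) ((i₁.add i₂).const_mul _)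
    fun x => ?_
  have h := mul_le_mul_of_nonneg_left (inner_le_half_norm_sq_add (G (l⁻¹ • x)) (G x))
    (hη0 (l⁻¹ • x))
  rw [real_inner_smul_left]
  linarith

lemma integral_inner_dilation_sub_le {φ : E N → ℝ} {G : E N → E N} (hφ : MemLp φ 2 volume)
    (hG : MemLp G 2 volume) (hη : IsTest η) (hη0 : ∀ x, 0 ≤ η x) {l : ℝ} (hl : 0 < l) :
    ∫ x, inner ℝ ((l ^ N)⁻¹ • l⁻¹ • (η (l⁻¹ • x) • G (l⁻¹ • x) +
        φ (l⁻¹ • x) • gradient η (l⁻¹ • x)) - (η x • G x + φ x • gradient η x)) (G x) ≤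
      1 / 2 * l⁻¹ * (∫ x, ‖G x‖ ^ 2 * η x) +
        1 / 2 * (l ^ (N + 1))⁻¹ * (∫ x, ‖G x‖ ^ 2 * η (l⁻¹ • x)) - (∫ x, ‖G x‖ ^ 2 * η x) +
        ((l ^ (N + 1))⁻¹ * (∫ x, inner ℝ (φ (l⁻¹ • x) • gradient η (l⁻¹ • x)) (G x)) -
          ∫ x, inner ℝ (φ x • gradient η x) (G x)) := by
  have hl' : l⁻¹ ≠ 0 := inv_ne_zero hl.ne'
  have j₁ := integrable_inner (memLp_comp_smul (hη.memLp_smul hG) hl') hG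
  have j₂ := integrable_inner (memLp_comp_smul (hη.memLp_smul_gradient hφ) hl') hG
  have j₃ := integrable_inner (hη.memLp_smul hG) hG
  have j₄ := integrable_inner (hη.memLp_smul_gradient hφ) hG
  have split : ∀ x, inner ℝ ((l ^ N)⁻¹ • l⁻¹ • (η (l⁻¹ • x) • G (l⁻¹ • x) +
        φ (l⁻¹ • x) • gradient η (l⁻¹ • x)) - (η x • G x + φ x • gradient η x)) (G x) =
      (l ^ (N + 1))⁻¹ * (inner ℝ (η (l⁻¹ • x) • G (l⁻¹ • x)) (G x) +
        inner ℝ (φ (l⁻¹ • x) • gradient η (l⁻¹ • x)) (G x)) -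
      (inner ℝ (η x • G x) (G x) + inner ℝ (φ x • gradient η x) (G x)) := fun x => by
    rw [inner_sub_left, inner_add_left, smul_smul, real_inner_smul_left, inner_add_left, pow_succ,
      mul_inv]
  have diag : ∫ x, inner ℝ (η x • G x) (G x) = ∫ x, ‖G x‖ ^ 2 * η x := by
    simp only [real_inner_smul_left, real_inner_self_eq_norm_sq, mul_comm]
  simp only [split]
  rw [integral_sub (by exact (j₁.add j₂).const_mul _) (by exact j₃.add j₄), integral_const_mul,
    integral_add j₁ j₂, integral_add j₃ j₄, diag]
  have hpow : (l ^ (N + 1))⁻¹ * l ^ N = l⁻¹ := by rw [pow_succ]; field_simp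
  have h := mul_le_mul_of_nonneg_left (integral_inner_smul_comp_le hG hη hη0 hl)
    (show 0 ≤ (l ^ (N + 1))⁻¹ by positivity)
  linear_combination h + 1 / 2 * (∫ x, ‖G x‖ ^ 2 * η x) * hpow

end Dilation

lemma eq_of_hasDerivAt_of_eventually_le {f g : ℝ → ℝ} {f' g' a : ℝ} (hf : HasDerivAt f f' a)
    (hg : HasDerivAt g g' a) (heq : f a = g a) (hle : ∀ᶠ x in 𝓝 a, f x ≤ g x) : f' = g' := by
  have hmin : IsLocalMin (fun x => g x - f x) a := by
    filter_upwards [hle] with x hx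
    linarith
  linarith [hmin.hasDerivAt_eq_zero (hg.fun_sub hf)]

/-- `g = x · ∇f` in the sense of distributions. Testing against nonnegative functions is enough,
and it is what convexity arguments provide. -/
def IsWeakRadialDeriv (f g : E N → ℝ) : Prop :=
  ∀ ζ : E N → ℝ, IsTest ζ → (∀ x, 0 ≤ ζ x) →
    ∫ x, ζ x * g x = -∫ x, f x * (N * ζ x + fderiv ℝ ζ x x)

lemma memLp_test_mul_rpow_sub_two_mul {p s : ℝ} {u ζ : E N → ℝ} (hp : 1 < p) (hps : p ≤ s)
    (hu : MemLp u (ENNReal.ofReal s) volume) (hζ : IsTest ζ) :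
    MemLp (fun x => ζ x * (|u x| ^ (p - 2) * u x)) (ENNReal.ofReal s.conjExponent) volume := by
  refine memLp_smul_of_memLpLoc hζ.continuous hζ.2 fun C hC => ?_
  have : IsFiniteMeasure (volume.restrict C) := ⟨by simpa using hC.measure_lt_top⟩
  refine ((memLp_rpow_sub_two_mul hp hu).restrict C).mono_exponent (ENNReal.ofReal_le_ofReal ?_)
  exact div_le_div_of_nonneg_left (by linarith) (by linarith) (by linarith)

lemma integral_test_mul_rpow_sub_two_mul_sub_le {p s : ℝ} {u ζ : E N → ℝ} (hp : 1 < p)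
    (hps : p ≤ s) (hu : MemLp u (ENNReal.ofReal s) volume) (hζ : IsTest ζ) (hζ0 : ∀ x, 0 ≤ ζ x)
    {l : ℝ} (hl : 0 < l) :
    (∫ x, ζ x * (|u x| ^ (p - 2) * u x) * u (l • x)) - ∫ x, ζ x * (|u x| ^ (p - 2) * u x) * u x ≤
      1 / p * ((l ^ N)⁻¹ * (∫ x, |u x| ^ p * ζ (l⁻¹ • x)) - ∫ x, |u x| ^ p * ζ x) := by
  have hs : s.HolderConjugate s.conjExponent := .conjExponent (hp.trans_le hps)
  have := (holderConjugate_ofReal hs).symm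
  have hk := memLp_test_mul_rpow_sub_two_mul hp hps hu hζ
  have hint : ∀ v : E N → ℝ, MemLp v (ENNReal.ofReal s) volume →
      Integrable fun x => |v x| ^ p * ζ x := fun v hv =>
    integrable_mul_of_hasCompactSupport ((memLp_abs_rpow (by linarith) hv).locallyIntegrable
      (ENNReal.one_le_ofReal.2 ((one_le_div (by linarith)).2 hps))) hζ.continuous hζ.2
  have i₁ : Integrable fun x => ζ x * (|u x| ^ (p - 2) * u x) * u (l • x) :=
    hk.integrable_mul (memLp_comp_smul hu hl.ne')
  have i₂ : Integrable fun x => ζ x * (|u x| ^ (p - 2) * u x) * u x := hk.integrable_mul hu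
  have i₃ := hint _ (memLp_comp_smul hu hl.ne')
  have i₄ := hint _ hu
  rw [← integral_mul_comp_smul hl (w := fun x => |u x| ^ p), ← integral_sub i₁ i₂]
  simp only [mul_comm (ζ _) (|_| ^ p)]
  rw [← integral_sub i₃ i₄, ← integral_const_mul]
  refine integral_mono (i₁.sub i₂) ((i₃.sub i₄).const_mul _) fun x => ?_
  have h := mul_le_mul_of_nonneg_left (rpow_sub_two_mul_self_mul_sub_le (u x) (u (l • x)) hp)
    (hζ0 x)
  beta_reduce
  linear_combination h

lemma HasWeakGradient.isWeakRadialDeriv_abs_rpow {p s : ℝ} {u : E N → ℝ} {G : E N → E N}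
    (h : HasWeakGradient u G) (hp : 1 < p) (hps : p ≤ s) (hu : MemLp u (ENNReal.ofReal s) volume)
    (hG : MemLpLoc (fun x => ‖G x‖) (ENNReal.ofReal s)) :
    IsWeakRadialDeriv (fun x => |u x| ^ p)
      (fun x => p * (|u x| ^ (p - 2) * u x * inner ℝ (G x) x)) := by
  intro ζ hζ hζ0
  have hs : s.HolderConjugate s.conjExponent := .conjExponent (hp.trans_le hps)
  have := (holderConjugate_ofReal hs).symm
  have hloc : LocallyIntegrable (fun x => |u x| ^ p) volume :=
    (memLp_abs_rpow (by linarith) hu).locallyIntegrable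
      (ENNReal.one_le_ofReal.2 ((one_le_div (by linarith)).2 hps))
  have dl := h.hasDerivAt_integral_of_hasCompactSupport ENNReal.ofReal_ne_top
    (memLp_test_mul_rpow_sub_two_mul hp hps hu hζ) hζ.2.mul_right hu hG
  have du := ((hasDerivAt_inv_pow_one N).fun_mul (hasDerivAt_integral_comp_inv_smul hloc hζ))
  have key := eq_of_hasDerivAt_of_eventually_le
    (dl.sub_const (∫ x, ζ x * (|u x| ^ (p - 2) * u x) * u x))
    ((du.sub_const (∫ x, |u x| ^ p * ζ x)).const_mul (1 / p)) (by simp)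
    (by filter_upwards [lt_mem_nhds (zero_lt_one' ℝ)] with l hl using
      integral_test_mul_rpow_sub_two_mul_sub_le hp hps hu hζ hζ0 hl)
  have expand : ∫ x, |u x| ^ p * (N * ζ x + fderiv ℝ ζ x x) =
      N * (∫ x, |u x| ^ p * ζ x) + ∫ x, |u x| ^ p * fderiv ℝ ζ x x := by
    rw [← integral_const_mul, ← integral_add
      ((integrable_mul_of_hasCompactSupport hloc hζ.continuous hζ.2).const_mul _)
      (integrable_mul_of_hasCompactSupport hloc hζ.continuous_fderiv_self
        hζ.hasCompactSupport_fderiv_self)]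
    simp only [mul_add, mul_left_comm]
  simp only [inv_one, one_smul, one_pow, one_mul] at key
  simp only [mul_left_comm _ p, integral_const_mul, expand]
  simp only [← mul_assoc] at key ⊢
  rw [key]
  field_simp
  ring

/-- The Riesz kernel with `‖x‖ ^ 2` replaced by `‖x‖ ^ 2 + ε`: a smooth kernel increasing to
`riesz N α` as `ε` decreases to `0`. -/
def rieszReg (N : ℕ) (α ε : ℝ) (x : E N) : ℝ :=
  rieszConst N α * (‖x‖ ^ 2 + ε) ^ (-((N - α) / 2))

lemma contDiff_rieszReg {α ε : ℝ} (hε : 0 < ε) : ContDiff ℝ ∞ (rieszReg N α ε) :=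
  contDiff_const.mul <| ((contDiff_norm_sq ℝ).add contDiff_const).rpow_const_of_ne
    fun x => by positivity

lemma rieszReg_nonneg {α ε : ℝ} (hα : 0 < α) (hαN : α < N) (hε : 0 < ε) (x : E N) :
    0 ≤ rieszReg N α ε x :=
  mul_nonneg (rieszConst_pos hα hαN).le (by positivity)

lemma rieszReg_neg (α ε : ℝ) (x : E N) : rieszReg N α ε (-x) = rieszReg N α ε x := by
  simp only [rieszReg, norm_neg]

lemma riesz_eq_rieszReg_zero {α : ℝ} {x : E N} (hx : x ≠ 0) :
    riesz N α x = rieszReg N α 0 x := by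
  have : 0 < ‖x‖ := norm_pos_iff.2 hx
  rw [riesz_eq, rieszReg, add_zero, Real.rpow_neg (by positivity), ← Real.rpow_natCast,
    ← Real.rpow_mul this.le, div_eq_mul_inv]
  congr 3
  push_cast
  ring

lemma rieszReg_le_riesz {α ε : ℝ} (hα : 0 < α) (hαN : α < N) (hε : 0 < ε) {x : E N} (hx : x ≠ 0) :
    rieszReg N α ε x ≤ riesz N α x := by
  have : 0 < ‖x‖ := norm_pos_iff.2 hx
  rw [riesz_eq_rieszReg_zero hx]
  exact mul_le_mul_of_nonneg_left
    (Real.rpow_le_rpow_of_nonpos (by positivity) (by linarith) (by linarith))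
    (rieszConst_pos hα hαN).le

lemma tendsto_rieszReg {α : ℝ} {x : E N} (hx : x ≠ 0) {ε : ℕ → ℝ} (hε : Tendsto ε atTop (𝓝 0)) :
    Tendsto (fun n => rieszReg N α (ε n) x) atTop (𝓝 (riesz N α x)) := by
  have : 0 < ‖x‖ := norm_pos_iff.2 hx
  rw [riesz_eq_rieszReg_zero hx]
  exact ((tendsto_const_nhds.add hε).rpow_const (.inl (by positivity))).const_mul _

lemma fderiv_rieszReg {α ε : ℝ} (hε : 0 < ε) (x v : E N) :
    fderiv ℝ (rieszReg N α ε) x v =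
      -((N - α) * rieszReg N α ε x * (inner ℝ x v / (‖x‖ ^ 2 + ε))) := by
  have hpos : 0 < ‖x‖ ^ 2 + ε := by positivity
  have h : HasFDerivAt (rieszReg N α ε) _ x :=
    (((hasStrictFDerivAt_norm_sq x).hasFDerivAt.add_const ε).rpow_const
      (p := -((N - α) / 2)) (.inl hpos.ne')).const_mul (rieszConst N α)
  rw [h.fderiv, rieszReg]
  simp only [smul_apply, innerSL_apply_apply, smul_eq_mul, nsmul_eq_mul]
  rw [Real.rpow_sub_one hpos.ne']
  field_simp
  push_cast
  ring

lemma ae_sub_ne_zero (hN : 1 ≤ N) :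
    ∀ᵐ z : E N × E N ∂volume.prod volume, z.1 - z.2 ≠ 0 := by
  have : Nonempty (Fin N) := ⟨⟨0, hN⟩⟩
  have hd : MeasurableSet {z : E N × E N | z.1 - z.2 ≠ 0} :=
    (measurable_fst.sub measurable_snd) (measurableSet_singleton 0).compl
  refine (Measure.ae_prod_iff_ae_ae hd).2 (.of_forall fun x => ?_)
  filter_upwards [compl_mem_ae_iff.2 (measure_singleton x)] with y hy h
  exact hy (sub_eq_zero.1 h).symm

section Multiplier

variable {α ε : ℝ} {f g : E N → ℝ}

lemma aestronglyMeasurable_rieszReg_prod (hε : 0 < ε) (hf : AEStronglyMeasurable f volume)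
    (hg : AEStronglyMeasurable g volume) {m : E N × E N → ℝ}
    (hm : AEStronglyMeasurable m (volume.prod volume)) :
    AEStronglyMeasurable (fun z => rieszReg N α ε (z.1 - z.2) * f z.2 * g z.1 * m z)
      (volume.prod volume) :=
  ((((contDiff_rieszReg hε).continuous.comp
    (continuous_fst.sub continuous_snd)).aestronglyMeasurable.mul hf.comp_snd).mul
    hg.comp_fst).mul hm

lemma ae_norm_rieszReg_prod_le (hα : 0 < α) (hαN : α < N) (hε : 0 < ε) (f g : E N → ℝ)
    {m : E N × E N → ℝ} {C : ℝ} (hC : ∀ z, ‖m z‖ ≤ C) :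
    ∀ᵐ z : E N × E N ∂volume.prod volume, ‖rieszReg N α ε (z.1 - z.2) * f z.2 * g z.1 * m z‖ ≤
      ‖riesz N α (z.1 - z.2) * f z.2 * g z.1‖ * C := by
  have hN : 1 ≤ N := by exact_mod_cast hα.trans hαN
  filter_upwards [ae_sub_ne_zero hN] with z hz
  have h := (rieszReg_le_riesz hα hαN hε hz).trans (le_abs_self _)
  simp only [norm_mul]
  rw [Real.norm_of_nonneg (rieszReg_nonneg hα hαN hε _)]
  gcongr
  exacts [h, hC z]

lemma integrable_rieszReg_prod (hα : 0 < α) (hαN : α < N) (hε : 0 < ε)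
    (hf : MemLp f (ENNReal.ofReal (2 * N / (N + α))) volume)
    (hg : MemLp g (ENNReal.ofReal (2 * N / (N + α))) volume) {m : E N × E N → ℝ}
    (hm : AEStronglyMeasurable m (volume.prod volume)) {C : ℝ} (hC : ∀ z, ‖m z‖ ≤ C) :
    Integrable (fun z => rieszReg N α ε (z.1 - z.2) * f z.2 * g z.1 * m z)
      (volume.prod volume) :=
  ((integrable_riesz_prod hα hαN hf hg).norm.mul_const C).mono'
    (aestronglyMeasurable_rieszReg_prod hε hf.1 hg.1 hm)
    (ae_norm_rieszReg_prod_le hα hαN hε f g hC)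

lemma tendsto_integral_rieszReg_prod (hα : 0 < α) (hαN : α < N)
    (hf : MemLp f (ENNReal.ofReal (2 * N / (N + α))) volume)
    (hg : MemLp g (ENNReal.ofReal (2 * N / (N + α))) volume) {m : ℕ → E N × E N → ℝ}
    {m' : E N × E N → ℝ} (hm : ∀ n, AEStronglyMeasurable (m n) (volume.prod volume))
    {C : ℝ} (hC : ∀ n z, ‖m n z‖ ≤ C) {ε : ℕ → ℝ} (hε0 : ∀ n, 0 < ε n)
    (hε : Tendsto ε atTop (𝓝 0))
    (h : ∀ z, z.1 - z.2 ≠ 0 → Tendsto (fun n => m n z) atTop (𝓝 (m' z))) :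
    Tendsto (fun n => ∫ z, rieszReg N α (ε n) (z.1 - z.2) * f z.2 * g z.1 * m n z
      ∂volume.prod volume) atTop
      (𝓝 (∫ z, riesz N α (z.1 - z.2) * f z.2 * g z.1 * m' z ∂volume.prod volume)) := by
  have hN : 1 ≤ N := by exact_mod_cast hα.trans hαN
  refine tendsto_integral_of_dominated_convergence _
    (fun n => aestronglyMeasurable_rieszReg_prod (hε0 n) hf.1 hg.1 (hm n))
    ((integrable_riesz_prod hα hαN hf hg).norm.mul_const C)
    (fun n => ae_norm_rieszReg_prod_le hα hαN (hε0 n) f g (hC n)) ?_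
  filter_upwards [ae_sub_ne_zero hN] with z hz
  exact (((tendsto_rieszReg hz hε).mul_const _).mul_const _).mul (h z hz)

/-- The factor which the vector field `η x • x`, acting on both variables, produces in front of the
kernel `rieszReg N α ε (x - y)`; `ε = 0` is the Riesz kernel itself. -/
def rieszMultiplier (N : ℕ) (α ε : ℝ) (η : E N → ℝ) (z : E N × E N) : ℝ :=
  N * η z.1 + fderiv ℝ η z.1 z.1 -
    (N - α) / 2 * (inner ℝ (z.1 - z.2) (η z.1 • z.1 - η z.2 • z.2) / (‖z.1 - z.2‖ ^ 2 + ε))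

lemma IsTest.measurable_rieszMultiplier {η : E N → ℝ} (hη : IsTest η) (α ε : ℝ) :
    Measurable (rieszMultiplier N α ε η) := by
  have hc : Continuous fun z : E N × E N =>
      inner ℝ (z.1 - z.2) (η z.1 • z.1 - η z.2 • z.2) := by
    have := hη.continuous
    fun_prop
  have hd : Continuous fun z : E N × E N => ‖z.1 - z.2‖ ^ 2 + ε := by fun_prop
  exact (((hη.continuous.comp continuous_fst).measurable.const_mul _).add
    (hη.continuous_fderiv_self.comp continuous_fst).measurable).sub
    ((hc.measurable.div hd.measurable).const_mul _)

lemma norm_rieszMultiplier_le (hαN : α < N) (hε : 0 ≤ ε) {η : E N → ℝ} {B B' L : ℝ}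
    (hB : ∀ x, ‖η x‖ ≤ B) (hB' : ∀ x, ‖fderiv ℝ η x x‖ ≤ B') (hL0 : 0 ≤ L)
    (hL : ∀ x y : E N, |inner ℝ (x - y) (η x • x - η y • y)| ≤ L * ‖x - y‖ ^ 2) (z : E N × E N) :
    ‖rieszMultiplier N α ε η z‖ ≤ N * B + B' + (N - α) / 2 * L := by
  have hquot : ‖inner ℝ (z.1 - z.2) (η z.1 • z.1 - η z.2 • z.2) / (‖z.1 - z.2‖ ^ 2 + ε)‖ ≤ L := by
    rw [norm_div, Real.norm_of_nonneg (by positivity : 0 ≤ ‖z.1 - z.2‖ ^ 2 + ε)]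
    refine div_le_of_le_mul₀ (by positivity) hL0 ((hL _ _).trans ?_)
    gcongr
    linarith
  refine (norm_sub_le _ _).trans (add_le_add ((norm_add_le _ _).trans (add_le_add ?_ (hB' _))) ?_)
  · rw [norm_mul, Real.norm_natCast]
    gcongr
    exact hB _
  · rw [norm_mul, Real.norm_of_nonneg (by linarith)]
    gcongr

lemma tendsto_rieszMultiplier_zero {ε : ℕ → ℝ} (hε : Tendsto ε atTop (𝓝 0)) (α : ℝ) (η : E N → ℝ)
    {z : E N × E N} (hz : z.1 - z.2 ≠ 0) :
    Tendsto (fun n => rieszMultiplier N α (ε n) η z) atTop (𝓝 (rieszMultiplier N α 0 η z)) :=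
  tendsto_const_nhds.sub (tendsto_const_nhds.mul
    (tendsto_const_nhds.div (tendsto_const_nhds.add hε) (by simpa using hz)))

lemma tendsto_rieszMultiplier_cutoff (α : ℝ) {z : E N × E N} (hz : z.1 - z.2 ≠ 0) :
    Tendsto (fun n : ℕ => rieszMultiplier N α 0 (cutoff N (n + 1)) z) atTop
      (𝓝 ((N + α) / 2)) := by
  refine tendsto_const_nhds.congr' ?_
  filter_upwards [eventually_cutoff_eq_one z.1, eventually_cutoff_eq_one z.2,
    eventually_fderiv_cutoff_eq_zero z.1] with n h₁ h₂ h₃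
  have : ‖z.1 - z.2‖ ≠ 0 := norm_ne_zero_iff.2 hz
  rw [rieszMultiplier, h₁, h₂, h₃, one_smul, one_smul, real_inner_self_eq_norm_sq, add_zero,
    div_self (by positivity)]
  simp only [zero_apply]
  ring

lemma norm_div_norm_sq_add_le (hε : 0 < ε) (x : E N) : ‖x‖ / (‖x‖ ^ 2 + ε) ≤ 1 + ε⁻¹ := by
  rw [div_le_iff₀ (by positivity)]
  have : 0 ≤ ε⁻¹ * ‖x‖ ^ 2 + ε := by positivity
  have : (1 + ε⁻¹) * (‖x‖ ^ 2 + ε) = ‖x‖ ^ 2 + 1 + (ε⁻¹ * ‖x‖ ^ 2 + ε) := by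
    field_simp
    ring
  nlinarith [sq_nonneg (‖x‖ - 1)]

lemma IsWeakRadialDeriv.integral_rieszReg_slice (h : IsWeakRadialDeriv f g) (hα : 0 < α)
    (hαN : α < N) (hε : 0 < ε) {η : E N → ℝ} (hη : IsTest η) (hη0 : ∀ x, 0 ≤ η x) (y : E N) :
    ∫ x, rieszReg N α ε (x - y) * f y * (η x * g x) =
      -∫ x, rieszReg N α ε (x - y) * f y * f x * (N * η x + fderiv ℝ η x x - (N - α) *
        (inner ℝ (x - y) (η x • x) / (‖x - y‖ ^ 2 + ε))) := by
  have hr : ContDiff ℝ ∞ fun x => rieszReg N α ε (x - y) :=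
    (contDiff_rieszReg hε).comp (contDiff_id.sub contDiff_const)
  have key := h _ (hη.contDiff_mul hr) fun x => mul_nonneg (rieszReg_nonneg hα hαN hε _) (hη0 x)
  have hl (x : E N) : rieszReg N α ε (x - y) * f y * (η x * g x) =
      f y * (rieszReg N α ε (x - y) * η x * g x) := by ring
  simp only [hl]
  rw [integral_const_mul, key, mul_neg, ← integral_const_mul]
  congr 2
  ext x
  have hd : fderiv ℝ (fun x => rieszReg N α ε (x - y) * η x) x x =
      rieszReg N α ε (x - y) * fderiv ℝ η x x + η x * fderiv ℝ (rieszReg N α ε) (x - y) x := by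
    rw [fderiv_fun_mul (hr.differentiable (by simp) x) (hη.differentiable x), fderiv_comp_sub]
    simp
  rw [hd, fderiv_rieszReg hε, inner_smul_right]
  ring

lemma integral_rieszReg_symm {m : E N × E N → ℝ} :
    ∫ z, rieszReg N α ε (z.1 - z.2) * f z.2 * f z.1 * m z.swap ∂volume.prod volume =
      ∫ z, rieszReg N α ε (z.1 - z.2) * f z.2 * f z.1 * m z ∂volume.prod volume := by
  rw [← integral_prod_swap]
  refine integral_congr_ae (.of_forall fun z => ?_)
  simp only [Prod.fst_swap, Prod.snd_swap, Prod.swap_swap]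
  rw [← neg_sub z.1 z.2, rieszReg_neg]
  ring

lemma continuous_inner_smul_div (hε : 0 < ε) {η : E N → ℝ} (hη : Continuous η) :
    Continuous fun z : E N × E N => inner ℝ (z.1 - z.2) (η z.1 • z.1) / (‖z.1 - z.2‖ ^ 2 + ε) :=
  .div (by fun_prop) (by fun_prop) fun z => by positivity

lemma IsTest.exists_norm_inner_smul_div_le (hε : 0 < ε) {η : E N → ℝ} (hη : IsTest η) :
    ∃ C, ∀ z : E N × E N,
      ‖inner ℝ (z.1 - z.2) (η z.1 • z.1) / (‖z.1 - z.2‖ ^ 2 + ε)‖ ≤ C := by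
  obtain ⟨M, hM⟩ := (hη.2.smul_right (f' := id)).exists_bound_of_continuous
    (hη.continuous.smul continuous_id)
  refine ⟨(1 + ε⁻¹) * M, fun z => ?_⟩
  rw [norm_div, Real.norm_of_nonneg (by positivity : 0 ≤ ‖z.1 - z.2‖ ^ 2 + ε)]
  calc ‖inner ℝ (z.1 - z.2) (η z.1 • z.1)‖ / (‖z.1 - z.2‖ ^ 2 + ε)
      ≤ ‖z.1 - z.2‖ * ‖η z.1 • z.1‖ / (‖z.1 - z.2‖ ^ 2 + ε) := by
        gcongr
        exact norm_inner_le_norm _ _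
    _ = ‖z.1 - z.2‖ / (‖z.1 - z.2‖ ^ 2 + ε) * ‖η z.1 • z.1‖ := mul_div_right_comm _ _ _
    _ ≤ (1 + ε⁻¹) * M := by
        gcongr
        exacts [norm_div_norm_sq_add_le hε _, hM _]

lemma IsTest.integrable_rieszReg_mul_div_prod {η : E N → ℝ} (hη : IsTest η) (hα : 0 < α)
    (hαN : α < N) (hε : 0 < ε) (hf : MemLp f (ENNReal.ofReal (2 * N / (N + α))) volume) :
    Integrable (fun z => rieszReg N α ε (z.1 - z.2) * f z.2 * f z.1 * (N * η z.1 +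
      fderiv ℝ η z.1 z.1 - (N - α) * (inner ℝ (z.1 - z.2) (η z.1 • z.1) /
        (‖z.1 - z.2‖ ^ 2 + ε)))) (volume.prod volume) := by
  obtain ⟨B, hB⟩ := hη.2.exists_bound_of_continuous hη.continuous
  obtain ⟨B', hB'⟩ :=
    hη.hasCompactSupport_fderiv_self.exists_bound_of_continuous hη.continuous_fderiv_self
  obtain ⟨C, hC⟩ := hη.exists_norm_inner_smul_div_le hε
  refine integrable_rieszReg_prod hα hαN hε hf hf
    (((((hη.continuous.comp continuous_fst).const_mul _).add
      (hη.continuous_fderiv_self.comp continuous_fst)).sub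
      ((continuous_inner_smul_div hε hη.continuous).const_mul _)).aestronglyMeasurable)
    (C := N * B + B' + (N - α) * C) fun z => ?_
  refine (norm_sub_le _ _).trans (add_le_add ((norm_add_le _ _).trans (add_le_add ?_ (hB' _))) ?_)
  · rw [norm_mul, Real.norm_natCast]
    gcongr
    exact hB _
  · rw [norm_mul, Real.norm_of_nonneg (by linarith)]
    gcongr
    exact hC z

lemma IsTest.integral_rieszReg_mul_rieszMultiplier {η : E N → ℝ} (hη : IsTest η) (hα : 0 < α)
    (hαN : α < N) (hε : 0 < ε) (hf : MemLp f (ENNReal.ofReal (2 * N / (N + α))) volume) :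
    ∫ z, rieszReg N α ε (z.1 - z.2) * f z.2 * f z.1 * rieszMultiplier N α ε η z
        ∂volume.prod volume =
      ∫ z, rieszReg N α ε (z.1 - z.2) * f z.2 * f z.1 * (N * η z.1 + fderiv ℝ η z.1 z.1 -
        (N - α) * (inner ℝ (z.1 - z.2) (η z.1 • z.1) / (‖z.1 - z.2‖ ^ 2 + ε)))
        ∂volume.prod volume := by
  set b : E N × E N → ℝ := fun z => inner ℝ (z.1 - z.2) (η z.1 • z.1) / (‖z.1 - z.2‖ ^ 2 + ε)
    with hb
  have hbc : Continuous b := continuous_inner_smul_div hε hη.continuous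
  obtain ⟨C, hC⟩ := hη.exists_norm_inner_smul_div_le hε
  have i₀ := hη.integrable_rieszReg_mul_div_prod hα hαN hε hf
  have i₁ := integrable_rieszReg_prod hα hαN hε hf hf hbc.aestronglyMeasurable hC
  have i₂ := integrable_rieszReg_prod hα hαN hε hf hf (m := fun z => b z.swap)
    (hbc.comp continuous_swap).aestronglyMeasurable fun z => hC z.swap
  have hsplit (z : E N × E N) : rieszReg N α ε (z.1 - z.2) * f z.2 * f z.1 *
      rieszMultiplier N α ε η z = rieszReg N α ε (z.1 - z.2) * f z.2 * f z.1 *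
        (N * η z.1 + fderiv ℝ η z.1 z.1 - (N - α) * b z) +
      (N - α) / 2 * (rieszReg N α ε (z.1 - z.2) * f z.2 * f z.1 * b z -
        rieszReg N α ε (z.1 - z.2) * f z.2 * f z.1 * b z.swap) := by
    simp only [rieszMultiplier, hb, Prod.fst_swap, Prod.snd_swap, ← neg_sub z.1 z.2, norm_neg,
      inner_neg_left, inner_sub_right]
    ring
  simp only [hsplit]
  rw [integral_add i₀ (by exact (i₁.sub i₂).const_mul _), integral_const_mul, integral_sub i₁ i₂,
    integral_rieszReg_symm, sub_self, mul_zero, add_zero]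

lemma IsWeakRadialDeriv.integral_rieszReg_prod (h : IsWeakRadialDeriv f g) (hα : 0 < α)
    (hαN : α < N) (hε : 0 < ε) (hf : MemLp f (ENNReal.ofReal (2 * N / (N + α))) volume)
    {η : E N → ℝ} (hη : IsTest η) (hη0 : ∀ x, 0 ≤ η x)
    (hg : MemLp (fun x => η x * g x) (ENNReal.ofReal (2 * N / (N + α))) volume) :
    ∫ z, rieszReg N α ε (z.1 - z.2) * f z.2 * (η z.1 * g z.1) ∂volume.prod volume =
      -∫ z, rieszReg N α ε (z.1 - z.2) * f z.2 * f z.1 * rieszMultiplier N α ε η z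
        ∂volume.prod volume := by
  have i : Integrable (fun z => rieszReg N α ε (z.1 - z.2) * f z.2 * (η z.1 * g z.1))
      (volume.prod volume) := by
    simpa only [mul_one] using integrable_rieszReg_prod hα hαN hε hf hg
      (m := fun _ => 1) aestronglyMeasurable_const (C := 1) (by simp)
  rw [integral_prod_symm _ i, hη.integral_rieszReg_mul_rieszMultiplier hα hαN hε hf,
    integral_prod_symm _ (hη.integrable_rieszReg_mul_div_prod hα hαN hε hf), ← integral_neg]
  exact integral_congr_ae (.of_forall (h.integral_rieszReg_slice hα hαN hε hη hη0))

lemma integral_rieszConv_mul (hα : 0 < α) (hαN : α < N)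
    (hf : MemLp f (ENNReal.ofReal (2 * N / (N + α))) volume)
    (hg : MemLp g (ENNReal.ofReal (2 * N / (N + α))) volume) :
    ∫ x, rieszConv α f x * g x =
      ∫ z, riesz N α (z.1 - z.2) * f z.2 * g z.1 ∂volume.prod volume := by
  rw [integral_prod _ (integrable_riesz_prod hα hαN hf hg)]
  simp only [integral_mul_const]
  rfl

lemma IsWeakRadialDeriv.integral_rieszConv_mul (h : IsWeakRadialDeriv f g) (hα : 0 < α)
    (hαN : α < N) (hf : MemLp f (ENNReal.ofReal (2 * N / (N + α))) volume)
    {η : E N → ℝ} (hη : IsTest η) (hη0 : ∀ x, 0 ≤ η x) {L : ℝ} (hL0 : 0 ≤ L)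
    (hL : ∀ x y : E N, |inner ℝ (x - y) (η x • x - η y • y)| ≤ L * ‖x - y‖ ^ 2)
    (hg : MemLp (fun x => η x * g x) (ENNReal.ofReal (2 * N / (N + α))) volume) :
    ∫ x, rieszConv α f x * (η x * g x) =
      -∫ z, riesz N α (z.1 - z.2) * f z.2 * f z.1 * rieszMultiplier N α 0 η z
        ∂volume.prod volume := by
  have hε := tendsto_one_div_add_atTop_nhds_zero_nat (𝕜 := ℝ)
  have hε0 : ∀ n : ℕ, 0 < 1 / ((n : ℝ) + 1) := fun n => by positivity
  obtain ⟨B, hB⟩ := hη.2.exists_bound_of_continuous hη.continuous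
  obtain ⟨B', hB'⟩ :=
    hη.hasCompactSupport_fderiv_self.exists_bound_of_continuous hη.continuous_fderiv_self
  have lhs := tendsto_integral_rieszReg_prod hα hαN hf hg (m := fun _ _ => 1)
    (m' := fun _ => 1) (fun _ => aestronglyMeasurable_const) (C := 1) (by simp) hε0 hε
    (fun _ _ => tendsto_const_nhds)
  have rhs := tendsto_integral_rieszReg_prod hα hαN hf hf
    (fun n => (hη.measurable_rieszMultiplier α (1 / ((n : ℝ) + 1))).aestronglyMeasurable)
    (fun n => norm_rieszMultiplier_le hαN (hε0 n).le hB hB' hL0 hL) hε0 hε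
    (fun z hz => tendsto_rieszMultiplier_zero hε α η hz)
  simp only [mul_one] at lhs
  rw [ChoquardSP.integral_rieszConv_mul hα hαN hf hg]
  exact tendsto_nhds_unique lhs (rhs.neg.congr fun n =>
    (h.integral_rieszReg_prod hα hαN (hε0 n) hf hη hη0 hg).symm)

lemma tendsto_integral_mul_of_bounded {X : Type*} [MeasurableSpace X] {μ : Measure X} {g : X → ℝ}
    (hg : Integrable g μ) {m : ℕ → X → ℝ} {m' : X → ℝ} (hm : ∀ n, AEStronglyMeasurable (m n) μ)
    {C : ℝ} (hC : ∀ n x, ‖m n x‖ ≤ C)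
    (h : ∀ᵐ x ∂μ, Tendsto (fun n => m n x) atTop (𝓝 (m' x))) :
    Tendsto (fun n => ∫ x, g x * m n x ∂μ) atTop (𝓝 (∫ x, g x * m' x ∂μ)) := by
  refine tendsto_integral_of_dominated_convergence _ (fun n => hg.1.mul (hm n))
    (hg.norm.mul_const C) (fun n => .of_forall fun x => ?_) ?_
  · rw [norm_mul]
    exact mul_le_mul_of_nonneg_left (hC n x) (norm_nonneg _)
  · filter_upwards [h] with x hx using tendsto_const_nhds.mul hx

/-- `N + α` is the degree of homogeneity of the Riesz energy under dilations, and the energy is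
quadratic in `f`. -/
lemma IsWeakRadialDeriv.tendsto_integral_rieszConv_mul_cutoff (h : IsWeakRadialDeriv f g)
    (hα : 0 < α) (hαN : α < N) (hf : MemLp f (ENNReal.ofReal (2 * N / (N + α))) volume)
    (hg : ∀ n : ℕ, MemLp (fun x => cutoff N (n + 1) x * g x) (ENNReal.ofReal (2 * N / (N + α)))
      volume) :
    Tendsto (fun n : ℕ => ∫ x, rieszConv α f x * (cutoff N (n + 1) x * g x)) atTop
      (𝓝 (-((N + α) / 2 * ∫ x, rieszConv α f x * f x))) := by
  have hN : 1 ≤ N := by exact_mod_cast hα.trans hαN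
  obtain ⟨L, hL0, hL⟩ := exists_inner_cutoff_smul_sub_le N
  obtain ⟨C, -, hC⟩ := exists_norm_fderiv_cutoff_mul_le N
  have hn (n : ℕ) : (0 : ℝ) < n + 1 := by positivity
  have bound (n : ℕ) (z : E N × E N) := norm_rieszMultiplier_le hαN le_rfl
    (norm_cutoff_le_one (N := N) (n + 1))
    (fun x => (ContinuousLinearMap.le_opNorm _ _).trans (hC _ (hn n) x)) hL0 (hL _ (hn n)) z
  rw [ChoquardSP.integral_rieszConv_mul hα hαN hf hf, ← integral_const_mul]
  simp only [mul_comm ((N + α) / 2)]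
  refine (tendsto_integral_mul_of_bounded (integrable_riesz_prod hα hαN hf hf)
    (fun n => ((isTest_cutoff_nat N n).measurable_rieszMultiplier α 0).aestronglyMeasurable)
    bound ?_).neg.congr fun n => (h.integral_rieszConv_mul hα hαN hf (isTest_cutoff_nat N n)
      (cutoff_nonneg _) hL0 (hL _ (hn n)) (hg n)).symm
  filter_upwards [ae_sub_ne_zero hN] with z hz using tendsto_rieszMultiplier_cutoff α hz

end Multiplier

/-- `(u, φ)` is a weak solution of the system with coupling constant `K` in the energy class, with
weak gradients `Du` and `Dφ`. The conditions on the parameters are part of the structure. -/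
structure IsEnergySolution (N : ℕ) (α p q K : ℝ) (u φ : E N → ℝ) (Du Dφ : E N → E N) : Prop where
  hN : 3 ≤ N
  hα : 0 < α
  hαN : α < N
  hp : 1 < p
  hq : 1 < q
  hK : K ≠ 0
  wu : HasWeakGradient u Du
  wφ : HasWeakGradient φ Dφ
  u2 : MemLp u 2 volume
  Du2 : MemLp Du 2 volume
  φ2 : MemLp φ 2 volume
  Dφ2 : MemLp Dφ 2 volume
  uσ : MemLp u (ENNReal.ofReal (2 * N * p / (N + α))) volume
  Duσ : MemLpLoc (fun x => ‖Du x‖) (ENNReal.ofReal (2 * N * p / (N + α)))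
  Kuq : MemLp (fun x => K * |u x| ^ q) (ENNReal.ofReal (2 * N / (N + 2))) volume
  eq₁ : ∀ η : E N → ℝ, IsTest η →
    (∫ x, fderiv ℝ η x (Du x)) + (∫ x, u x * η x) +
        (∫ x, K * φ x * (|u x| ^ (q - 2) * u x) * η x) =
      ∫ x, rieszConv α (fun y => |u y| ^ p) x * (|u x| ^ (p - 2) * u x) * η x
  eq₂ : ∀ η : E N → ℝ, IsTest η → ∫ x, fderiv ℝ η x (Dφ x) = ∫ x, K * |u x| ^ q * η x

namespace IsEnergySolution

variable {α p q K : ℝ} {u φ : E N → ℝ} {Du Dφ : E N → E N}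

lemma three_le (S : IsEnergySolution N α p q K u φ Du Dφ) : (3 : ℝ) ≤ N := by
  exact_mod_cast S.hN

lemma holderConjugate_two_star (S : IsEnergySolution N α p q K u φ Du Dφ) :
    (2 * N / (N + 2) : ℝ).HolderConjugate (2 * N / (N - 2)) :=
  (holderConjugate_riesz two_pos (by linarith [S.three_le])).symm

lemma lt_exponent_choquard (S : IsEnergySolution N α p q K u φ Du Dφ) :
    p < 2 * N * p / (N + α) := by
  rw [mul_div_right_comm]
  exact lt_mul_of_one_lt_left (by linarith [S.hp]) (holderConjugate_riesz S.hα S.hαN).symm.lt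

lemma lt_exponent_coupling (S : IsEnergySolution N α p q K u φ Du Dφ) :
    q < 2 * N * q / (N + 2) := by
  rw [mul_div_right_comm]
  exact lt_mul_of_one_lt_left (by linarith [S.hq]) S.holderConjugate_two_star.lt

lemma holderConjugate_choquard (S : IsEnergySolution N α p q K u φ Du Dφ) :
    ENNReal.HolderConjugate (ENNReal.ofReal (2 * N * p / (N + α)).conjExponent)
      (ENNReal.ofReal (2 * N * p / (N + α))) :=
  holderConjugate_ofReal
    (Real.HolderConjugate.conjExponent (S.hp.trans S.lt_exponent_choquard)).symm

lemma holderConjugate_coupling (S : IsEnergySolution N α p q K u φ Du Dφ) :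
    ENNReal.HolderConjugate (ENNReal.ofReal (2 * N * q / (N + 2)).conjExponent)
      (ENNReal.ofReal (2 * N * q / (N + 2))) :=
  holderConjugate_ofReal
    (Real.HolderConjugate.conjExponent (S.hq.trans S.lt_exponent_coupling)).symm

lemma uτ (S : IsEnergySolution N α p q K u φ Du Dφ) :
    MemLp u (ENNReal.ofReal (2 * N * q / (N + 2))) volume := by
  have h : MemLp (fun x => |u x| ^ q) (ENNReal.ofReal (2 * N / (N + 2))) volume := by
    simpa only [inv_mul_cancel_left₀ S.hK] using S.Kuq.const_mul K⁻¹
  simpa only [mul_div_right_comm] using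
    memLp_of_memLp_abs_rpow (by linarith [S.hq]) S.u2.1 h

lemma φstar (S : IsEnergySolution N α p q K u φ Du Dφ) :
    MemLp φ (ENNReal.ofReal (2 * N / (N - 2))) volume :=
  S.wφ.memLp_sobolev S.hN S.φ2 S.Dφ2

lemma memLp_abs_rpow (S : IsEnergySolution N α p q K u φ Du Dφ) :
    MemLp (fun x => |u x| ^ p) (ENNReal.ofReal (2 * N / (N + α))) volume := by
  have hp := S.hp
  have h := ChoquardSP.memLp_abs_rpow (by linarith) S.uσ
  rwa [div_right_comm, mul_div_cancel_right₀ _ (by linarith)] at h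

lemma memLp_choquard (S : IsEnergySolution N α p q K u φ Du Dφ) :
    MemLp (fun x => rieszConv α (fun y => |u y| ^ p) x * (|u x| ^ (p - 2) * u x))
      (ENNReal.ofReal (2 * N * p / (N + α)).conjExponent) volume := by
  have hu := S.uσ
  rw [mul_div_right_comm] at hu ⊢
  exact memLp_mul_rpow_sub_two_mul (holderConjugate_riesz S.hα S.hαN).symm S.hp
    (memLp_rieszConv S.hα S.hαN S.memLp_abs_rpow) hu

lemma memLp_coupling (S : IsEnergySolution N α p q K u φ Du Dφ) :
    MemLp (fun x => K * φ x * (|u x| ^ (q - 2) * u x))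
      (ENNReal.ofReal (2 * N * q / (N + 2)).conjExponent) volume := by
  have hu := S.uτ
  rw [mul_div_right_comm] at hu ⊢
  exact memLp_mul_rpow_sub_two_mul S.holderConjugate_two_star S.hq (S.φstar.const_mul K) hu

lemma integrable_Kuq_mul (S : IsEnergySolution N α p q K u φ Du Dφ) {v : E N → ℝ}
    (hv : MemLp v (ENNReal.ofReal (2 * N / (N - 2))) volume) :
    Integrable fun x => K * |u x| ^ q * v x :=
  have := holderConjugate_ofReal S.holderConjugate_two_star
  S.Kuq.integrable_mul hv

lemma integrable_coupling_mul (S : IsEnergySolution N α p q K u φ Du Dφ) {v : E N → ℝ}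
    (hv : MemLp v (ENNReal.ofReal (2 * N * q / (N + 2))) volume) :
    Integrable fun x => K * φ x * (|u x| ^ (q - 2) * u x) * v x :=
  have := S.holderConjugate_coupling
  S.memLp_coupling.integrable_mul hv

lemma eq₁_of_hasWeakGradient (S : IsEnergySolution N α p q K u φ Du Dφ) {v : E N → ℝ}
    {G : E N → E N} (h : HasWeakGradient v G) (v2 : MemLp v 2 volume) (G2 : MemLp G 2 volume)
    (vσ : MemLp v (ENNReal.ofReal (2 * N * p / (N + α))) volume)
    (vτ : MemLp v (ENNReal.ofReal (2 * N * q / (N + 2))) volume) :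
    (∫ x, inner ℝ (G x) (Du x)) + (∫ x, u x * v x) +
        (∫ x, K * φ x * (|u x| ^ (q - 2) * u x) * v x) =
      ∫ x, rieszConv α (fun y => |u y| ^ p) x * (|u x| ^ (p - 2) * u x) * v x := by
  have := S.holderConjugate_choquard
  have := S.holderConjugate_coupling
  obtain ⟨η, hη, hηG, hηv⟩ := h.exists_tendsto_test v2 G2
  have hm (n : ℕ) : AEStronglyMeasurable (η n) volume := (hη n).continuous.aestronglyMeasurable
  have tgrad := tendsto_integral_inner S.Du2 G2
    (fun n => (hη n).continuous_gradient.aestronglyMeasurable) hηG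
  have tmass := tendsto_integral_mul S.u2 v2 hm (hηv 2 one_le_two ENNReal.ofNat_ne_top v2)
  have tcoupling := tendsto_integral_mul S.memLp_coupling vτ hm (hηv _
    (ENNReal.one_le_ofReal.2 (S.hq.trans S.lt_exponent_coupling).le) ENNReal.ofReal_ne_top vτ)
  have tchoquard := tendsto_integral_mul S.memLp_choquard vσ hm (hηv _
    (ENNReal.one_le_ofReal.2 (S.hp.trans S.lt_exponent_choquard).le) ENNReal.ofReal_ne_top vσ)
  simp only [real_inner_comm _ (Du _)] at tgrad
  refine tendsto_nhds_unique ((tgrad.add tmass).add tcoupling) (tchoquard.congr fun n => ?_)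
  simp only [← S.eq₁ _ (hη n), inner_gradient_left]

lemma eq₂_of_hasWeakGradient (S : IsEnergySolution N α p q K u φ Du Dφ) {v : E N → ℝ}
    {G : E N → E N} (h : HasWeakGradient v G) (v2 : MemLp v 2 volume) (G2 : MemLp G 2 volume) :
    ∫ x, inner ℝ (G x) (Dφ x) = ∫ x, K * |u x| ^ q * v x := by
  have := holderConjugate_ofReal S.holderConjugate_two_star
  obtain ⟨η, hη, hηG, hηv⟩ := h.exists_tendsto_test v2 G2
  have vstar := h.memLp_sobolev S.hN v2 G2
  have tgrad := tendsto_integral_inner S.Dφ2 G2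
    (fun n => (hη n).continuous_gradient.aestronglyMeasurable) hηG
  have trhs := tendsto_integral_mul S.Kuq vstar
    (fun n => (hη n).continuous.aestronglyMeasurable) (hηv _
      (ENNReal.one_le_ofReal.2 S.holderConjugate_two_star.symm.lt.le) ENNReal.ofReal_ne_top vstar)
  simp only [real_inner_comm _ (Dφ _)] at tgrad
  refine tendsto_nhds_unique tgrad (trhs.congr fun n => ?_)
  simp only [← S.eq₂ _ (hη n), inner_gradient_left]

lemma integral_norm_sq_Dφ (S : IsEnergySolution N α p q K u φ Du Dφ) :
    ∫ x, ‖Dφ x‖ ^ 2 = ∫ x, K * |u x| ^ q * φ x := by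
  simpa only [real_inner_self_eq_norm_sq] using S.eq₂_of_hasWeakGradient S.wφ S.φ2 S.Dφ2

lemma nehari (S : IsEnergySolution N α p q K u φ Du Dφ) :
    (∫ x, ‖Du x‖ ^ 2) + (∫ x, u x ^ 2) + (∫ x, ‖Dφ x‖ ^ 2) =
      ∫ x, rieszConv α (fun y => |u y| ^ p) x * |u x| ^ p := by
  have h := S.eq₁_of_hasWeakGradient S.wu S.u2 S.Du2 S.uσ S.uτ
  simp only [real_inner_self_eq_norm_sq, mul_assoc, ← sq,
    rpow_sub_two_mul_self_mul_self _ S.hp,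
    rpow_sub_two_mul_self_mul_self _ S.hq] at h
  rw [S.integral_norm_sq_Dφ, ← h]
  simp only [mul_comm (φ _), mul_assoc]

lemma ae_mul_φ_nonneg (S : IsEnergySolution N α p q K u φ Du Dφ) : ∀ᵐ x, 0 ≤ K * φ x := by
  refine (S.wφ.const_mul K).ae_nonneg_of_superharmonic S.hN (S.φ2.const_mul K)
    (S.Dφ2.const_smul K) fun w H hw w2 H2 hw0 => ?_
  simp only [inner_smul_right, integral_const_mul, S.eq₂_of_hasWeakGradient hw w2 H2]
  rw [← integral_const_mul]
  refine integral_nonneg fun x => ?_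
  have hw0x : 0 ≤ w x := hw0 x
  have h : K * (K * |u x| ^ q * w x) = K ^ 2 * (|u x| ^ q * w x) := by ring
  beta_reduce
  rw [h]
  positivity

end IsEnergySolution

lemma hasDerivAt_integral_inner_smul_sub_bound {F : Type*} [NormedAddCommGroup F] {G : E N → F}
    (hG : MemLp G 2 volume) {η : E N → ℝ} (hη : IsTest η) (k : ℕ) :
    HasDerivAt (fun l : ℝ => 1 / 2 * ((l ^ k) ^ 2 * (l ^ N)⁻¹ *
        (∫ x, ‖G x‖ ^ 2 * η (l⁻¹ • x)) - ∫ x, ‖G x‖ ^ 2 * η x))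
      (1 / 2 * (-(N - 2 * k) * (∫ x, ‖G x‖ ^ 2 * η x) - ∫ x, ‖G x‖ ^ 2 * fderiv ℝ η x x)) 1 := by
  have hint := hasDerivAt_integral_comp_inv_smul
    (hG.integrable_norm_pow two_ne_zero).locallyIntegrable hη
  refine (((((((hasDerivAt_id' (1 : ℝ)).fun_pow k).fun_pow 2).fun_mul
    (hasDerivAt_inv_pow_one N)).fun_mul hint).sub_const _).const_mul (1 / 2)).congr_deriv ?_
  simp only [one_pow, inv_one, one_smul, Nat.cast_ofNat]
  ring

lemma HasWeakGradient.hasDerivAt_integral_inner_dilation_sub_bound {φ : E N → ℝ} {G : E N → E N}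
    (h : HasWeakGradient φ G) (hφ : MemLp φ 2 volume) (hG : MemLp G 2 volume) {η : E N → ℝ}
    (hη : IsTest η) :
    HasDerivAt (fun l : ℝ => 1 / 2 * l⁻¹ * (∫ x, ‖G x‖ ^ 2 * η x) +
        1 / 2 * (l ^ (N + 1))⁻¹ * (∫ x, ‖G x‖ ^ 2 * η (l⁻¹ • x)) - (∫ x, ‖G x‖ ^ 2 * η x) +
        ((l ^ (N + 1))⁻¹ * (∫ x, inner ℝ (φ (l⁻¹ • x) • gradient η (l⁻¹ • x)) (G x)) -
          ∫ x, inner ℝ (φ x • gradient η x) (G x)))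
      (1 / 2 * (-(N + 2) * (∫ x, ‖G x‖ ^ 2 * η x) - ∫ x, ‖G x‖ ^ 2 * fderiv ℝ η x x) -
        (N + 1) * (∫ x, inner ℝ (φ x • gradient η x) (G x)) -
        ∑ i : Fin N, ∫ x, G x i *
          (fderiv ℝ η x (EuclideanSpace.single i 1) * inner ℝ (G x) x +
            fderiv ℝ (fun y => fderiv ℝ η y (EuclideanSpace.single i 1)) x x * φ x)) 1 := by
  have hint := hasDerivAt_integral_comp_inv_smul
    (hG.integrable_norm_pow two_ne_zero).locallyIntegrable hη
  have hinv := hasDerivAt_inv (one_ne_zero (α := ℝ))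
  have hgrad := HasDerivAt.comp (1 : ℝ)
    (by simpa only [inv_one] using
      h.hasDerivAt_integral_smul_gradient hφ hG (fun C _ => hG.norm.restrict C) hη) hinv
  refine (((((hinv.const_mul (1 / 2)).mul_const _).fun_add
    (((hasDerivAt_inv_pow_one (N + 1)).const_mul (1 / 2)).fun_mul hint)).sub_const _).fun_add
    (((hasDerivAt_inv_pow_one (N + 1)).fun_mul hgrad).sub_const _)).congr_deriv ?_
  simp only [Function.comp_apply, one_pow, inv_one, one_smul, Nat.cast_add, Nat.cast_one]
  ring

namespace IsEnergySolution

variable {α p q K : ℝ} {u φ : E N → ℝ} {Du Dφ : E N → E N}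

lemma integral_coupling_sub_le (S : IsEnergySolution N α p q K u φ Du Dφ) {η : E N → ℝ}
    (hη : IsTest η) (hη0 : ∀ x, 0 ≤ η x) {l : ℝ} (hl : 0 < l) :
    ∫ x, K * φ x * (|u x| ^ (q - 2) * u x) * (η x * (u (l • x) - u x)) ≤
      1 / q * ∫ x, K * |u x| ^ q * ((l ^ N)⁻¹ * (η (l⁻¹ • x) * φ (l⁻¹ • x)) - η x * φ x) := by
  have hηφ := hη.memLp_smul S.φstar
  have hconj := holderConjugate_ofReal S.holderConjugate_two_star
  have hv : MemLp (fun x => η x * (u (l • x) - u x))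
      (ENNReal.ofReal (2 * N * q / (N + 2))) volume :=
    hη.memLp_smul ((memLp_comp_smul S.uτ hl.ne').sub S.uτ)
  have i₁ : Integrable fun x => K * |u (l • x)| ^ q * (η x * φ x) :=
    (memLp_comp_smul S.Kuq hl.ne').integrable_mul hηφ
  have i₂ : Integrable fun x => K * |u x| ^ q * (η x * φ x) := S.integrable_Kuq_mul hηφ
  have i₃ : Integrable fun x => K * |u x| ^ q * (η (l⁻¹ • x) * φ (l⁻¹ • x)) :=
    S.integrable_Kuq_mul (memLp_comp_smul hηφ (inv_ne_zero hl.ne'))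
  have change : ∫ x, K * |u (l • x)| ^ q * (η x * φ x) =
      ∫ x, (l ^ N)⁻¹ * (K * |u x| ^ q * (η (l⁻¹ • x) * φ (l⁻¹ • x))) := by
    simpa only [mul_comm (K * _) (_ * _), integral_const_mul] using
      integral_mul_comp_smul hl (w := fun x => K * |u x| ^ q) (ζ := fun x => η x * φ x)
  calc _ ≤ ∫ x, 1 / q * (K * |u (l • x)| ^ q * (η x * φ x) - K * |u x| ^ q * (η x * φ x)) := by
        refine integral_mono_ae (S.integrable_coupling_mul hv) ((i₁.sub i₂).const_mul _) ?_
        filter_upwards [S.ae_mul_φ_nonneg] with x hx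
        have h := mul_le_mul_of_nonneg_left
          (rpow_sub_two_mul_self_mul_sub_le (u x) (u (l • x)) S.hq) (mul_nonneg hx (hη0 x))
        linear_combination h
    _ = _ := by
        rw [integral_const_mul, integral_sub i₁ i₂, change,
          ← integral_sub (i₃.const_mul _) i₂]
        congr 2 with x
        ring

lemma integral_coupling_dilation_le (S : IsEnergySolution N α p q K u φ Du Dφ) {η : E N → ℝ}
    (hη : IsTest η) (hη0 : ∀ x, 0 ≤ η x) {l : ℝ} (hl : 0 < l) :
    ∫ x, K * φ x * (|u x| ^ (q - 2) * u x) * (η x * (u (l • x) - u x)) ≤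
      1 / q * (1 / 2 * l⁻¹ * (∫ x, ‖Dφ x‖ ^ 2 * η x) +
        1 / 2 * (l ^ (N + 1))⁻¹ * (∫ x, ‖Dφ x‖ ^ 2 * η (l⁻¹ • x)) - (∫ x, ‖Dφ x‖ ^ 2 * η x) +
        ((l ^ (N + 1))⁻¹ * (∫ x, inner ℝ (φ (l⁻¹ • x) • gradient η (l⁻¹ • x)) (Dφ x)) -
          ∫ x, inner ℝ (φ x • gradient η x) (Dφ x))) := by
  have hq := S.hq
  have hl' : 0 < l⁻¹ := inv_pos.2 hl
  have w := S.wφ.contDiff_mul hη.1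
  have w2 := hη.memLp_smul S.φ2
  have G2 := (hη.memLp_smul S.Dφ2).add (hη.memLp_smul_gradient S.φ2)
  have htest := S.eq₂_of_hasWeakGradient (((w.comp_smul hl').const_mul (l ^ N)⁻¹).sub w)
    (((memLp_comp_smul w2 hl'.ne').const_mul _).sub w2)
    ((((memLp_comp_smul G2 hl'.ne').const_smul l⁻¹).const_smul (l ^ N)⁻¹).sub G2)
  refine (S.integral_coupling_sub_le hη hη0 hl).trans
    (mul_le_mul_of_nonneg_left ?_ (by positivity))
  rw [← htest]
  exact integral_inner_dilation_sub_le S.φ2 S.Dφ2 hη hη0 hl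

lemma eq₁_dilation (S : IsEnergySolution N α p q K u φ Du Dφ) {η : E N → ℝ} (hη : IsTest η)
    {l : ℝ} (hl : 0 < l) :
    (∫ x, inner ℝ (η x • (l • Du (l • x) - Du x)) (Du x)) +
        ((∫ x, fderiv ℝ η x (Du x) * u (l • x)) - ∫ x, fderiv ℝ η x (Du x) * u x) +
        (∫ x, u x * (η x * (u (l • x) - u x))) +
        (∫ x, K * φ x * (|u x| ^ (q - 2) * u x) * (η x * (u (l • x) - u x))) =
      (∫ x, η x * (rieszConv α (fun y => |u y| ^ p) x * (|u x| ^ (p - 2) * u x)) * u (l • x)) -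
        ∫ x, η x * (rieszConv α (fun y => |u y| ^ p) x * (|u x| ^ (p - 2) * u x)) * u x := by
  have := S.holderConjugate_choquard
  have hdiff {r : ℝ≥0∞} (hu : MemLp u r volume) := (memLp_comp_smul hu hl.ne').sub hu
  have hDη := hη.memLp_fderiv_apply S.Du2
  have hc := hη.memLp_smul S.memLp_choquard
  have g₁ : MemLp (fun x => η x • (l • Du (l • x) - Du x)) 2 volume :=
    hη.memLp_smul (((memLp_comp_smul S.Du2 hl.ne').const_smul l).sub S.Du2)
  have g₂ := hη.memLp_smul_gradient (hdiff S.u2)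
  have htest := S.eq₁_of_hasWeakGradient (((S.wu.comp_smul hl).sub S.wu).contDiff_mul hη.1)
    (hη.memLp_smul (hdiff S.u2)) (g₁.add g₂) (hη.memLp_smul (hdiff S.uσ))
    (hη.memLp_smul (hdiff S.uτ))
  have i₁ : Integrable fun x => fderiv ℝ η x (Du x) * u (l • x) :=
    hDη.integrable_mul (memLp_comp_smul S.u2 hl.ne')
  have i₂ : Integrable fun x => fderiv ℝ η x (Du x) * u x := hDη.integrable_mul S.u2
  rw [← integral_sub i₁ i₂, ← integral_add (integrable_inner g₁ S.Du2) (by exact i₁.sub i₂),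
    ← integral_sub (by exact hc.integrable_mul (memLp_comp_smul S.uσ hl.ne'))
      (by exact hc.integrable_mul S.uσ)]
  convert htest using 3
  · congr 1 with x
    rw [inner_add_left, real_inner_smul_left (gradient η x), inner_gradient_left]
    ring
  · ring

lemma choquard_dilation_sub_le (S : IsEnergySolution N α p q K u φ Du Dφ) {η : E N → ℝ}
    (hη : IsTest η) (hη0 : ∀ x, 0 ≤ η x) {l : ℝ} (hl : 0 < l) :
    (∫ x, η x * (rieszConv α (fun y => |u y| ^ p) x * (|u x| ^ (p - 2) * u x)) * u (l • x)) -
        (∫ x, η x * (rieszConv α (fun y => |u y| ^ p) x * (|u x| ^ (p - 2) * u x)) * u x) -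
        ((∫ x, fderiv ℝ η x (Du x) * u (l • x)) - ∫ x, fderiv ℝ η x (Du x) * u x) ≤
      1 / 2 * ((l ^ 1) ^ 2 * (l ^ N)⁻¹ *
        (∫ x, ‖Du x‖ ^ 2 * η (l⁻¹ • x)) - ∫ x, ‖Du x‖ ^ 2 * η x) +
      1 / 2 * ((l ^ 0) ^ 2 * (l ^ N)⁻¹ *
        (∫ x, ‖u x‖ ^ 2 * η (l⁻¹ • x)) - ∫ x, ‖u x‖ ^ 2 * η x) +
      1 / q * (1 / 2 * l⁻¹ * (∫ x, ‖Dφ x‖ ^ 2 * η x) +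
        1 / 2 * (l ^ (N + 1))⁻¹ * (∫ x, ‖Dφ x‖ ^ 2 * η (l⁻¹ • x)) - (∫ x, ‖Dφ x‖ ^ 2 * η x) +
        ((l ^ (N + 1))⁻¹ * (∫ x, inner ℝ (φ (l⁻¹ • x) • gradient η (l⁻¹ • x)) (Dφ x)) -
          ∫ x, inner ℝ (φ x • gradient η x) (Dφ x))) := by
  have heq := S.eq₁_dilation hη hl
  have hDu := integral_inner_smul_sub_le S.Du2 hη hη0 hl (l ^ 1)
  have hu := integral_inner_smul_sub_le S.u2 hη hη0 hl (l ^ 0)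
  have hcoupling := S.integral_coupling_dilation_le hη hη0 hl
  have hmass : ∫ x, inner ℝ (η x • (l ^ 0 • u (l • x) - u x)) (u x) =
      ∫ x, u x * (η x * (u (l • x) - u x)) := by
    simp only [pow_zero, smul_eq_mul, RCLike.inner_apply, conj_trivial, one_mul]
  rw [hmass] at hu
  simp only [pow_one] at hDu ⊢
  linarith

lemma local_pohozaev (S : IsEnergySolution N α p q K u φ Du Dφ) {η : E N → ℝ}
    (hη : IsTest η) (hη0 : ∀ x, 0 ≤ η x) :
    1 / 2 * (-(N - 2) * (∫ x, ‖Du x‖ ^ 2 * η x) - ∫ x, ‖Du x‖ ^ 2 * fderiv ℝ η x x) +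
      1 / 2 * (-N * (∫ x, ‖u x‖ ^ 2 * η x) - ∫ x, ‖u x‖ ^ 2 * fderiv ℝ η x x) +
      1 / q * (1 / 2 * (-(N + 2) * (∫ x, ‖Dφ x‖ ^ 2 * η x) - ∫ x, ‖Dφ x‖ ^ 2 * fderiv ℝ η x x) -
        (N + 1) * (∫ x, inner ℝ (φ x • gradient η x) (Dφ x)) -
        ∑ i : Fin N, ∫ x, Dφ x i *
          (fderiv ℝ η x (EuclideanSpace.single i 1) * inner ℝ (Dφ x) x +
            fderiv ℝ (fun y => fderiv ℝ η y (EuclideanSpace.single i 1)) x x * φ x)) +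
      (∫ x, fderiv ℝ η x (Du x) * inner ℝ (Du x) x) =
    ∫ x, η x * (rieszConv α (fun y => |u y| ^ p) x * (|u x| ^ (p - 2) * u x)) *
      inner ℝ (Du x) x := by
  have := S.holderConjugate_choquard
  have hchoquard := S.wu.hasDerivAt_integral_of_hasCompactSupport ENNReal.ofReal_ne_top
    (hη.memLp_smul S.memLp_choquard) hη.2.mul_right S.uσ S.Duσ
  have hcross := S.wu.hasDerivAt_integral_of_hasCompactSupport ENNReal.ofNat_ne_top
    (hη.memLp_fderiv_apply S.Du2) ((hη.2.fderiv ℝ).mono' fun x hx =>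
      subset_tsupport _ fun h => hx (by simp [h])) S.u2 (fun C _ => S.Du2.norm.restrict C)
  have hupper := ((hasDerivAt_integral_inner_smul_sub_bound S.Du2 hη 1).fun_add
    (hasDerivAt_integral_inner_smul_sub_bound S.u2 hη 0)).fun_add
    ((S.wφ.hasDerivAt_integral_inner_dilation_sub_bound S.φ2 S.Dφ2 hη).const_mul (1 / q))
  have hle := (lt_mem_nhds (zero_lt_one (α := ℝ))).mono
    fun l hl => S.choquard_dilation_sub_le hη hη0 hl
  have heq := eq_of_hasDerivAt_of_eventually_le
    ((hchoquard.sub_const _).fun_sub (hcross.sub_const _)) hupper ?_ hle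
  · simp only [Nat.cast_one, Nat.cast_zero, mul_one, mul_zero, sub_zero, smul_eq_mul] at heq
    linarith
  · simp only [one_pow, inv_one, one_smul, smul_eq_mul]
    ring

end IsEnergySolution

section CutoffLimits

lemma tendsto_integral_zero_of_norm_le_fderiv_cutoff {F : ℕ → E N → ℝ} {g : E N → ℝ}
    (hg : Integrable g) (hF : ∀ n, AEStronglyMeasurable (F n) volume)
    (h : ∀ n x, ‖F n x‖ ≤ ‖fderiv ℝ (cutoff N (n + 1)) x‖ * ‖x‖ * ‖g x‖) :
    Tendsto (fun n => ∫ x, F n x) atTop (𝓝 0) := by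
  obtain ⟨C, -, hC⟩ := exists_norm_fderiv_cutoff_mul_le N
  rw [← integral_zero (E N) ℝ (μ := volume)]
  refine tendsto_integral_of_dominated_convergence _ hF (hg.norm.const_mul C)
    (fun n => .of_forall fun x => (h n x).trans
      (mul_le_mul_of_nonneg_right (hC _ (by positivity) x) (norm_nonneg _)))
    (.of_forall fun x => squeeze_zero_norm (h · x) (tendsto_const_nhds.congr' ?_))
  filter_upwards [eventually_fderiv_cutoff_eq_zero x] with n hn
  rw [hn, norm_zero, zero_mul, zero_mul]

lemma tendsto_integral_mul_cutoff {g : E N → ℝ} (hg : Integrable g) :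
    Tendsto (fun n : ℕ => ∫ x, g x * cutoff N (n + 1) x) atTop (𝓝 (∫ x, g x)) := by
  simpa only [mul_one] using tendsto_integral_mul_of_bounded hg
    (fun n => (isTest_cutoff_nat N n).continuous.aestronglyMeasurable)
    (fun n => norm_cutoff_le_one _) (.of_forall tendsto_cutoff)

lemma tendsto_integral_mul_fderiv_cutoff_self {g : E N → ℝ} (hg : Integrable g) :
    Tendsto (fun n : ℕ => ∫ x, g x * fderiv ℝ (cutoff N (n + 1)) x x) atTop (𝓝 0) := by
  refine tendsto_integral_zero_of_norm_le_fderiv_cutoff hg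
    (fun n => hg.1.mul (isTest_cutoff_nat N n).continuous_fderiv_self.aestronglyMeasurable)
    fun n x => ?_
  rw [norm_mul, mul_comm]
  gcongr
  exact ContinuousLinearMap.le_opNorm _ _

lemma tendsto_integral_fderiv_cutoff_mul_inner_self {G : E N → E N} (hG : MemLp G 2 volume) :
    Tendsto (fun n : ℕ => ∫ x, fderiv ℝ (cutoff N (n + 1)) x (G x) * inner ℝ (G x) x) atTop
      (𝓝 0) := by
  refine tendsto_integral_zero_of_norm_le_fderiv_cutoff (hG.integrable_norm_pow two_ne_zero)
    (fun n => ((isTest_cutoff_nat N n).memLp_fderiv_apply hG).1.mul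
      (hG.1.inner aestronglyMeasurable_id)) fun n x => ?_
  calc ‖fderiv ℝ (cutoff N (n + 1)) x (G x) * inner ℝ (G x) x‖
      ≤ ‖fderiv ℝ (cutoff N (n + 1)) x‖ * ‖G x‖ * (‖G x‖ * ‖x‖) :=
        norm_mul_le_of_le (ContinuousLinearMap.le_opNorm _ _) (norm_inner_le_norm _ _)
    _ = ‖fderiv ℝ (cutoff N (n + 1)) x‖ * ‖x‖ * ‖‖G x‖ ^ 2‖ := by
        rw [norm_pow, norm_norm]
        ring

lemma tendsto_integral_inner_smul_gradient_cutoff {φ : E N → ℝ} {G : E N → E N}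
    (hφ : MemLp φ 2 volume) (hG : MemLp G 2 volume) :
    Tendsto (fun n : ℕ => ∫ x, inner ℝ (φ x • gradient (cutoff N (n + 1)) x) (G x)) atTop
      (𝓝 0) := by
  simpa only [inner_zero_right, integral_zero, real_inner_comm] using
    tendsto_integral_inner hG (MemLp.zero' (p := 2))
      (e := fun n x => φ x • gradient (cutoff N (n + 1)) x)
      (fun n => ((isTest_cutoff_nat N n).memLp_smul_gradient hφ).1)
      (by simpa only [sub_zero] using
        tendsto_eLpNorm_smul_gradient_cutoff ENNReal.ofNat_ne_top hφ)

lemma tendsto_integral_mul_fderiv_fderiv_cutoff {g : E N → ℝ} (hg : Integrable g) (v : E N) :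
    Tendsto (fun n : ℕ => ∫ x, g x * fderiv ℝ (fun y => fderiv ℝ (cutoff N (n + 1)) y v) x x)
      atTop (𝓝 0) := by
  obtain ⟨M, hM0, hM⟩ := exists_fderiv_fderiv_cutoff_le N v
  have bound (n : ℕ) (x : E N) :
      ‖fderiv ℝ (fun y => fderiv ℝ (cutoff N (n + 1)) y v) x x‖ ≤ M / (n + 1) :=
    hM _ (by positivity) x
  have hlim : Tendsto (fun n : ℕ => M / ((n : ℝ) + 1)) atTop (𝓝 0) := by
    simpa only [mul_one_div, mul_zero] using
      tendsto_one_div_add_atTop_nhds_zero_nat.const_mul M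
  simpa only [mul_zero, integral_zero] using tendsto_integral_mul_of_bounded hg
    (fun n => ((isTest_cutoff_nat N n).fderiv_apply v).continuous_fderiv_self.aestronglyMeasurable)
    (fun n x => (bound n x).trans (div_le_self hM0 (by simp)))
    (.of_forall fun x => squeeze_zero_norm (bound · x) hlim)

lemma tendsto_integral_fderiv_cutoff_apply {φ : E N → ℝ} {G : E N → E N} (hφ : MemLp φ 2 volume)
    (hG : MemLp G 2 volume) (i : Fin N) :
    Tendsto (fun n : ℕ => ∫ x, G x i *
      (fderiv ℝ (cutoff N (n + 1)) x (EuclideanSpace.single i 1) * inner ℝ (G x) x +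
        fderiv ℝ (fun y => fderiv ℝ (cutoff N (n + 1)) y (EuclideanSpace.single i 1)) x x * φ x))
      atTop (𝓝 0) := by
  have hη (n : ℕ) := (isTest_cutoff_nat N n).fderiv_apply (EuclideanSpace.single i 1)
  have hφG : Integrable fun x => G x i * φ x := (hG.eval_piLp i).integrable_mul hφ
  have int₁ (n : ℕ) : Integrable fun x => G x i *
      (fderiv ℝ (cutoff N (n + 1)) x (EuclideanSpace.single i 1) * inner ℝ (G x) x) :=
    (hG.eval_piLp i).integrable_mul (memLp_smul_of_memLpLoc (hη n).continuous (hη n).2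
      (memLpLoc_inner_self hG.1 fun C _ => hG.norm.restrict C))
  have int₂ (n : ℕ) : Integrable fun x => G x i * φ x *
      fderiv ℝ (fun y => fderiv ℝ (cutoff N (n + 1)) y (EuclideanSpace.single i 1)) x x :=
    integrable_mul_of_hasCompactSupport hφG.locallyIntegrable (hη n).continuous_fderiv_self
      (hη n).hasCompactSupport_fderiv_self
  have lim₁ : Tendsto (fun n : ℕ => ∫ x, G x i *
      (fderiv ℝ (cutoff N (n + 1)) x (EuclideanSpace.single i 1) * inner ℝ (G x) x))
      atTop (𝓝 0) := by
    refine tendsto_integral_zero_of_norm_le_fderiv_cutoff (hG.integrable_norm_pow two_ne_zero)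
      (fun n => (int₁ n).1) fun n x => ?_
    calc _ ≤ ‖G x‖ * ((‖fderiv ℝ (cutoff N (n + 1)) x‖ * 1) * (‖G x‖ * ‖x‖)) := by
          refine norm_mul_le_of_le (PiLp.norm_apply_le _ _)
            (norm_mul_le_of_le ?_ (norm_inner_le_norm _ _))
          exact ContinuousLinearMap.le_opNorm_of_le _ (by simp)
      _ = _ := by
          rw [norm_pow, norm_norm]
          ring
  have h := lim₁.add (tendsto_integral_mul_fderiv_fderiv_cutoff hφG (EuclideanSpace.single i 1))
  rw [add_zero] at h
  refine h.congr fun n => ?_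
  rw [← integral_add (int₁ n) (int₂ n)]
  exact integral_congr_ae (.of_forall fun x => by ring)

end CutoffLimits

namespace IsEnergySolution

variable {α p q K : ℝ} {u φ : E N → ℝ} {Du Dφ : E N → E N}

lemma memLp_mul_radial_choquard (S : IsEnergySolution N α p q K u φ Du Dφ) {η : E N → ℝ}
    (hη : IsTest η) :
    MemLp (fun x => η x * (p * (|u x| ^ (p - 2) * u x * inner ℝ (Du x) x)))
      (ENNReal.ofReal (2 * N / (N + α))) volume := by
  have h3 := S.three_le
  have hp := S.hp
  have hα := S.hα
  have hN : (N : ℝ) + α ≠ 0 := by linarith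
  have : ENNReal.HolderTriple (ENNReal.ofReal (2 * N * p / (N + α) / (p - 1)))
      (ENNReal.ofReal (2 * N * p / (N + α))) (ENNReal.ofReal (2 * N / (N + α))) :=
    holderTriple_ofReal (div_pos (by positivity) (by linarith)) (by positivity) (by positivity)
      (by field_simp [sub_ne_zero.2 hp.ne']; ring)
  have hDu := memLp_smul_of_memLpLoc hη.continuous hη.2 (memLpLoc_inner_self S.Du2.1 S.Duσ)
  refine ((hDu.mul (memLp_rpow_sub_two_mul hp S.uσ)).const_mul p).ae_eq
    (.of_forall fun x => ?_)
  simp only [Pi.mul_apply, smul_eq_mul]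
  ring

lemma tendsto_integral_choquard (S : IsEnergySolution N α p q K u φ Du Dφ) :
    Tendsto (fun n : ℕ => ∫ x, cutoff N (n + 1) x *
      (rieszConv α (fun y => |u y| ^ p) x * (|u x| ^ (p - 2) * u x)) * inner ℝ (Du x) x) atTop
      (𝓝 (-((N + α) / (2 * p) * ∫ x, rieszConv α (fun y => |u y| ^ p) x * |u x| ^ p))) := by
  have hp : p ≠ 0 := by linarith [S.hp]
  have h := ((S.wu.isWeakRadialDeriv_abs_rpow S.hp S.lt_exponent_choquard.le S.uσ S.Duσ
    ).tendsto_integral_rieszConv_mul_cutoff S.hα S.hαN S.memLp_abs_rpow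
    fun n => S.memLp_mul_radial_choquard (isTest_cutoff_nat N n)).const_mul p⁻¹
  convert h using 2 with n
  · rw [← integral_const_mul]
    congr! 2
    field_simp
  · field_simp

lemma pohozaev (S : IsEnergySolution N α p q K u φ Du Dφ) :
    (N - 2) / 2 * (∫ x, ‖Du x‖ ^ 2) + N / 2 * (∫ x, u x ^ 2) +
        (N + 2) / (2 * q) * (∫ x, ‖Dφ x‖ ^ 2) =
      (N + α) / (2 * p) * ∫ x, rieszConv α (fun y => |u y| ^ p) x * |u x| ^ p := by
  have hu := S.u2.integrable_norm_pow two_ne_zero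
  have hDu := S.Du2.integrable_norm_pow two_ne_zero
  have hDφ := S.Dφ2.integrable_norm_pow two_ne_zero
  have lim := (((((tendsto_integral_mul_cutoff hDu).const_mul (-((N : ℝ) - 2))).sub
        (tendsto_integral_mul_fderiv_cutoff_self hDu)).const_mul (1 / 2)).add
      ((((tendsto_integral_mul_cutoff hu).const_mul (-(N : ℝ))).sub
        (tendsto_integral_mul_fderiv_cutoff_self hu)).const_mul (1 / 2)) |>.add
      ((((((tendsto_integral_mul_cutoff hDφ).const_mul (-((N : ℝ) + 2))).sub
        (tendsto_integral_mul_fderiv_cutoff_self hDφ)).const_mul (1 / 2)).sub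
        ((tendsto_integral_inner_smul_gradient_cutoff S.φ2 S.Dφ2).const_mul ((N : ℝ) + 1))).sub
        (tendsto_finsetSum Finset.univ fun i _ =>
          tendsto_integral_fderiv_cutoff_apply S.φ2 S.Dφ2 i) |>.const_mul (1 / q))).add
      (tendsto_integral_fderiv_cutoff_mul_inner_self S.Du2)
  have key := tendsto_nhds_unique (lim.congr fun n =>
    S.local_pohozaev (isTest_cutoff_nat N n) (cutoff_nonneg _)) S.tendsto_integral_choquard
  simp only [Real.norm_eq_abs, sq_abs, Finset.sum_const_zero] at key
  have hq : (N + 2) / (2 * q) = 1 / q * ((N + 2) / 2) := by ring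
  rw [hq]
  linarith

lemma ae_eq_zero_of_integral_norm_sq {F : Type*} [NormedAddCommGroup F] {G : E N → F}
    (hG : MemLp G 2 volume) (h : ∫ x, ‖G x‖ ^ 2 = 0) : G =ᵐ[volume] 0 := by
  filter_upwards [(integral_eq_zero_iff_of_nonneg (fun x => sq_nonneg ‖G x‖)
    (hG.integrable_norm_pow two_ne_zero)).1 h] with x hx
  exact norm_eq_zero.1 (eq_zero_of_pow_eq_zero hx)

lemma nehari_pohozaev (S : IsEnergySolution N α p q K u φ Du Dφ) :
    (N - 2 - (N + α) / p) * (∫ x, ‖Du x‖ ^ 2) + (N - (N + α) / p) * (∫ x, u x ^ 2) +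
      ((N + 2) / q - (N + α) / p) * ∫ x, ‖Dφ x‖ ^ 2 = 0 := by
  have h := S.pohozaev
  rw [← S.nehari, mul_comm 2 q, mul_comm 2 p, ← div_div, ← div_div] at h
  linear_combination 2 * h

lemma u_eq_zero (S : IsEnergySolution N α p q K u φ Du Dφ)
    (hcond : ((N + α) / (N - 2) ≤ p ∧ (N + α) / p ≤ (N + 2) / q) ∨
      (p ≤ (N + α) / N ∧ (N + 2) / q ≤ (N + α) / p)) :
    u =ᵐ[volume] 0 := by
  have h3 := S.three_le
  have hp : 0 < p := by linarith [S.hp]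
  have hDu : 0 ≤ ∫ x, ‖Du x‖ ^ 2 := integral_nonneg fun x => sq_nonneg _
  have hu : 0 ≤ ∫ x, u x ^ 2 := integral_nonneg fun x => sq_nonneg _
  have hDφ : 0 ≤ ∫ x, ‖Dφ x‖ ^ 2 := integral_nonneg fun x => sq_nonneg _
  rcases hcond with ⟨hpN, hpq⟩ | ⟨hpN, hpq⟩
  · have ha : (N + α) / p ≤ N - 2 := (div_le_comm₀ (by linarith) hp).1 hpN
    refine ae_eq_zero_of_integral_norm_sq S.u2 ?_
    simp only [Real.norm_eq_abs, sq_abs]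
    nlinarith [S.nehari_pohozaev, mul_nonneg (sub_nonneg.2 ha) hDu,
      mul_nonneg (sub_nonneg.2 ha) hu, mul_nonneg (sub_nonneg.2 hpq) hDφ]
  · have ha : N ≤ (N + α) / p := (le_div_comm₀ hp (by linarith)).1 hpN
    refine S.wu.eq_zero S.hN S.u2 (ae_eq_zero_of_integral_norm_sq S.Du2 ?_)
    nlinarith [S.nehari_pohozaev, mul_nonneg (sub_nonneg.2 ha) hDu,
      mul_nonneg (sub_nonneg.2 ha) hu, mul_nonneg (sub_nonneg.2 hpq) hDφ]

lemma φ_eq_zero (S : IsEnergySolution N α p q K u φ Du Dφ) (hu : u =ᵐ[volume] 0) :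
    φ =ᵐ[volume] 0 := by
  have hq : q ≠ 0 := by linarith [S.hq]
  refine S.wφ.eq_zero S.hN S.φ2 (ae_eq_zero_of_integral_norm_sq S.Dφ2 ?_)
  rw [S.integral_norm_sq_Dφ]
  refine integral_eq_zero_of_ae (hu.mono fun x hx => ?_)
  simp [hx, Real.zero_rpow hq]

end IsEnergySolution

lemma exists_isEnergySolution {α p q K : ℝ} {u φ : E N → ℝ} (hN : 3 ≤ N) (hα : 0 < α)
    (hαN : α < N) (hp : 1 < p) (hq : 1 < q) (hK : K ≠ 0)
    (h : IsWeakSolution α p q (fun _ => K) u φ) (hu : MemH1 u)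
    (huσ : MemLp u (ENNReal.ofReal (2 * N * p / (N + α))) volume) (hφ : MemH1 φ)
    (hKuq : MemLp (fun x => K * |u x| ^ q) (ENNReal.ofReal (2 * N / (N + 2))) volume)
    (hDu : ∃ Du : E N → E N, HasWeakGradient u Du ∧
      MemLpLoc (fun x => ‖Du x‖) (ENNReal.ofReal (2 * N * p / (N + α)))) :
    ∃ Du Dφ, IsEnergySolution N α p q K u φ Du Dφ := by
  obtain ⟨Du, Dφ, wu, wφ, eq₁, eq₂⟩ := h
  obtain ⟨u2, G, hG, G2⟩ := hu
  obtain ⟨φ2, H, hH, H2⟩ := hφ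
  obtain ⟨D, hD, Dσ⟩ := hDu
  have hDDu : D =ᵐ[volume] Du := hD.unique wu
  exact ⟨Du, Dφ, hN, hα, hαN, hp, hq, hK, wu, wφ, u2, G2.ae_eq (hG.unique wu), φ2,
    H2.ae_eq (hH.unique wφ), huσ,
    fun C hC => (Dσ C hC).ae_eq (ae_restrict_of_ae (hDDu.fun_comp norm)), hKuq, eq₁, eq₂⟩

lemma isWeakSolution_of_ae_eq_zero {α p q K : ℝ} {u φ : E N → ℝ} (hq : q ≠ 0)
    (hu : u =ᵐ[volume] 0) (hφ : φ =ᵐ[volume] 0) : IsWeakSolution α p q (fun _ => K) u φ := by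
  refine ⟨fun _ => 0, fun _ => 0, HasWeakGradient.zero.congr hu.symm .rfl,
    HasWeakGradient.zero.congr hφ.symm .rfl, fun η _ => ?_, fun η _ => ?_⟩
  · rw [integral_eq_zero_of_ae (f := fun x => fderiv ℝ η x 0)
        (.of_forall fun x => by simp),
      integral_eq_zero_of_ae (f := fun x => u x * η x) (hu.mono fun x hx => by simp [hx]),
      integral_eq_zero_of_ae (f := fun x => K * φ x * (|u x| ^ (q - 2) * u x) * η x)
        (hu.mono fun x hx => by simp [hx]),
      integral_eq_zero_of_ae
        (f := fun x => rieszConv α (fun y => |u y| ^ p) x * (|u x| ^ (p - 2) * u x) * η x)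
        (hu.mono fun x hx => by simp [hx]), add_zero, add_zero]
  · rw [integral_eq_zero_of_ae (f := fun x => fderiv ℝ η x 0)
        (.of_forall fun x => by simp),
      integral_eq_zero_of_ae (f := fun x => K * |u x| ^ q * η x)
        (hu.mono fun x hx => by simp [hx, Real.zero_rpow hq])]

lemma isRegular_of_ae_eq_zero {α p q K : ℝ} {u φ : E N → ℝ} (hq : q ≠ 0)
    (hu : u =ᵐ[volume] 0) (hφ : φ =ᵐ[volume] 0) : IsRegular α p q (fun _ => K) u φ := by
  have memLp {f : E N → ℝ} (hf : f =ᵐ[volume] 0) (r : ℝ≥0∞) : MemLp f r volume :=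
    MemLp.zero.ae_eq hf.symm
  have grad {f : E N → ℝ} (hf : f =ᵐ[volume] 0) : HasWeakGradient f fun _ => 0 :=
    HasWeakGradient.zero.congr hf.symm .rfl
  have hKuq : (fun x => K * |u x| ^ q) =ᵐ[volume] 0 :=
    hu.mono fun x hx => by simp [hx, Real.zero_rpow hq]
  refine ⟨⟨memLp hu _, _, grad hu, MemLp.zero⟩, memLp hu _, ⟨memLp hφ _, _, grad hφ, MemLp.zero⟩,
    memLp hKuq _, _, grad hu, ⟨fun C _ => ?_, _, grad (.of_eq ?_), fun C _ => ?_⟩,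
    fun C _ => ?_⟩
  · simp
  · exact funext fun _ => norm_zero
  · simp
  · simp

end ChoquardSP

end

theorem corollary2p3_general (N : ℕ) (hN : 3 ≤ N) (α p q : ℝ) (hα : 0 < α) (hαN : α < N)
    (hp : 1 < p) (hq : 1 < q) (K : ℝ) (hK : K ≠ 0)
    (hcond :
      (((N : ℝ) + α) / ((N : ℝ) - 2) ≤ p ∧ ((N : ℝ) + α) / p ≤ ((N : ℝ) + 2) / q) ∨
      (p ≤ ((N : ℝ) + α) / (N : ℝ) ∧ ((N : ℝ) + 2) / q ≤ ((N : ℝ) + α) / p))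
    (u φ : ChoquardSP.E N → ℝ) (h : ChoquardSP.IsWeakSolution α p q (fun _ => K) u φ)
    (hu : ChoquardSP.MemH1 u) (huσ : MemLp u (ENNReal.ofReal (2 * N * p / (N + α))) volume)
    (hφ : ChoquardSP.MemH1 φ)
    (hKuq : MemLp (fun x => K * |u x| ^ q) (ENNReal.ofReal (2 * N / (N + 2))) volume)
    (hDu : ∃ Du : ChoquardSP.E N → ChoquardSP.E N, ChoquardSP.HasWeakGradient u Du ∧
      ChoquardSP.MemLpLoc (fun x => ‖Du x‖) (ENNReal.ofReal (2 * N * p / (N + α)))) :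
    u =ᵐ[volume] 0 ∧ φ =ᵐ[volume] 0 := by
  obtain ⟨Du, Dφ, S⟩ :=
    ChoquardSP.exists_isEnergySolution hN hα hαN hp hq hK h hu huσ hφ hKuq hDu
  exact ⟨S.u_eq_zero hcond, S.φ_eq_zero (S.u_eq_zero hcond)⟩

theorem corollary2p3 (N : ℕ) (hN : 3 ≤ N) (α p q : ℝ) (hα : 0 < α) (hαN : α < N)
    (hp : 1 < p) (hq : 1 < q) (K : ℝ) (hK : 0 < K)
    (hcond :
      (((N : ℝ) + α) / ((N : ℝ) - 2) ≤ p ∧ ((N : ℝ) + α) / p ≤ ((N : ℝ) + 2) / q) ∨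
      (p ≤ ((N : ℝ) + α) / (N : ℝ) ∧ ((N : ℝ) + 2) / q < ((N : ℝ) + α) / p))
    (u φ : ChoquardSP.E N → ℝ) :
    (ChoquardSP.IsWeakSolution α p q (fun _ => K) u φ ∧
        ChoquardSP.IsRegular α p q (fun _ => K) u φ) ↔
      (u =ᵐ[MeasureTheory.volume] 0 ∧ φ =ᵐ[MeasureTheory.volume] 0) := by
  refine ⟨fun ⟨hw, hu, huσ, hφ, hKuq, Du, hDu, _, hDuσ⟩ => ?_, fun ⟨hu, hφ⟩ => ?_⟩
  · exact corollary2p3_general N hN α p q hα hαN hp hq K hK.ne'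
      (hcond.imp_right (And.imp_right le_of_lt)) u φ hw hu huσ hφ hKuq ⟨Du, hDu, hDuσ⟩
  · have hq₀ : q ≠ 0 := by linarith
    exact ⟨ChoquardSP.isWeakSolution_of_ae_eq_zero hq₀ hu hφ,
      ChoquardSP.isRegular_of_ae_eq_zero hq₀ hu hφ⟩
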